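/- Notation. $\mathcal S(\mathbb R)$ and $\mathcal S'(\mathbb R)$ are the Schwartz functions and the tempered distributions. A *submultiplicative weight* on $\mathbb R^2$ is a locally integrable $v:\mathbb R^2\to[0,\infty)$ with $v(y+z)\le v(y)v(z)$; it is *subexponential* if $v(z)\le Ce^{\gamma\|z\|_\infty^{\beta}}$ for some $C,\gamma>0$ and $0<\beta<1$. A locally integrable $w:\mathbb R^2\to[0,\infty)$ is *$v$-moderate* if $w(y+z)\le C\,w(y)\,v(z)$ for some $C>0$. For $1\le p,q\le\infty$, $$\|f\|_{L^{p,q}_w}=\Big\|\,\xi\mapsto\big\|w(\cdot,\xi)f(\cdot,\xi)\big\|_{L^p(\mathbb R)}\Big\|_{L^q(\mathbb R)},$$ and, with $\mathfrak g(x)=2^{1/4}e^{-\pi x^2}$ and $V_{\mathfrak g}F(t,\nu)=\langle F,\,e^{2\pi i\nu\,\cdot}\,\mathfrak g(\cdot-t)\rangle$, $M^{p,q}_w(\mathbb R)$ consists of the $F\in\mathcal S'(\mathbb R)$ with $\|F\|_{M^{p,q}_w}=\|V_{\mathfrak g}F\|_{L^{p,q}_w}<\infty$ ($M^{\infty,\infty}$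 is the case $p=q=\infty$, $w\equiv1$). A continuous linear operator $H:\mathcal S(\mathbb R)\to\mathcal S'(\mathbb R)$ has a Kohn–Nirenberg symbol $\sigma_H\in\mathcal S'(\mathbb R^2)$, given by $Hf(x)=\int\sigma_H(x,\xi)\widehat f(\xi)e^{2\pi ix\xi}\,d\xi$ in the sense of distributions, and a spreading function $\eta_H=\mathcal F^s\sigma_H$, where $\mathcal F^sF(t,\nu)=\iint F(x,\xi)e^{-2\pi i(\nu x-\xi t)}\,dx\,d\xi$. For $M\subseteq\mathbb R^2$, $OPW^{p,q}_w(M)$ is the space of all such $H$ with $\operatorname{supp}\eta_H\subseteq M$ and $\sigma_H\in L^{p,q}_w(\mathbb R^2)$, with norm $\|H\|_{OPW^{p,q}_w}=\|\sigma_H\|_{L^{p,q}_w}$. For $g\in M^{\infty,\infty}(\mathbb R)$, $Hg$ denotes the common weak-$*$ limit in $\mathcal S'(\mathbb R)$ of $Hf_k$ over the sequences $f_k\in\mathcal S(\mathbb R)$ that are bounded in $M^{\infty,\infty}(\mathbb R)$ and converge weak-$*$ to $g$. For $K,L\in\mathbb N$ let $\mathcal U_{K,L}$ be the family of finite unions of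 rectangles $[0,\frac1K)\times[0,\frac KL)+(\frac kK,\frac{mK}L)$, $k,m\in\mathbb Z$. The *outer Jordan content* $\mathrm{vol}^+(M)$ of $M\subseteq\mathbb R^2$ is the infimum of the areas of all $U\supseteq M$ with $U\in\mathcal U_{K,L}$ for some $K,L\in\mathbb N$ (it is $\infty$ if $M$ is unbounded). **Theorem.** Let $1\le p,q\le\infty$, and let $w=w_1\otimes w_2$ (that is, $w(x,\xi)=w_1(x)w_2(\xi)$) be moderate with respect to a subexponential submultiplicative weight on $\mathbb R^2$. If $M\subseteq\mathbb R^2$ satisfies $\mathrm{vol}^+(M)<1$, then $OPW^{p,q}_w(M)$, mapping $M^{\infty,\infty}(\mathbb R)$ to $M^{p,q}_w(\mathbb R)$, permits operator sampling: there are $x_j\in\mathbb R$, $c_j\in\mathbb C$ such that $g=\sum_jc_j\delta_{x_j}\in M^{\infty,\infty}(\mathbb R)$ and, with constants $A,B>0$, $A\|H\|_{OPW^{p,q}_w}\le\|Hg\|_{M^{p,q}_w}\le B\|H\|_{OPW^{p,q}_w}$ for all $H\in OPW^{p,q}_w(M)$. In fact there exist $L>0$, a periodic sequence $(c_n)_{n\in\mathbb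 Z}$ of complex numbers and $A,B>0$ such that $\sum_nc_n\delta_{n/L}\in M^{\infty,\infty}(\mathbb R)$, $H\sum_nc_n\delta_{n/L}$ is well defined for every $H\in OPW^{p,q}_w(M)$, and $$A\,\|H\|_{OPW^{p,q}_w}\ \le\ \Big\|H\sum_{n\in\mathbb Z}c_n\delta_{n/L}\Big\|_{M^{p,q}_w}\ \le\ B\,\|H\|_{OPW^{p,q}_w},\qquad H\in OPW^{p,q}_w(M).$$ -/

import Mathlib

open MeasureTheory SchwartzMap FourierTransform Filter Topology
open scoped ENNReal NNReal

noncomputable section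

namespace OperatorSampling

/-! ### Schwartz functions used as building blocks -/

/-- `x ↦ e^{iθ(x)}` is smooth with polynomially bounded derivatives when `θ` is. -/
theorem hasTemperateGrowth_cexp_I {E : Type*} [NormedAddCommGroup E] [NormedSpace ℝ E]
    {θ : E → ℝ} (hθ : θ.HasTemperateGrowth) :
    (fun x => Complex.exp ((θ x : ℂ) * Complex.I)).HasTemperateGrowth := by
  have h1 : (fun s : ℝ => Complex.exp ((s : ℂ) * Complex.I)).HasTemperateGrowth := by
    have hd : ∀ n : ℕ, iteratedDeriv n (fun s : ℝ => Complex.exp ((s : ℂ) * Complex.I)) =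
        fun s : ℝ => Complex.I ^ n * Complex.exp ((s : ℂ) * Complex.I) := by
      intro n
      induction n with
      | zero => simp
      | succ n ih =>
        rw [iteratedDeriv_succ, ih]
        funext s
        have h2 : HasDerivAt (fun s : ℝ => Complex.exp ((s : ℂ) * Complex.I))
            (Complex.exp ((s : ℂ) * Complex.I) * (1 * Complex.I)) s :=
          ((Complex.ofRealCLM.hasDerivAt (x := s)).mul_const Complex.I).cexp
        rw [(h2.const_mul (Complex.I ^ n)).deriv]
        ring
    refine ⟨?_, fun n => ⟨0, 1, fun s => ?_⟩⟩
    · exact Complex.contDiff_exp.comp (Complex.ofRealCLM.contDiff.mul contDiff_const)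
    · rw [norm_iteratedFDeriv_eq_norm_iteratedDeriv, hd]
      simp [Complex.norm_exp_ofReal_mul_I]
  exact h1.comp hθ

theorem exists_bound_polynomial_mul_gaussian (P : Polynomial ℝ) :
    ∃ C : ℝ, ∀ x : ℝ, |P.eval x| * Real.exp (-(x ^ 2 / 2)) ≤ C := by
  induction P using Polynomial.induction_on' with
  | add P Q hP hQ =>
    obtain ⟨C, hC⟩ := hP
    obtain ⟨D, hD⟩ := hQ
    refine ⟨C + D, fun x => ?_⟩
    have h := mul_le_mul_of_nonneg_right (abs_add_le (P.eval x) (Q.eval x))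
      (Real.exp_pos (-(x ^ 2 / 2))).le
    rw [Polynomial.eval_add]
    linarith [hC x, hD x]
  | monomial n a =>
    refine ⟨|a| * (n.factorial * Real.exp (1 / 2)), fun x => ?_⟩
    rw [Polynomial.eval_monomial, abs_mul, abs_pow, mul_assoc]
    have h1 : |x| ^ n ≤ n.factorial * Real.exp |x| := by
      have := Real.pow_div_factorial_le_exp |x| (abs_nonneg x) n
      rwa [div_le_iff₀' (by positivity)] at this
    have h2 : Real.exp |x| * Real.exp (-(x ^ 2 / 2)) ≤ Real.exp (1 / 2) := by
      rw [← Real.exp_add]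
      apply Real.exp_le_exp.mpr
      nlinarith [sq_nonneg (|x| - 1), sq_abs x]
    refine mul_le_mul_of_nonneg_left ?_ (abs_nonneg a)
    calc |x| ^ n * Real.exp (-(x ^ 2 / 2))
        ≤ (n.factorial * Real.exp |x|) * Real.exp (-(x ^ 2 / 2)) := by gcongr
      _ = n.factorial * (Real.exp |x| * Real.exp (-(x ^ 2 / 2))) := by ring
      _ ≤ _ := by gcongr

/-- The function `y ↦ e^{-y²/2}` as a Schwartz function. -/
def stdGaussian : 𝓢(ℝ, ℝ) where
  toFun y := Real.exp (-(y ^ 2 / 2))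
  smooth' := by fun_prop
  decay' k n := by
    obtain ⟨C, hC⟩ := exists_bound_polynomial_mul_gaussian
      (Polynomial.X ^ k * (Polynomial.hermite n).map (Int.castRingHom ℝ))
    refine ⟨C, fun x => ?_⟩
    refine le_trans (le_of_eq ?_) (hC x)
    rw [norm_iteratedFDeriv_eq_norm_iteratedDeriv, iteratedDeriv_eq_iterate,
      Polynomial.deriv_gaussian_eq_hermite_mul_gaussian]
    simp [Polynomial.aeval_def, Polynomial.eval_map, abs_mul, mul_assoc]

/-- The normalized Gaussian `𝔤(x) = 2^{1/4} e^{-π x²}` as a Schwartz function. -/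
def gaussianWindow : 𝓢(ℝ, ℂ) :=
  ((2 : ℝ) ^ (1 / 4 : ℝ) : ℝ) • postcompCLM (𝕜 := ℝ) Complex.ofRealCLM
    (compCLMOfContinuousLinearEquiv ℝ
      (ContinuousLinearEquiv.unitsEquivAut ℝ
        (Units.mk0 (Real.sqrt (2 * Real.pi)) (by positivity))) stdGaussian)

theorem gaussianWindow_apply (x : ℝ) :
    gaussianWindow x = (((2 : ℝ) ^ (1 / 4 : ℝ) * Real.exp (-Real.pi * x ^ 2) : ℝ) : ℂ) := by
  have h : (Real.sqrt (2 * Real.pi)) ^ 2 = 2 * Real.pi := Real.sq_sqrt (by positivity)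
  have h' : -((x * Real.sqrt (2 * Real.pi)) ^ 2 / 2) = -Real.pi * x ^ 2 := by
    rw [mul_pow, h]; ring
  have hs : ∀ y : ℝ, stdGaussian y = Real.exp (-(y ^ 2 / 2)) := fun _ => rfl
  rw [← h']
  simp [gaussianWindow, hs]

/-- The time-frequency shift `π(t,ν) φ = M_ν T_t φ`, i.e. `x ↦ e^{2πiνx} φ(x - t)`. -/
def tfShift (t ν : ℝ) (φ : 𝓢(ℝ, ℂ)) : 𝓢(ℝ, ℂ) :=
  smulLeftCLM ℂ (fun x : ℝ => Complex.exp (((2 * Real.pi * ν * x : ℝ) : ℂ) * Complex.I))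
    (compSubConstCLM ℂ t φ)

theorem tfShift_apply (t ν : ℝ) (φ : 𝓢(ℝ, ℂ)) (x : ℝ) :
    tfShift t ν φ x = Complex.exp (((2 * Real.pi * ν * x : ℝ) : ℂ) * Complex.I) * φ (x - t) := by
  unfold tfShift
  rw [smulLeftCLM_apply_apply (hasTemperateGrowth_cexp_I (by fun_prop))]
  simp

/-- The tensor product `(x, ξ) ↦ φ(x) ψ(ξ)` of Schwartz functions. -/
def tensor (φ ψ : 𝓢(ℝ, ℂ)) : 𝓢(ℝ × ℝ, ℂ) where
  toFun z := φ z.1 * ψ z.2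
  smooth' := (φ.smooth'.comp contDiff_fst).mul (ψ.smooth'.comp contDiff_snd)
  decay' k n := by
    have hfst : ∀ i (z : ℝ × ℝ), ‖iteratedFDeriv ℝ i (fun z : ℝ × ℝ => φ z.1) z‖ ≤
        ‖iteratedFDeriv ℝ i φ z.1‖ := by
      intro i z
      have h := (ContinuousLinearMap.fst ℝ ℝ ℝ).iteratedFDeriv_comp_right
        φ.smooth' z (i := i) (by exact_mod_cast le_top)
      have h' : iteratedFDeriv ℝ i (fun z : ℝ × ℝ => φ z.1) z = _ := h
      rw [h']
      refine (ContinuousMultilinearMap.norm_compContinuousLinearMap_le _ _).trans ?_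
      refine mul_le_of_le_one_right (norm_nonneg _) ?_
      exact Finset.prod_le_one (fun _ _ => norm_nonneg _)
        (fun _ _ => ContinuousLinearMap.norm_fst_le ℝ ℝ ℝ)
    have hsnd : ∀ i (z : ℝ × ℝ), ‖iteratedFDeriv ℝ i (fun z : ℝ × ℝ => ψ z.2) z‖ ≤
        ‖iteratedFDeriv ℝ i ψ z.2‖ := by
      intro i z
      have h := (ContinuousLinearMap.snd ℝ ℝ ℝ).iteratedFDeriv_comp_right
        ψ.smooth' z (i := i) (by exact_mod_cast le_top)
      have h' : iteratedFDeriv ℝ i (fun z : ℝ × ℝ => ψ z.2) z = _ := h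
      rw [h']
      refine (ContinuousMultilinearMap.norm_compContinuousLinearMap_le _ _).trans ?_
      refine mul_le_of_le_one_right (norm_nonneg _) ?_
      exact Finset.prod_le_one (fun _ _ => norm_nonneg _)
        (fun _ _ => ContinuousLinearMap.norm_snd_le ℝ ℝ ℝ)
    choose A hA using fun (a b : ℕ) => φ.decay' a b
    choose B hB using fun (a b : ℕ) => ψ.decay' a b
    refine ⟨∑ i ∈ Finset.range (n + 1), (n.choose i : ℝ) *
      (A k i * B 0 (n - i) + A 0 i * B k (n - i)), fun z => ?_⟩
    have hmul := norm_iteratedFDeriv_mul_le (𝕜 := ℝ) (N := ((⊤ : ℕ∞) : WithTop ℕ∞))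
      (f := fun z : ℝ × ℝ => φ z.1) (g := fun z : ℝ × ℝ => ψ z.2)
      (φ.smooth'.comp contDiff_fst) (ψ.smooth'.comp contDiff_snd) z
      (n := n) (by exact_mod_cast le_top)
    refine (mul_le_mul_of_nonneg_left hmul (by positivity)).trans ?_
    rw [Finset.mul_sum]
    refine Finset.sum_le_sum fun i _ => ?_
    have hz : ‖z‖ ^ k ≤ ‖z.1‖ ^ k + ‖z.2‖ ^ k := by
      rw [Prod.norm_def]
      rcases max_choice ‖z.1‖ ‖z.2‖ with h | h <;> rw [h]
      · exact le_add_of_nonneg_right (by positivity)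
      · exact le_add_of_nonneg_left (by positivity)
    set a := ‖iteratedFDeriv ℝ i φ z.1‖
    set b := ‖iteratedFDeriv ℝ (n - i) ψ z.2‖
    have ha : 0 ≤ a := norm_nonneg _
    have hb : 0 ≤ b := norm_nonneg _
    have e1 : ‖z.1‖ ^ k * a ≤ A k i := hA k i z.1
    have e2 : ‖z.2‖ ^ k * b ≤ B k (n - i) := hB k (n - i) z.2
    have e3 : a ≤ A 0 i := le_trans (by simp [a]; rfl) (hA 0 i z.1)
    have e4 : b ≤ B 0 (n - i) := le_trans (by simp [b]; rfl) (hB 0 (n - i) z.2)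
    calc ‖z‖ ^ k * ((n.choose i : ℝ) * ‖iteratedFDeriv ℝ i (fun z : ℝ × ℝ => φ z.1) z‖ *
          ‖iteratedFDeriv ℝ (n - i) (fun z : ℝ × ℝ => ψ z.2) z‖)
        ≤ (‖z.1‖ ^ k + ‖z.2‖ ^ k) * ((n.choose i : ℝ) * a * b) := by
          gcongr
          · exact hfst i z
          · exact hsnd (n - i) z
      _ = (n.choose i : ℝ) * ((‖z.1‖ ^ k * a) * b + a * (‖z.2‖ ^ k * b)) := by ring
      _ ≤ _ := by
          have f1 : (‖z.1‖ ^ k * a) * b ≤ A k i * B 0 (n - i) :=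
            mul_le_mul e1 e4 hb ((by positivity : (0:ℝ) ≤ ‖z.1‖ ^ k * a).trans e1)
          have f2 : a * (‖z.2‖ ^ k * b) ≤ A 0 i * B k (n - i) :=
            mul_le_mul e3 e2 (by positivity) (ha.trans e3)
          gcongr

@[simp] theorem tensor_apply (φ ψ : 𝓢(ℝ, ℂ)) (z : ℝ × ℝ) : tensor φ ψ z = φ z.1 * ψ z.2 := rfl

/-! ### Weights, mixed norms, modulation spaces -/

/-- A submultiplicative weight on the time-frequency plane. -/
structure IsSubmultiplicative (v : ℝ × ℝ → ℝ) : Prop where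
  nonneg : ∀ z, 0 ≤ v z
  locallyIntegrable : LocallyIntegrable v
  map_add_le : ∀ y z, v (y + z) ≤ v y * v z

/-- `w` is a `v`-moderate weight. -/
structure IsModerate (v w : ℝ × ℝ → ℝ) : Prop where
  nonneg : ∀ z, 0 ≤ w z
  locallyIntegrable : LocallyIntegrable w
  exists_map_add_le : ∃ C : ℝ, 0 < C ∧ ∀ y z, w (y + z) ≤ C * w y * v z

/-- `v(z) ≤ C e^{γ ‖z‖^β}` for some `0 < β < 1`, with `‖·‖` the maximum norm. -/
def IsSubexponential (v : ℝ × ℝ → ℝ) : Prop :=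
  ∃ γ C β : ℝ, 0 < γ ∧ 0 < C ∧ 0 < β ∧ β < 1 ∧ ∀ z, v z ≤ C * Real.exp (γ * ‖z‖ ^ β)

/-- The weighted mixed norm `‖f‖_{L_w^{p,q}}`: the `L^p` norm of `w f` in the first variable is
taken first, then the `L^q` norm in the second variable. -/
def mixedNorm (p q : ℝ≥0∞) (w : ℝ × ℝ → ℝ) (f : ℝ × ℝ → ℂ) : ℝ≥0∞ :=
  eLpNorm (fun ξ : ℝ => eLpNorm (fun x : ℝ => (w (x, ξ) : ℂ) * f (x, ξ)) p volume) q volume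

/-- The short-time Fourier transform `V_𝔤 F(t,ν) = ⟨F, π(t,ν)𝔤⟩`. The duality of
distributions and test functions is bilinear, and the complex conjugate of `π(t,ν)𝔤` is
`π(t,-ν)𝔤` because `𝔤` is real. -/
def stft (F : 𝓢'(ℝ, ℂ)) (z : ℝ × ℝ) : ℂ := F (tfShift z.1 (-z.2) gaussianWindow)

/-- The modulation space norm `‖F‖_{M_w^{p,q}}`; `F` belongs to `M_w^{p,q}(ℝ)` when it is finite. -/
def modulationNorm (p q : ℝ≥0∞) (w : ℝ × ℝ → ℝ) (F : 𝓢'(ℝ, ℂ)) : ℝ≥0∞ :=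
  mixedNorm p q w (stft F)

/-! ### Kohn-Nirenberg symbol and spreading function -/

/-- The Schwartz function `(x, ξ) ↦ φ(x) f̂(ξ) e^{2πixξ}`. -/
def symbolTest (f φ : 𝓢(ℝ, ℂ)) : 𝓢(ℝ × ℝ, ℂ) :=
  smulLeftCLM ℂ (fun z : ℝ × ℝ => Complex.exp (((2 * Real.pi * (z.1 * z.2) : ℝ) : ℂ) * Complex.I))
    (tensor φ (𝓕 f))

theorem hasTemperateGrowth_phase :
    (fun z : ℝ × ℝ => 2 * Real.pi * (z.1 * z.2)).HasTemperateGrowth := by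
  have h1 : (fun z : ℝ × ℝ => z.1).HasTemperateGrowth :=
    (ContinuousLinearMap.fst ℝ ℝ ℝ).hasTemperateGrowth
  have h2 : (fun z : ℝ × ℝ => z.2).HasTemperateGrowth :=
    (ContinuousLinearMap.snd ℝ ℝ ℝ).hasTemperateGrowth
  exact (Function.HasTemperateGrowth.const (2 * Real.pi)).mul (h1.mul h2)

theorem symbolTest_apply (f φ : 𝓢(ℝ, ℂ)) (x ξ : ℝ) :
    symbolTest f φ (x, ξ) =
      φ x * 𝓕 (f : ℝ → ℂ) ξ * Complex.exp (((2 * Real.pi * (x * ξ) : ℝ) : ℂ) * Complex.I) := by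
  unfold symbolTest
  rw [smulLeftCLM_apply_apply (hasTemperateGrowth_cexp_I hasTemperateGrowth_phase)]
  simp only [tensor_apply, SchwartzMap.fourier_coe, smul_eq_mul]
  ring

/-- `σ` is the Kohn-Nirenberg symbol of `H`, that is `Hf(x) = ∫ σ(x,ξ) f̂(ξ) e^{2πixξ} dξ` in the
sense of tempered distributions. -/
def IsSymbol (H : 𝓢(ℝ, ℂ) →L[ℂ] 𝓢'(ℝ, ℂ)) (σ : 𝓢'(ℝ × ℝ, ℂ)) : Prop :=
  ∀ f φ : 𝓢(ℝ, ℂ), H f φ = σ (symbolTest f φ)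

open Classical in
/-- The Kohn-Nirenberg symbol `σ_H`. By the Schwartz kernel theorem it exists and is unique, so
the value `0` in the second case is never used. -/
def symbol (H : 𝓢(ℝ, ℂ) →L[ℂ] 𝓢'(ℝ, ℂ)) : 𝓢'(ℝ × ℝ, ℂ) :=
  if h : ∃ σ, IsSymbol H σ then h.choose else 0

/-- The linear map `(x, ξ) ↦ (-ξ, x)`, into the plane with its Euclidean norm. -/
def rotE : (ℝ × ℝ) ≃L[ℝ] WithLp 2 (ℝ × ℝ) :=
  ((ContinuousLinearEquiv.prodComm ℝ ℝ ℝ).trans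
    ((ContinuousLinearEquiv.neg ℝ).prodCongr (ContinuousLinearEquiv.refl ℝ ℝ))).trans
    (WithLp.prodContinuousLinearEquiv 2 ℝ ℝ ℝ).symm

/-- The transpose of the symplectic Fourier transform, on Schwartz functions:
`φ ↦ ((x, ξ) ↦ ∬ φ(t,ν) e^{-2πi(νx - ξt)} dt dν)`. -/
def symplecticFourierTest : 𝓢(ℝ × ℝ, ℂ) →L[ℂ] 𝓢(ℝ × ℝ, ℂ) :=
  (compCLMOfContinuousLinearEquiv ℂ rotE).comp
    ((fourierCLM ℂ 𝓢(WithLp 2 (ℝ × ℝ), ℂ)).comp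
      (compCLMOfContinuousLinearEquiv ℂ (WithLp.prodContinuousLinearEquiv 2 ℝ ℝ ℝ)))

theorem symplecticFourierTest_apply (φ : 𝓢(ℝ × ℝ, ℂ)) (x ξ : ℝ) :
    symplecticFourierTest φ (x, ξ) =
      ∫ z : ℝ × ℝ, Complex.exp (((-2 * Real.pi * (z.2 * x - ξ * z.1) : ℝ) : ℂ) * Complex.I) * φ z := by
  have hmp : MeasurePreserving (WithLp.ofLp : WithLp 2 (ℝ × ℝ) → ℝ × ℝ) :=
    WithLp.volume_preserving_ofLp ℝ ℝ
  rw [← hmp.integral_comp (MeasurableEquiv.toLp 2 (ℝ × ℝ)).symm.measurableEmbedding]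
  simp only [symplecticFourierTest, ContinuousLinearMap.comp_apply,
    compCLMOfContinuousLinearEquiv_apply, Function.comp_apply, fourierCLM_apply,
    SchwartzMap.fourier_coe, Real.fourier_eq']
  refine integral_congr_ae (ae_of_all _ fun z => ?_)
  simp [rotE, WithLp.prod_inner_apply]
  left
  congr 1
  ring

/-- The symplectic Fourier transform
`(𝓕ˢ F)(t,ν) = ∬ F(x,ξ) e^{-2πi(νx - ξt)} dx dξ` of tempered distributions, by duality. -/
def symplecticFourier (F : 𝓢'(ℝ × ℝ, ℂ)) : 𝓢'(ℝ × ℝ, ℂ) :=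
  PointwiseConvergenceCLM.precomp ℂ symplecticFourierTest F

theorem symplecticFourier_apply (F : 𝓢'(ℝ × ℝ, ℂ)) (φ : 𝓢(ℝ × ℝ, ℂ)) :
    symplecticFourier F φ = F (symplecticFourierTest φ) := rfl

/-- The spreading function `η_H = 𝓕ˢ σ_H`. -/
def spreading (H : 𝓢(ℝ, ℂ) →L[ℂ] 𝓢'(ℝ, ℂ)) : 𝓢'(ℝ × ℝ, ℂ) := symplecticFourier (symbol H)

/-! ### Operator Paley-Wiener spaces -/

/-- The distribution `σ` is given by the locally integrable function `s`. -/
def IsGivenBy (σ : 𝓢'(ℝ × ℝ, ℂ)) (s : ℝ × ℝ → ℂ) : Prop :=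
  LocallyIntegrable s ∧
    ∀ φ : 𝓢(ℝ × ℝ, ℂ), HasCompactSupport φ → σ φ = ∫ z, s z * φ z

/-- The norm `‖σ‖_{L_w^{p,q}}` of a distribution: the norm of the function that gives `σ`, which is
unique up to null sets, and `∞` if `σ` is not a locally integrable function. -/
def distMixedNorm (p q : ℝ≥0∞) (w : ℝ × ℝ → ℝ) (σ : 𝓢'(ℝ × ℝ, ℂ)) : ℝ≥0∞ :=
  ⨅ (s : ℝ × ℝ → ℂ) (_ : IsGivenBy σ s), mixedNorm p q w s

/-- The norm `‖H‖_{OPW_w^{p,q}} = ‖σ_H‖_{L_w^{p,q}}`. -/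
def opwNorm (p q : ℝ≥0∞) (w : ℝ × ℝ → ℝ) (H : 𝓢(ℝ, ℂ) →L[ℂ] 𝓢'(ℝ, ℂ)) : ℝ≥0∞ :=
  distMixedNorm p q w (symbol H)

/-- The operator Paley-Wiener space `OPW_w^{p,q}(M)`. -/
def OPW (p q : ℝ≥0∞) (w : ℝ × ℝ → ℝ) (M : Set (ℝ × ℝ)) : Set (𝓢(ℝ, ℂ) →L[ℂ] 𝓢'(ℝ, ℂ)) :=
  {H | (∃ σ, IsSymbol H σ) ∧ Distribution.dsupport (spreading H) ⊆ M ∧ opwNorm p q w H < ∞}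

/-! ### Extension to `M^{∞,∞}` and operator sampling -/

/-- The Schwartz functions `f k` converge to `g` in the weak-* sense and are bounded in
`M^{∞,∞}(ℝ)`. -/
def BoundedWeakStarTendsto (f : ℕ → 𝓢(ℝ, ℂ)) (g : 𝓢'(ℝ, ℂ)) : Prop :=
  Tendsto (fun k => toTemperedDistributionCLM ℝ ℂ volume (f k)) atTop (𝓝 g) ∧
    ⨆ k, modulationNorm ∞ ∞ (fun _ => 1) (toTemperedDistributionCLM ℝ ℂ volume (f k)) < ∞

/-- `F = Hg` for the extension of `H` to `M^{∞,∞}(ℝ)`: the element `g` is the limit of some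
sequence as in `BoundedWeakStarTendsto`, and `H f_k` converges weak-* to `F` for every such
sequence. -/
def IsImage (H : 𝓢(ℝ, ℂ) →L[ℂ] 𝓢'(ℝ, ℂ)) (g F : 𝓢'(ℝ, ℂ)) : Prop :=
  (∃ f, BoundedWeakStarTendsto f g) ∧
    ∀ f, BoundedWeakStarTendsto f g → Tendsto (fun k => H (f k)) atTop (𝓝 F)

/-- `OPW_w^{p,q}(M)`, mapping `M^{∞,∞}(ℝ)` to `M_w^{p,q}(ℝ)`, is identifiable by `g`:
`A ‖H‖ ≤ ‖Hg‖ ≤ B ‖H‖` for all `H`, with `A, B > 0`. -/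
def IsIdentifiableBy (p q : ℝ≥0∞) (w : ℝ × ℝ → ℝ) (M : Set (ℝ × ℝ)) (g : 𝓢'(ℝ, ℂ)) : Prop :=
  modulationNorm ∞ ∞ (fun _ => 1) g < ∞ ∧
    ∃ A B : ℝ≥0, 0 < A ∧ 0 < B ∧ ∀ H ∈ OPW p q w M, ∃ F, IsImage H g F ∧
      A * opwNorm p q w H ≤ modulationNorm p q w F ∧
      modulationNorm p q w F ≤ B * opwNorm p q w H

/-- `g = ∑ₙ cₙ δ_{xₙ}` with weak-* convergence. -/
def IsDeltaSeries (c : ℤ → ℂ) (x : ℤ → ℝ) (g : 𝓢'(ℝ, ℂ)) : Prop :=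
  HasSum (fun n => c n • TemperedDistribution.delta (x n)) g

/-- `OPW_w^{p,q}(M)` permits operator sampling. -/
def PermitsOperatorSampling (p q : ℝ≥0∞) (w : ℝ × ℝ → ℝ) (M : Set (ℝ × ℝ)) : Prop :=
  ∃ (c : ℤ → ℂ) (x : ℤ → ℝ) (g : 𝓢'(ℝ, ℂ)), IsDeltaSeries c x g ∧ IsIdentifiableBy p q w M g

/-! ### Outer Jordan content -/

/-- The rectangle `[0, 1/K) × [0, K/L) + (k/K, mK/L)`. -/
def cell (K L : ℕ) (j : ℤ × ℤ) : Set (ℝ × ℝ) :=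
  Set.Ico (j.1 / K : ℝ) (j.1 / K + 1 / K) ×ˢ Set.Ico (j.2 * K / L : ℝ) (j.2 * K / L + K / L)

/-- The outer Jordan content: the infimum of the areas of finite unions of cells of some grid that
cover `M`. It is `∞` if `M` is unbounded. -/
def outerContent (M : Set (ℝ × ℝ)) : ℝ≥0∞ :=
  ⨅ (K : ℕ) (L : ℕ) (_ : 0 < K) (_ : 0 < L) (J : Finset (ℤ × ℤ)) (_ : M ⊆ ⋃ j ∈ J, cell K L j),
    volume (⋃ j ∈ J, cell K L j)

end OperatorSampling

end

noncomputable section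

namespace OperatorSampling

/-! ### Characters and the functions `exp (-c |x| ^ b)` -/

/-! An operator whose spreading function lives on `M` is a superposition of time-frequency shifts by
points of `M`. Take a grid with steps `a = 1/K` in time and `(L a)⁻¹ = K/L` in frequency. A cell has
area `1/L`, so after refinement `vol⁺(M) < 1` leaves a set `Λ` of fewer than `L` grid points whose
overlapping bumps cover `M` (`exists_grid`). They split the symbol into finitely many pieces.

A delta train with spacing `a` and `L`-periodic weights `c` sees these pieces aliased: by Poisson
summation the piece of index `(k, j)` enters through the vector of `ℂ^L` obtained from `c` by
translating by `k` and modulating by `j`. The pieces separate if these vectors are linearly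
independent. Weights `2^(n²)` on one period turn the matrix in question into a Vandermonde matrix
with distinct nodes, so dual sequences exist (`exists_dual_sequences`).

Upper bound: bounded spectrum makes the symbol a function `S` of polynomial growth, reproduced by
convolution with the symplectic transform of a cutoff `χ₁ ⊗ χ₂` (`exists_symbol_function`). The
operator then has a transpose `T` on Schwartz functions (`exists_transpose`), `Hg = g ∘ T`, and the
short-time Fourier transform of `Hg` at `ζ` is the integral of `S` against a kernel with
subexponential decay in `z - ζ`. Young's inequality for weighted mixed norms (`exists_mixedNorm_le`)
gives the estimate.

Lower bound: pair `Hg` with a modulated lattice sum whose coefficients are a dual sequence. By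
`combPairing_combFun` all pieces but one drop out, and what remains is the value at a point `z₀` of
one piece of the symbol. Summing over `Λ` gives `S z₀` (`symbolPart_eq_sum`). The test functions are
concentrated near `z₀` in the time-frequency plane, so inversion of the short-time Fourier transform
(`stft_inversion`) bounds `|S z₀|` by the transform of `Hg` integrated against a decaying kernel
(`exists_enorm_symbolPart_le`), and the same Young inequality applies.

The weights may grow like `exp (γ ‖z‖ ^ β)` with `β < 1`. The bumps must beat this in frequency
while keeping compact support, which Gevrey functions with Fourier decay `exp (-c |x| ^ b)`, `β < b
< 1`, achieve (`exists_partition_fourier_decay`). -/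

/-- The character `θ ↦ e^{2πiθ}`. -/
def ec (θ : ℝ) : ℂ := Complex.exp (((2 * Real.pi * θ : ℝ) : ℂ) * Complex.I)

@[simp] theorem norm_ec (θ : ℝ) : ‖ec θ‖ = 1 := Complex.norm_exp_ofReal_mul_I _

theorem ec_add (x y : ℝ) : ec (x + y) = ec x * ec y := by
  rw [ec, ec, ec, ← Complex.exp_add]; push_cast; ring_nf

@[simp] theorem ec_zero : ec 0 = 1 := by simp [ec]

theorem ec_ne_zero (θ : ℝ) : ec θ ≠ 0 := Complex.exp_ne_zero _

theorem ec_neg_mul_self (θ : ℝ) : ec (-θ) * ec θ = 1 := by rw [← ec_add]; simp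

theorem ec_sub (x y : ℝ) : ec (x - y) = ec x * ec (-y) := by rw [sub_eq_add_neg, ec_add]

@[simp] theorem ec_intCast (n : ℤ) : ec n = 1 := by
  rw [ec, Complex.exp_eq_one_iff]; exact ⟨n, by push_cast; ring⟩

theorem ec_eq_one_iff (θ : ℝ) : ec θ = 1 ↔ ∃ n : ℤ, θ = n := by
  constructor
  · intro h
    rw [ec, Complex.exp_eq_one_iff] at h
    obtain ⟨n, hn⟩ := h
    refine ⟨n, ?_⟩
    have h2 : ((2 * Real.pi * θ : ℝ) : ℂ) * Complex.I = ((2 * Real.pi * n : ℝ) : ℂ) * Complex.I := by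
      rw [hn]; push_cast; ring
    have h3 := Complex.ofReal_injective (mul_right_cancel₀ Complex.I_ne_zero h2)
    have hpi : (2 * Real.pi) ≠ 0 := by positivity
    exact mul_left_cancel₀ hpi h3
  · rintro ⟨n, rfl⟩; simp

@[fun_prop] theorem contDiff_ec {n : WithTop ℕ∞} : ContDiff ℝ n ec := by
  unfold ec
  exact Complex.contDiff_exp.comp ((Complex.ofRealCLM.contDiff.comp
    (contDiff_const.mul contDiff_id)).mul contDiff_const)

@[fun_prop] theorem continuous_ec : Continuous ec := contDiff_ec (n := 0) |>.continuous

theorem fourier_eq_ec (f : ℝ → ℂ) (w : ℝ) : 𝓕 f w = ∫ v, ec (-(v * w)) * f v := by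
  rw [Real.fourier_eq']
  congr 1; ext v
  simp [ec]; left; ring_nf

theorem fourierInv_eq_ec (f : ℝ → ℂ) (w : ℝ) : 𝓕⁻ f w = ∫ v, ec (v * w) * f v := by
  rw [Real.fourierInv_eq']
  congr 1; ext v
  simp [ec]; left; ring_nf

theorem tfShift_eq_ec (t ν : ℝ) (φ : 𝓢(ℝ, ℂ)) (x : ℝ) :
    tfShift t ν φ x = ec (ν * x) * φ (x - t) := by
  rw [tfShift_apply, ec]; ring_nf

theorem symbolTest_eq_ec (f φ : 𝓢(ℝ, ℂ)) (x ξ : ℝ) :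
    symbolTest f φ (x, ξ) = φ x * 𝓕 (f : ℝ → ℂ) ξ * ec (x * ξ) := symbolTest_apply f φ x ξ

theorem symplecticFourierTest_eq_ec (φ : 𝓢(ℝ × ℝ, ℂ)) (x ξ : ℝ) :
    symplecticFourierTest φ (x, ξ) = ∫ z : ℝ × ℝ, ec (ξ * z.1 - z.2 * x) * φ z := by
  rw [symplecticFourierTest_apply]
  congr 1; ext z
  rw [ec]; ring_nf

/-- The subexponential function `x ↦ exp (-c |x| ^ b)`. -/
def sexp (b c x : ℝ) : ℝ := Real.exp (-(c * |x| ^ b))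

theorem sexp_pos (b c x : ℝ) : 0 < sexp b c x := Real.exp_pos _

theorem sexp_nonneg (b c x : ℝ) : 0 ≤ sexp b c x := (sexp_pos b c x).le

@[simp] theorem sexp_neg (b c x : ℝ) : sexp b c (-x) = sexp b c x := by simp [sexp]

theorem sexp_sub_comm (b c x y : ℝ) : sexp b c (x - y) = sexp b c (y - x) := by
  rw [← sexp_neg, neg_sub]

theorem sexp_le_one {b c : ℝ} (hc : 0 ≤ c) (x : ℝ) : sexp b c x ≤ 1 := by
  rw [sexp, Real.exp_le_one_iff, neg_nonpos]
  positivity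

theorem sexp_anti {b c c' : ℝ} (h : c ≤ c') (x : ℝ) : sexp b c' x ≤ sexp b c x := by
  unfold sexp
  gcongr

theorem sexp_add_rate (b c c' x : ℝ) : sexp b (c + c') x = sexp b c x * sexp b c' x := by
  rw [sexp, sexp, sexp, ← Real.exp_add]; ring_nf

theorem continuous_sexp {b c : ℝ} (hb : 0 < b) : Continuous (sexp b c) := by
  unfold sexp
  have : Continuous fun x : ℝ => |x| ^ b :=
    continuous_abs.rpow_const (fun x => Or.inr hb.le)
  fun_prop

/-- Subadditivity of `|·| ^ b` for `b ≤ 1` is what later allows decay to be traded between shifted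
arguments. -/
theorem abs_add_rpow_le {b : ℝ} (hb : 0 < b) (hb1 : b ≤ 1) (x y : ℝ) :
    |x + y| ^ b ≤ |x| ^ b + |y| ^ b :=
  (Real.rpow_le_rpow (abs_nonneg _) (abs_add_le x y) hb.le).trans
    (Real.rpow_add_le_add_rpow (abs_nonneg _) (abs_nonneg _) hb.le hb1)

theorem sexp_mul_sexp_le {b c : ℝ} (hb : 0 < b) (hb1 : b ≤ 1) (hc : 0 ≤ c) (x y : ℝ) :
    sexp b c x * sexp b c y ≤ sexp b c (x + y) := by
  rw [sexp, sexp, sexp, ← Real.exp_add, Real.exp_le_exp]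
  nlinarith [abs_add_rpow_le hb hb1 x y]

/-- Moving the argument by a bounded amount changes `sexp` by a bounded factor. -/
theorem sexp_add_le {b c : ℝ} (hb : 0 < b) (hb1 : b ≤ 1) (hc : 0 ≤ c) (x y : ℝ) :
    sexp b c (x + y) ≤ Real.exp (c * |y| ^ b) * sexp b c x := by
  rw [sexp, sexp, ← Real.exp_add, Real.exp_le_exp]
  have := abs_add_rpow_le hb hb1 (x + y) (-y)
  simp only [add_neg_cancel_right, abs_neg] at this
  nlinarith

theorem exists_rpow_mul_le_exp {b c : ℝ} (hb : 0 < b) (hc : 0 < c) (N : ℕ) :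
    ∃ C : ℝ, 0 < C ∧ ∀ x, (1 + |x|) ^ N * sexp b c x ≤ C := by
  have h := (tendsto_rpow_mul_exp_neg_mul_atTop_nhds_zero (N / b) c hc).comp
    (tendsto_rpow_atTop hb)
  have hcont : Continuous fun x : ℝ => (1 + |x|) ^ N * sexp b c x :=
    ((continuous_const.add continuous_abs).pow N).mul (continuous_sexp hb)
  have h1 : ∀ᶠ y : ℝ in atTop, y ^ N * Real.exp (-c * y ^ b) ≤ 1 := by
    have h2 := h.eventually (ge_mem_nhds (show (0:ℝ) < 1 by norm_num))
    filter_upwards [h2, eventually_gt_atTop 0] with y hy hy0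
    simp only [Function.comp] at hy
    rwa [← Real.rpow_mul hy0.le, mul_div_cancel₀ _ hb.ne', Real.rpow_natCast] at hy
  obtain ⟨R, hR⟩ := eventually_atTop.1 h1
  set R' := max R 1
  obtain ⟨C, hC⟩ := (isCompact_Icc (a := -R') (b := R')).exists_bound_of_continuousOn
    hcont.continuousOn
  refine ⟨max C (2 ^ N), lt_of_lt_of_le (by positivity) (le_max_right _ _), fun x => ?_⟩
  by_cases hx : |x| ≤ R'
  · exact ((le_abs_self _).trans (hC x (abs_le.1 hx))).trans (le_max_left _ _)
  · push Not at hx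
    refine le_trans ?_ (le_max_right _ _)
    have h3 := hR |x| ((le_max_left _ _).trans hx.le)
    have h4 : 1 ≤ |x| := (le_max_right _ _).trans hx.le
    have h5 : (1 + |x|) ^ N ≤ 2 ^ N * |x| ^ N := by
      rw [← mul_pow]
      gcongr
      linarith
    calc (1 + |x|) ^ N * sexp b c x ≤ (2 ^ N * |x| ^ N) * sexp b c x := by
          gcongr; exact sexp_nonneg _ _ _
      _ = 2 ^ N * (|x| ^ N * Real.exp (-c * |x| ^ b)) := by rw [sexp]; ring_nf
      _ ≤ 2 ^ N * 1 := by gcongr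
      _ = 2 ^ N := mul_one _

theorem exists_sexp_le_inv {b c : ℝ} (hb : 0 < b) (hc : 0 < c) :
    ∃ C : ℝ, 0 < C ∧ ∀ x, sexp b c x ≤ C * (1 + x ^ 2)⁻¹ := by
  obtain ⟨C, hC, h⟩ := exists_rpow_mul_le_exp hb hc 2
  refine ⟨C, hC, fun x => ?_⟩
  rw [← div_eq_mul_inv, le_div_iff₀ (by positivity)]
  refine le_trans ?_ (h x)
  rw [mul_comm]
  have : 1 + x ^ 2 ≤ (1 + |x|) ^ 2 := by nlinarith [abs_nonneg x, sq_abs x]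
  gcongr
  exact sexp_nonneg _ _ _

theorem integrable_sexp {b c : ℝ} (hb : 0 < b) (hc : 0 < c) : Integrable (sexp b c) := by
  obtain ⟨C, hC, h⟩ := exists_sexp_le_inv hb hc
  refine (integrable_inv_one_add_sq.const_mul C).mono'
    (continuous_sexp hb).aestronglyMeasurable (ae_of_all _ fun x => ?_)
  rw [Real.norm_of_nonneg (sexp_nonneg _ _ _)]
  exact h x

theorem summable_inv_one_add_sq {a : ℝ} (ha : 0 < a) :
    Summable fun n : ℤ => (1 + (n * a) ^ 2)⁻¹ := by
  have h : Summable fun n : ℤ => (a ^ 2)⁻¹ * (1 / (n : ℝ) ^ 2) :=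
    (Real.summable_one_div_int_pow.2 one_lt_two).mul_left _
  refine Summable.of_norm_bounded_eventually (g := fun n : ℤ => (a ^ 2)⁻¹ * (1 / (n : ℝ) ^ 2)) h ?_
  have : ∀ᶠ n : ℤ in cofinite, n ≠ 0 := (Set.finite_singleton (0:ℤ)).compl_mem_cofinite
  filter_upwards [this] with n hn
  have hn' : (n : ℝ) ≠ 0 := by exact_mod_cast hn
  rw [Real.norm_of_nonneg (by positivity), one_div, ← mul_inv]
  apply inv_anti₀ (by positivity)
  nlinarith

theorem summable_sexp {a b c : ℝ} (ha : 0 < a) (hb : 0 < b) (hc : 0 < c) :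
    Summable fun n : ℤ => sexp b c (n * a) := by
  obtain ⟨C, hC, h⟩ := exists_sexp_le_inv hb hc
  exact Summable.of_nonneg_of_le (fun n => sexp_nonneg _ _ _) (fun n => h _)
    ((summable_inv_one_add_sq ha).mul_left C)

/-- The sums of `sexp` over translated lattices converge and are bounded. -/
theorem exists_tsum_sexp_le {a b c : ℝ} (ha : 0 < a) (hb : 0 < b) (hb1 : b ≤ 1) (hc : 0 < c) :
    ∃ C : ℝ, 0 < C ∧ ∀ t : ℝ, Summable (fun n : ℤ => sexp b c (n * a - t)) ∧
      ∑' n : ℤ, sexp b c (n * a - t) ≤ C := by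
  set Γ := Real.exp (c * |a| ^ b)
  have hs := summable_sexp ha hb hc
  refine ⟨Γ * ∑' n : ℤ, sexp b c (n * a) + 1, ?_, fun t => ?_⟩
  · have : 0 ≤ ∑' n : ℤ, sexp b c (n * a) := tsum_nonneg fun n => sexp_nonneg _ _ _
    positivity
  -- Removing the lattice part of `t` leaves a shift `s ∈ [0, a]`, which costs at most the factor
  -- `Γ`; this makes the bound independent of `t`.
  set m : ℤ := ⌊t / a⌋
  set s : ℝ := t - m * a
  have hs0 : 0 ≤ s := by
    have := Int.floor_le (t / a)
    rw [le_div_iff₀ ha] at this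
    simp only [s]; linarith
  have hs1 : s ≤ a := by
    have := (Int.lt_floor_add_one (t / a)).le
    rw [div_le_iff₀ ha] at this
    simp only [s]; linarith
  have hb' : ∀ n : ℤ, sexp b c (n * a - s) ≤ Γ * sexp b c (n * a) := by
    intro n
    rw [sub_eq_add_neg]
    refine (sexp_add_le hb hb1 hc.le _ _).trans ?_
    have : |(-s)| ≤ |a| := by rw [abs_neg, abs_of_nonneg hs0, abs_of_pos ha]; exact hs1
    have h0 := sexp_nonneg b c (n * a)
    simp only [Γ]
    gcongr
  have hsum : Summable fun n : ℤ => sexp b c (n * a - s) :=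
    Summable.of_nonneg_of_le (fun n => sexp_nonneg _ _ _) hb' (hs.mul_left Γ)
  have heq : (fun n : ℤ => sexp b c (n * a - t)) =
      (fun n : ℤ => sexp b c (n * a - s)) ∘ (Equiv.subRight m) := by
    ext n
    simp only [Function.comp, Equiv.subRight_apply, s]
    push_cast; ring_nf
  rw [heq]
  refine ⟨(Equiv.subRight m).summable_iff.2 hsum, ?_⟩
  have := (Equiv.subRight m).tsum_eq (fun n : ℤ => sexp b c (n * a - s))
  rw [Function.comp_def, this]
  have h2 := hsum.tsum_le_tsum hb' (hs.mul_left Γ)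
  rw [tsum_mul_left] at h2
  linarith

theorem sexp_mul_pos {b c r : ℝ} (x : ℝ) (hr : 0 < r) :
    sexp b c (r * x) = sexp b (c * r ^ b) x := by
  rw [sexp, sexp, abs_mul, abs_of_pos hr, Real.mul_rpow hr.le (abs_nonneg x)]; ring_nf

/-! ### Compactly supported functions with subexponentially decaying Fourier transform -/

theorem iteratedDeriv_comp_ofReal {f : ℂ → ℂ} {U : Set ℂ} (hU : IsOpen U)
    (hf : DifferentiableOn ℂ f U) (n : ℕ) :
    ∀ t : ℝ, (t : ℂ) ∈ U → iteratedDeriv n (fun t : ℝ => f t) t = iteratedDeriv n f t := by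
  induction n with
  | zero => intro t _; simp
  | succ n ih =>
    intro t ht
    have hev : iteratedDeriv n (fun t : ℝ => f t) =ᶠ[𝓝 t] fun t : ℝ => iteratedDeriv n f t := by
      have : ∀ᶠ s : ℝ in 𝓝 t, (s : ℂ) ∈ U :=
        Complex.continuous_ofReal.continuousAt.eventually (hU.mem_nhds ht)
      filter_upwards [this] with s hs using ih s hs
    rw [iteratedDeriv_succ, hev.deriv_eq, iteratedDeriv_succ]
    have hd : DifferentiableAt ℂ (iteratedDeriv n f) t := by
      have := (hf.analyticOnNhd hU).iterated_deriv n t ht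
      rw [← iteratedDeriv_eq_iterate] at this
      exact this.differentiableAt
    exact hd.hasDerivAt.comp_ofReal.deriv

/-- By homogeneity, writing `ζ = r (1 + w)` reduces the claim to continuity of `(1 + w)^{-α}` at `w
= 0`. The aperture `κ` does not depend on `r`, so discs of radius proportional to the distance from
the singularity are admissible. -/
theorem exists_re_inv_pow_ge (α : ℕ) :
    ∃ κ : ℝ, 0 < κ ∧ κ < 1 ∧ ∀ r : ℝ, 0 < r → ∀ ζ : ℂ, ‖ζ - r‖ ≤ κ * r →
      ζ ≠ 0 ∧ (r ^ α)⁻¹ / 2 ≤ ((ζ ^ α)⁻¹).re := by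
  have hc : ContinuousAt (fun w : ℂ => (((1 + w) ^ α)⁻¹).re) 0 := by
    apply Complex.continuous_re.continuousAt.comp
    apply ContinuousAt.inv₀ (by fun_prop)
    simp
  have h1 : ∀ᶠ w : ℂ in 𝓝 0, 1 / 2 < (((1 + w) ^ α)⁻¹).re := by
    apply hc.eventually (lt_mem_nhds _)
    norm_num
  obtain ⟨ε, hε, h2⟩ := Metric.eventually_nhds_iff.1 h1
  refine ⟨min (ε / 2) (1 / 2), by positivity, (min_le_right _ _).trans_lt (by norm_num),
    fun r hr ζ hζ => ?_⟩
  have hrc : (r : ℂ) ≠ 0 := by exact_mod_cast hr.ne'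
  set w : ℂ := (ζ - r) / r
  have hw : ‖w‖ ≤ min (ε / 2) (1 / 2) := by
    rw [norm_div, Complex.norm_real, Real.norm_of_nonneg hr.le, div_le_iff₀ hr]
    exact hζ
  have hζw : ζ = r * (1 + w) := by simp only [w]; field_simp; ring
  constructor
  · rintro rfl
    simp only [zero_sub, norm_neg, Complex.norm_real, Real.norm_of_nonneg hr.le] at hζ
    have : min (ε / 2) (1 / 2) * r ≤ 1 / 2 * r := by gcongr; exact min_le_right _ _
    linarith
  · have h3 := h2 (y := w) (by
      rw [dist_zero_right]
      exact (hw.trans (min_le_left _ _)).trans_lt (by linarith))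
    rw [hζw, mul_pow, mul_inv, ← Complex.ofReal_pow, ← Complex.ofReal_inv, Complex.re_ofReal_mul]
    have : 0 < (r ^ α)⁻¹ := by positivity
    nlinarith

/-- The holomorphic function extending the bump function `gevreyBump`. -/
def gevreyHol (α : ℕ) (ζ : ℂ) : ℂ :=
  Complex.exp (-((1 / 2 + ζ) ^ α)⁻¹ - ((1 / 2 - ζ) ^ α)⁻¹)

/-- `t ↦ exp (-(1/2 + t)^{-α} - (1/2 - t)^{-α})` on `(-1/2, 1/2)`, extended by zero. -/
def gevreyBump (α : ℕ) (t : ℝ) : ℝ :=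
  expNegInvGlue ((1 / 2 + t) ^ α) * expNegInvGlue ((1 / 2 - t) ^ α)

theorem contDiff_gevreyBump (α : ℕ) : ContDiff ℝ (⊤ : ℕ∞) (gevreyBump α) := by
  unfold gevreyBump
  exact (expNegInvGlue.contDiff.comp (by fun_prop)).mul (expNegInvGlue.contDiff.comp (by fun_prop))

theorem gevreyBump_nonneg (α : ℕ) (t : ℝ) : 0 ≤ gevreyBump α t :=
  mul_nonneg (expNegInvGlue.nonneg _) (expNegInvGlue.nonneg _)

theorem gevreyBump_zero_pos (α : ℕ) : 0 < gevreyBump α 0 :=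
  mul_pos (expNegInvGlue.pos_of_pos (by positivity)) (expNegInvGlue.pos_of_pos (by norm_num))

/-- Oddness of `α` keeps the sign: beyond an endpoint the corresponding base is negative and so is
its power, where `expNegInvGlue` vanishes. -/
theorem gevreyBump_eq_zero {α : ℕ} (hα : Odd α) {t : ℝ} (ht : 1 / 2 ≤ |t|) :
    gevreyBump α t = 0 := by
  unfold gevreyBump
  rcases le_abs'.1 ht with h | h
  · rw [expNegInvGlue.zero_of_nonpos (hα.pow_nonpos_iff.2 (by linarith)), zero_mul]
  · rw [expNegInvGlue.zero_of_nonpos (x := (1 / 2 - t) ^ α) (hα.pow_nonpos_iff.2 (by linarith)),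
      mul_zero]

theorem gevreyBump_eq_gevreyHol {α : ℕ} {t : ℝ} (ht : |t| < 1 / 2) :
    (gevreyBump α t : ℂ) = gevreyHol α t := by
  have h1 : 0 < (1 / 2 + t) ^ α := pow_pos (by linarith [(abs_lt.1 ht).1]) _
  have h2 : 0 < (1 / 2 - t) ^ α := pow_pos (by linarith [(abs_lt.1 ht).2]) _
  rw [gevreyBump, expNegInvGlue, expNegInvGlue, if_neg h1.not_ge, if_neg h2.not_ge, ← Real.exp_add,
    gevreyHol, Complex.ofReal_exp]
  congr 1
  push_cast; ring

/-- Cauchy's estimate on a disc of radius `κ d`, with `d` the distance to the nearer endpoint. The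
blow-up `d^{-αm}` is absorbed by the smallness `exp (-d^{-α}/2)` of the function there, at the cost
of a factor `2^m m!`. The endpoints are left out; they form a null set. -/
theorem exists_norm_iteratedDeriv_gevreyBump_le {α : ℕ} (hα : Odd α) :
    ∃ κ : ℝ, 0 < κ ∧ ∀ (m : ℕ) (t : ℝ), |t| ≠ 1 / 2 →
      ‖iteratedDeriv (α * m) (fun t : ℝ => (gevreyBump α t : ℂ)) t‖ ≤
        (Set.Icc (-(1 / 2) : ℝ) (1 / 2)).indicator
          (fun _ => (α * m).factorial * (2 ^ m * m.factorial) / κ ^ (α * m)) t := by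
  obtain ⟨κ, hκ, hκ1, h⟩ := exists_re_inv_pow_ge α
  refine ⟨κ, hκ, fun m t ht => ?_⟩
  rcases lt_or_gt_of_ne ht with ht | ht
  swap
  · have h0 : (fun t : ℝ => (gevreyBump α t : ℂ)) =ᶠ[𝓝 t] fun _ => 0 := by
      have : ∀ᶠ s : ℝ in 𝓝 t, 1 / 2 < |s| := continuous_abs.continuousAt.eventually (lt_mem_nhds ht)
      filter_upwards [this] with s hs
      rw [gevreyBump_eq_zero hα hs.le, Complex.ofReal_zero]
    rw [h0.iteratedDeriv_eq, Set.indicator_of_notMem]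
    · simp
    · rintro ⟨h1, h2⟩
      exact absurd (abs_le.2 ⟨h1, h2⟩) (not_le.2 ht)
  rw [Set.indicator_of_mem (Set.mem_Icc.2 (abs_le.1 ht.le))]
  obtain ⟨ht1, ht2⟩ := abs_lt.1 ht
  have h0 : (fun t : ℝ => (gevreyBump α t : ℂ)) =ᶠ[𝓝 t] fun t : ℝ => gevreyHol α t := by
    have : ∀ᶠ s : ℝ in 𝓝 t, |s| < 1 / 2 := continuous_abs.continuousAt.eventually (gt_mem_nhds ht)
    filter_upwards [this] with s hs using gevreyBump_eq_gevreyHol hs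
  set d := min (1 / 2 + t) (1 / 2 - t)
  have hd : 0 < d := lt_min (by linarith) (by linarith)
  set U : Set ℂ := {ζ | 1 / 2 + ζ ≠ 0 ∧ 1 / 2 - ζ ≠ 0}
  have hU : IsOpen U := IsOpen.inter (isOpen_ne_fun (by fun_prop) (by fun_prop))
    (isOpen_ne_fun (by fun_prop) (by fun_prop))
  have hdiff : DifferentiableOn ℂ (gevreyHol α) U := by
    intro ζ hζ
    have e1 := pow_ne_zero α hζ.1
    have e2 := pow_ne_zero α hζ.2
    unfold gevreyHol
    apply DifferentiableAt.differentiableWithinAt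
    fun_prop (disch := assumption)
  have hp : ∀ ζ : ℂ, ‖ζ - t‖ ≤ κ * d → 1 / 2 + ζ ≠ 0 ∧
      ((1 / 2 + t) ^ α)⁻¹ / 2 ≤ (((1 / 2 + ζ) ^ α)⁻¹).re := by
    intro ζ hζ
    have := h (1 / 2 + t) (by linarith) (1 / 2 + ζ) (by
      push_cast
      rw [show (1 / 2 + ζ - (1 / 2 + t) : ℂ) = ζ - t by ring]
      exact hζ.trans (by gcongr; exact min_le_left _ _))
    exact this
  have hm : ∀ ζ : ℂ, ‖ζ - t‖ ≤ κ * d → 1 / 2 - ζ ≠ 0 ∧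
      ((1 / 2 - t) ^ α)⁻¹ / 2 ≤ (((1 / 2 - ζ) ^ α)⁻¹).re := by
    intro ζ hζ
    have := h (1 / 2 - t) (by linarith) (1 / 2 - ζ) (by
      push_cast
      rw [show (1 / 2 - ζ - (1 / 2 - t) : ℂ) = -(ζ - t) by ring, norm_neg]
      exact hζ.trans (by gcongr; exact min_le_right _ _))
    exact this
  have hball : ∀ ζ ∈ Metric.closedBall (t : ℂ) (κ * d), ζ ∈ U := by
    intro ζ hζ
    rw [mem_closedBall_iff_norm] at hζ
    exact ⟨(hp ζ hζ).1, (hm ζ hζ).1⟩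
  have htU : (t : ℂ) ∈ U := hball _ (Metric.mem_closedBall_self (by positivity))
  rw [h0.iteratedDeriv_eq, iteratedDeriv_comp_ofReal hU hdiff _ _ htU]
  -- On the Cauchy circle the term of the nearer endpoint contributes at least `y` to the negative
  -- real part of the exponent; the other term has positive real part and only helps.
  set y := (d ^ α)⁻¹ / 2
  have hy : 0 < y := by positivity
  have hcau := Complex.norm_iteratedDeriv_le_of_forall_mem_sphere_norm_le (c := (t : ℂ)) (R := κ * d)
    (C := Real.exp (-y)) (f := gevreyHol α) (α * m) (by positivity) (by
      apply DifferentiableOn.diffContOnCl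
      refine hdiff.mono fun ζ hζ => hball ζ (Metric.closure_ball_subset_closedBall hζ)) (by
      intro ζ hζ
      rw [mem_sphere_iff_norm] at hζ
      rw [gevreyHol, Complex.norm_exp, Real.exp_le_exp, Complex.sub_re, Complex.neg_re]
      have e1 := (hp ζ hζ.le).2
      have e2 := (hm ζ hζ.le).2
      have p1 : 0 < ((1 / 2 + t) ^ α)⁻¹ := inv_pos.2 (pow_pos (by linarith) _)
      have p2 : 0 < ((1 / 2 - t) ^ α)⁻¹ := inv_pos.2 (pow_pos (by linarith) _)
      simp only [y, d]
      rcases min_choice (1 / 2 + t) (1 / 2 - t) with hd' | hd' <;> rw [hd'] <;> linarith)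
  refine hcau.trans ?_
  have hexp : y ^ m * Real.exp (-y) ≤ m.factorial := by
    have := Real.pow_div_factorial_le_exp y hy.le m
    rw [div_le_iff₀ (by positivity)] at this
    rw [Real.exp_neg, ← div_eq_mul_inv, div_le_iff₀ (Real.exp_pos _), mul_comm]
    exact this
  have hdy : (d ^ (α * m))⁻¹ = 2 ^ m * y ^ m := by
    rw [← mul_pow, show 2 * y = (d ^ α)⁻¹ by simp only [y]; ring, inv_pow, ← pow_mul]
  rw [mul_pow, div_eq_mul_inv, mul_inv, hdy]
  calc ((α * m).factorial : ℝ) * Real.exp (-y) * ((κ ^ (α * m))⁻¹ * (2 ^ m * y ^ m))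
      = (α * m).factorial * (2 ^ m * (y ^ m * Real.exp (-y))) * (κ ^ (α * m))⁻¹ := by ring
    _ ≤ (α * m).factorial * (2 ^ m * m.factorial) * (κ ^ (α * m))⁻¹ := by gcongr
    _ = _ := by rw [div_eq_mul_inv]

theorem hasCompactSupport_gevreyBump {α : ℕ} (hα : Odd α) : HasCompactSupport (gevreyBump α) := by
  apply HasCompactSupport.of_support_subset_isCompact (isCompact_Icc (a := (-(1/2) : ℝ)) (b := 1 / 2))
  intro t ht
  rw [Set.mem_Icc, ← abs_le]
  by_contra h
  exact ht (gevreyBump_eq_zero hα (not_le.1 h).le)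

/-- Integrating by parts `α m` times and using `(αm)! ≤ (αe)^{αm} (m!)^α` leaves `(m!)^{α+1}` times
a geometric factor, which `B` collects. Only multiples of `α` are used as orders, so the variable is
effectively `|x|^α`. -/
theorem exists_norm_fourier_gevreyBump_mul_pow_le {α : ℕ} (hα : Odd α) :
    ∃ B : ℝ, 0 < B ∧ ∀ (m : ℕ) (x : ℝ),
      ‖𝓕 (fun t : ℝ => (gevreyBump α t : ℂ)) x‖ * (B * |x| ^ α) ^ m ≤
        (m.factorial : ℝ) ^ (α + 1) := by
  obtain ⟨κ, hκ, h⟩ := exists_norm_iteratedDeriv_gevreyBump_le hα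
  have hα0 : 0 < α := hα.pos
  set u : ℝ → ℂ := fun t : ℝ => (gevreyBump α t : ℂ)
  have hu : ContDiff ℝ (⊤ : ℕ∞) u := Complex.ofRealCLM.contDiff.comp (contDiff_gevreyBump α)
  have hus : HasCompactSupport u := (hasCompactSupport_gevreyBump hα).comp_left Complex.ofReal_zero
  have hint : ∀ n : ℕ, Integrable (iteratedDeriv n u) := by
    intro n
    apply (hu.continuous_iteratedDeriv n (by exact_mod_cast le_top)).integrable_of_hasCompactSupport
    rw [iteratedDeriv_eq_iterate]
    induction n with
    | zero => exact hus
    | succ n ih => rw [Function.iterate_succ_apply']; exact ih.deriv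
  refine ⟨(2 * Real.pi * κ) ^ α / (2 * (α * Real.exp 1) ^ α), by positivity, fun m x => ?_⟩
  set M : ℝ := (α * m).factorial * (2 ^ m * m.factorial) / κ ^ (α * m)
  have hM : 0 ≤ M := by positivity
  have h1 : ‖𝓕 (iteratedDeriv (α * m) u) x‖ ≤ M := by
    refine (VectorFourier.norm_fourierIntegral_le_integral_norm _ _ _ _ _).trans ?_
    have h2 : ∫ t, ‖iteratedDeriv (α * m) u t‖ ≤
        ∫ t, (Set.Icc (-(1 / 2) : ℝ) (1 / 2)).indicator (fun _ => M) t := by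
      apply integral_mono_ae (hint _).norm
      · rw [integrable_indicator_iff measurableSet_Icc]
        exact integrableOn_const (by simp)
      · have : ∀ᵐ t : ℝ, t ∉ ({1 / 2, -(1 / 2)} : Set ℝ) :=
          (Set.Finite.measure_zero (by simp) volume : volume ({1 / 2, -(1 / 2)} : Set ℝ) = 0)
            |> measure_eq_zero_iff_ae_notMem.1
        filter_upwards [this] with t ht
        apply h m t
        intro h3
        rcases (abs_eq (by norm_num)).1 h3 with h3 | h3 <;> simp [h3] at ht
    refine h2.trans ?_
    rw [integral_indicator measurableSet_Icc, setIntegral_const]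
    simp [Measure.real]
    norm_num
  rw [Real.fourier_iteratedDeriv (N := ⊤) hu (fun n _ => hint n) le_top] at h1
  have h3 : ‖𝓕 u x‖ * (2 * Real.pi * |x|) ^ (α * m) ≤ M := by
    refine le_trans (le_of_eq ?_) h1
    simp [mul_comm, abs_of_pos Real.pi_pos]
  have hfac : ((α * m).factorial : ℝ) ≤ ((α * Real.exp 1) ^ α) ^ m * (m.factorial : ℝ) ^ α := by
    have e1 : ((α * m).factorial : ℝ) ≤ ((α : ℝ) * m) ^ (α * m) := by
      exact_mod_cast Nat.factorial_le_pow (α * m)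
    have e2 : (m : ℝ) ^ m ≤ Real.exp 1 ^ m * m.factorial := by
      have := Real.pow_div_factorial_le_exp (m : ℝ) (by positivity) m
      rw [div_le_iff₀ (by positivity)] at this
      rwa [← Real.exp_nat_mul, mul_one]
    calc ((α * m).factorial : ℝ) ≤ ((α : ℝ) * m) ^ (α * m) := e1
      _ = ((α : ℝ) ^ α) ^ m * ((m : ℝ) ^ m) ^ α := by
          rw [mul_pow, pow_mul, ← pow_mul (m : ℝ) m α, mul_comm α m]
      _ ≤ ((α : ℝ) ^ α) ^ m * (Real.exp 1 ^ m * m.factorial) ^ α := by gcongr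
      _ = _ := by rw [mul_pow, mul_pow, mul_pow, ← pow_mul (Real.exp 1), mul_comm m α, pow_mul]; ring
  have hκm : 0 < κ ^ (α * m) := by positivity
  have hE : 0 < (2 * (α * Real.exp 1) ^ α) ^ m := by positivity
  have h4 : ‖𝓕 u x‖ * ((2 * Real.pi * |x|) ^ (α * m) * κ ^ (α * m)) ≤
      (α * m).factorial * (2 ^ m * m.factorial) := by
    rw [← mul_assoc]
    rwa [le_div_iff₀ hκm] at h3
  rw [div_mul_eq_mul_div, div_pow, mul_div_assoc', div_le_iff₀ hE]
  calc ‖𝓕 u x‖ * ((2 * Real.pi * κ) ^ α * |x| ^ α) ^ m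
      = ‖𝓕 u x‖ * ((2 * Real.pi * |x|) ^ (α * m) * κ ^ (α * m)) := by
        rw [pow_mul, pow_mul, ← mul_pow, ← mul_pow, ← mul_pow]; ring
    _ ≤ (α * m).factorial * (2 ^ m * m.factorial) := h4
    _ ≤ (((α * Real.exp 1) ^ α) ^ m * (m.factorial : ℝ) ^ α) * (2 ^ m * m.factorial) := by gcongr
    _ = (m.factorial : ℝ) ^ (α + 1) * (2 * (α * Real.exp 1) ^ α) ^ m := by
        rw [mul_pow 2, pow_succ]; ring

/-- Dividing the hypotheses by `2^m m!` and summing compares the exponential series at `y/2` with a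
geometric series of sum `2`. -/
theorem le_exp_of_mul_pow_le_factorial {r y : ℝ}
    (h : ∀ m : ℕ, r * y ^ m ≤ m.factorial) : r ≤ 2 * Real.exp (-(y / 2)) := by
  have h1 : HasSum (fun m : ℕ => r * ((y / 2) ^ m / m.factorial)) (r * Real.exp (y / 2)) := by
    have := NormedSpace.expSeries_div_hasSum_exp (𝔸 := ℝ) (y / 2)
    rw [← Real.exp_eq_exp_ℝ] at this
    exact this.mul_left r
  have h2 : r * Real.exp (y / 2) ≤ 2 := by
    refine hasSum_le (fun m => ?_) h1 hasSum_geometric_two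
    rw [div_pow, div_div, mul_div_assoc', div_le_iff₀ (by positivity)]
    calc r * y ^ m ≤ m.factorial := h m
      _ = (1 / 2) ^ m * (2 ^ m * m.factorial) := by
        rw [← mul_assoc, ← mul_pow]; norm_num
  rw [Real.exp_neg, ← div_eq_mul_inv, le_div_iff₀ (Real.exp_pos _)]
  exact h2

/-- The root of order `α + 1` turns `(m!)^{α+1}` into `m!`, so the preceding lemma applies with `y`
proportional to `|x|^{α/(α+1)}`; raising back to the power `α + 1` only changes constants. -/
theorem exists_norm_fourier_gevreyBump_le {α : ℕ} (hα : Odd α) :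
    ∃ C c : ℝ, 0 < c ∧ 0 < C ∧ ∀ x : ℝ,
      ‖𝓕 (fun t : ℝ => (gevreyBump α t : ℂ)) x‖ ≤ C * sexp (α / (α + 1)) c x := by
  obtain ⟨B, hB, h⟩ := exists_norm_fourier_gevreyBump_mul_pow_le hα
  set e : ℝ := ((α : ℝ) + 1)⁻¹
  have he : 0 < e := by positivity
  have he1 : e * (α + 1 : ℕ) = 1 := by
    push_cast
    exact inv_mul_cancel₀ (by positivity)
  refine ⟨2 ^ (α + 1), (α + 1 : ℕ) * (B ^ e / 2), by positivity, by positivity, fun x => ?_⟩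
  set r := ‖𝓕 (fun t : ℝ => (gevreyBump α t : ℂ)) x‖
  have hr : 0 ≤ r := norm_nonneg _
  have hyn : 0 ≤ B * |x| ^ α := by positivity
  have h1 := le_exp_of_mul_pow_le_factorial (r := r ^ e) (y := (B * |x| ^ α) ^ e)
    (fun m => by
      have := Real.rpow_le_rpow (by positivity) (h m x) he.le
      rw [Real.mul_rpow hr (by positivity), ← Real.rpow_pow_comm hyn,
        ← Real.rpow_pow_comm (Nat.cast_nonneg _), ← Real.rpow_natCast _ (α + 1),
        ← Real.rpow_mul (Nat.cast_nonneg _), he1, Real.rpow_one] at this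
      exact this)
  have h2 := pow_le_pow_left₀ (by positivity) h1 (α + 1)
  rw [← Real.rpow_natCast (r ^ e), ← Real.rpow_mul hr, he1, Real.rpow_one, mul_pow,
    ← Real.exp_nat_mul] at h2
  refine h2.trans (le_of_eq ?_)
  congr 2
  rw [Real.mul_rpow hB.le (by positivity), ← Real.rpow_natCast |x| α,
    ← Real.rpow_mul (abs_nonneg x), show (α : ℝ) * e = α / (α + 1) by rw [div_eq_mul_inv]]
  ring

theorem norm_fourier_comp_add (f : ℝ → ℂ) (a w : ℝ) : ‖𝓕 (fun x => f (x + a)) w‖ = ‖𝓕 f w‖ := by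
  have : 𝓕 (fun x => f (x + a)) w = ec (a * w) * 𝓕 f w := by
    rw [fourier_eq_ec, fourier_eq_ec, ← integral_const_mul,
      ← integral_add_right_eq_self (fun v => ec (a * w) * (ec (-(v * w)) * f v)) a]
    congr 1; ext v
    rw [← mul_assoc, ← ec_add]; ring_nf
  rw [this, norm_mul, norm_ec, one_mul]

/-- A smooth partition of unity consisting of the integer translates of a function supported in
`[-1, 1]`, whose Fourier transform decays subexponentially with order `b > β`. -/
theorem exists_partition_fourier_decay {β : ℝ} (hβ : β < 1) :
    ∃ b : ℝ, β < b ∧ 0 < b ∧ b < 1 ∧ ∃ ψ : 𝓢(ℝ, ℂ), (∀ x, 1 ≤ |x| → ψ x = 0) ∧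
      (∀ x, HasSum (fun k : ℤ => ψ (x - k)) 1) ∧
      ∃ C c : ℝ, 0 < c ∧ 0 < C ∧ ∀ x, ‖𝓕 ψ x‖ ≤ C * sexp b c x := by
  -- The choice makes `α` odd with `α (1 - β) > 1`, hence `α/(α+1) > β`.
  obtain ⟨j, hj⟩ := exists_nat_gt (1 / (1 - β))
  set α : ℕ := 2 * j + 1
  have hα : Odd α := ⟨j, rfl⟩
  have hb1 : (α : ℝ) / (α + 1) < 1 := by rw [div_lt_one (by positivity)]; linarith
  have hb0 : 0 < (α : ℝ) / (α + 1) := by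
    have : 0 < α := hα.pos
    positivity
  have hbβ : β < (α : ℝ) / (α + 1) := by
    rw [lt_div_iff₀ (by positivity)]
    rw [div_lt_iff₀ (by linarith)] at hj
    have : (α : ℝ) = 2 * j + 1 := by simp [α]
    rw [this]
    have : (0 : ℝ) ≤ j := by positivity
    nlinarith
  refine ⟨(α : ℝ) / (α + 1), hbβ, hb0, hb1, ?_⟩
  obtain ⟨C, c, hc, hC, hF⟩ := exists_norm_fourier_gevreyBump_le hα
  set b := (α : ℝ) / (α + 1)
  set u := gevreyBump α
  have hu : ContDiff ℝ (⊤ : ℕ∞) u := contDiff_gevreyBump α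
  have hus : HasCompactSupport u := hasCompactSupport_gevreyBump hα
  have hui : Integrable u := hu.continuous.integrable_of_hasCompactSupport hus
  set I := ∫ t, u t
  have hI : 0 < I := by
    apply integral_pos_of_integrable_nonneg_nonzero hu.continuous hui (gevreyBump_nonneg α)
      (x := 0) (gevreyBump_zero_pos α).ne'
  set U : ℝ → ℝ := fun x => ∫ t in (0 : ℝ)..x, u t
  have hU : ∀ x, HasDerivAt U (u x) x := fun x =>
    intervalIntegral.integral_hasDerivAt_right (hu.continuous.intervalIntegrable _ _)
      (hu.continuous.stronglyMeasurableAtFilter _ _) hu.continuous.continuousAt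
  have hUd : deriv U = u := funext fun x => (hU x).deriv
  have hUc : ContDiff ℝ (⊤ : ℕ∞) U := by
    rw [contDiff_infty_iff_deriv, hUd]
    exact ⟨fun x => (hU x).differentiableAt, hu⟩
  have hUsub : ∀ x y, U y - U x = ∫ t in x..y, u t := fun x y =>
    intervalIntegral.integral_interval_sub_left (hu.continuous.intervalIntegrable _ _)
      (hu.continuous.intervalIntegrable _ _)
  -- This is the normalized bump convolved with the indicator of `[-1/2, 1/2]`. Its integer
  -- translates integrate the bump over adjacent unit intervals, so they add up to one.
  set ψ : ℝ → ℂ := fun x => (((U (x + 1 / 2) - U (x - 1 / 2)) / I : ℝ) : ℂ)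
  have hψ0 : ∀ x, 1 ≤ |x| → ψ x = 0 := by
    intro x hx
    simp only [ψ, hUsub]
    rw [intervalIntegral.integral_congr (g := fun _ => (0 : ℝ))]
    · simp
    · intro t ht
      rw [Set.uIcc_of_le (by linarith)] at ht
      apply gevreyBump_eq_zero hα
      rcases le_abs.1 hx with h | h
      · exact le_abs.2 (Or.inl (by linarith [ht.1]))
      · exact le_abs.2 (Or.inr (by linarith [ht.2]))
  have hψc : ContDiff ℝ (⊤ : ℕ∞) ψ := by
    apply Complex.ofRealCLM.contDiff.comp
    exact ((hUc.comp (by fun_prop)).sub (hUc.comp (by fun_prop))).div_const I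
  have hψs : HasCompactSupport ψ := by
    apply HasCompactSupport.of_support_subset_isCompact (isCompact_Icc (a := (-1 : ℝ)) (b := 1))
    intro t ht
    rw [Set.mem_Icc, ← abs_le]
    by_contra h
    exact ht (hψ0 t (not_le.1 h).le)
  set Ψ : 𝓢(ℝ, ℂ) := hψs.toSchwartzMap hψc
  have hΨ : (Ψ : ℝ → ℂ) = ψ := rfl
  refine ⟨Ψ, hψ0, fun x => ?_, ?_⟩
  · have h1 := ((hui.hasSum_intervalIntegral (x - 1 / 2)).div_const I)
    rw [div_self hI.ne'] at h1
    have h2 := (Complex.ofRealCLM.hasSum h1)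
    simp only [Complex.ofRealCLM_apply, Complex.ofReal_one] at h2
    rw [← (Equiv.neg ℤ).hasSum_iff] at h2
    convert h2 using 1
    ext k
    change ψ (x - k) = _
    simp only [ψ, hUsub, Function.comp, Equiv.neg_apply]
    congr 3 <;> (push_cast; ring)
  -- The derivative is a difference of two translates of the bump, so its transform has the decay of
  -- the bump's. Dividing by `2πix` is harmless for `|x| ≥ 1`; for `|x| < 1` the trivial bound by
  -- the `L¹` norm suffices.
  · have hd : ∀ x, HasDerivAt ψ (((u (x + 1 / 2) - u (x + -(1 / 2))) / I : ℝ) : ℂ) x := by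
      intro x
      apply HasDerivAt.ofReal_comp
      rw [← sub_eq_add_neg]
      exact (((hU (x + 1 / 2)).comp_add_const x (1 / 2)).sub
        ((hU (x - 1 / 2)).comp_sub_const x (1 / 2))).div_const I
    have hdi : Integrable (deriv ψ) := (derivCLM ℂ ℂ Ψ).integrable
    have h3 := Real.fourier_deriv (f := ψ) Ψ.integrable (hψc.differentiable (by simp)) hdi
    have h4 : ∀ x, ‖𝓕 (deriv ψ) x‖ ≤ 2 * C / I * sexp b c x := by
      intro x
      have hI' : (I : ℂ) ≠ 0 := by exact_mod_cast hI.ne'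
      set uc : ℝ → ℂ := fun t => (u t : ℂ)
      have huc : Integrable uc := hui.ofReal
      have e1 : deriv ψ = fun x => (I : ℂ)⁻¹ * uc (x + 1 / 2) - (I : ℂ)⁻¹ * uc (x + -(1 / 2)) := by
        ext x
        rw [(hd x).deriv]
        simp only [uc]
        push_cast
        field_simp
      have e2 : 𝓕 (deriv ψ) x = (I : ℂ)⁻¹ * 𝓕 (fun x => uc (x + 1 / 2)) x -
          (I : ℂ)⁻¹ * 𝓕 (fun x => uc (x + -(1 / 2))) x := by
        rw [e1]
        simp only [fourier_eq_ec]
        rw [← integral_const_mul, ← integral_const_mul, ← integral_sub]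
        · congr 1; ext v; ring
        · exact ((huc.comp_add_right (1 / 2)).bdd_mul (c := 1) (by fun_prop)
            (ae_of_all _ fun v => by simp)).const_mul _
        · exact ((huc.comp_add_right (-(1 / 2))).bdd_mul (c := 1) (by fun_prop)
            (ae_of_all _ fun v => by simp)).const_mul _
      rw [e2]
      refine (norm_sub_le _ _).trans ?_
      rw [norm_mul, norm_mul, norm_fourier_comp_add, norm_fourier_comp_add, norm_inv,
        Complex.norm_real, Real.norm_of_nonneg hI.le]
      calc I⁻¹ * ‖𝓕 uc x‖ + I⁻¹ * ‖𝓕 uc x‖ = 2 * I⁻¹ * ‖𝓕 uc x‖ := by ring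
        _ ≤ 2 * I⁻¹ * (C * sexp b c x) := by gcongr; exact hF x
        _ = _ := by ring
    set D := ∫ v, ‖ψ v‖
    have hD : 0 ≤ D := integral_nonneg fun v => norm_nonneg _
    refine ⟨2 * C / I + D * Real.exp c, c, hc, by positivity, fun x => ?_⟩
    have hs := sexp_nonneg b c x
    rw [add_mul]
    by_cases hx : 1 ≤ |x|
    · refine le_add_of_le_of_nonneg ?_ (by positivity)
      refine le_trans ?_ (h4 x)
      rw [h3, norm_smul]
      refine le_mul_of_one_le_left (norm_nonneg _) ?_
      simp only [norm_mul, Complex.norm_ofNat, Complex.norm_real, Complex.norm_I, Real.norm_eq_abs,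
        abs_of_pos Real.pi_pos, mul_one]
      nlinarith [Real.pi_gt_three]
    · push Not at hx
      refine le_add_of_nonneg_of_le (by positivity) ?_
      have h5 : ‖𝓕 ψ x‖ ≤ D := VectorFourier.norm_fourierIntegral_le_integral_norm _ _ _ _ _
      have h6 : 1 ≤ Real.exp c * sexp b c x := by
        rw [sexp, ← Real.exp_add, Real.one_le_exp_iff]
        have : |x| ^ b ≤ 1 := Real.rpow_le_one (abs_nonneg x) hx.le hb0.le
        nlinarith
      calc ‖𝓕 ψ x‖ ≤ D * 1 := by rw [mul_one]; exact h5
        _ ≤ D * (Real.exp c * sexp b c x) := by gcongr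
        _ = _ := by ring

/-! ### Schwartz functions with subexponential decay in time and frequency -/

/-- `f` and its Fourier transform decay subexponentially of order `b`. -/
def IsSubexp (b : ℝ) (f : 𝓢(ℝ, ℂ)) : Prop :=
  ∃ c C : ℝ, 0 < c ∧ 0 < C ∧ ∀ x, ‖f x‖ ≤ C * sexp b c x ∧ ‖𝓕 f x‖ ≤ C * sexp b c x

theorem fourier_fourier_apply (f : 𝓢(ℝ, ℂ)) (x : ℝ) : 𝓕 (𝓕 f) x = f (-x) := by
  have h : 𝓕⁻ (𝓕 f) (-x) = f (-x) := by rw [FourierTransform.fourierInv_fourier_eq]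
  rw [← h, fourierInv_coe, fourier_coe, Real.fourierInv_eq_fourier_neg, neg_neg]

theorem fourierInv_apply_eq_fourier_neg (f : 𝓢(ℝ, ℂ)) (x : ℝ) : 𝓕⁻ f x = 𝓕 f (-x) := by
  rw [fourierInv_coe, fourier_coe, Real.fourierInv_eq_fourier_neg]

theorem IsSubexp.fourierInv {b : ℝ} {f : 𝓢(ℝ, ℂ)} (h : IsSubexp b f) : IsSubexp b (𝓕⁻ f) := by
  obtain ⟨c, C, hc, hC, h⟩ := h
  refine ⟨c, C, hc, hC, fun x => ⟨?_, ?_⟩⟩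
  · rw [fourierInv_apply_eq_fourier_neg, ← sexp_neg]; exact (h _).2
  · rw [FourierTransform.fourier_fourierInv_eq]; exact (h _).1

theorem IsSubexp.fourier {b : ℝ} {f : 𝓢(ℝ, ℂ)} (h : IsSubexp b f) : IsSubexp b (𝓕 f) := by
  obtain ⟨c, C, hc, hC, h⟩ := h
  refine ⟨c, C, hc, hC, fun x => ⟨(h _).2, ?_⟩⟩
  rw [fourier_fourier_apply, ← sexp_neg]; exact (h _).1

theorem IsSubexp.add {b : ℝ} {f g : 𝓢(ℝ, ℂ)} (hf : IsSubexp b f) (hg : IsSubexp b g) :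
    IsSubexp b (f + g) := by
  obtain ⟨c, C, hc, hC, hf⟩ := hf
  obtain ⟨d, D, hd, hD, hg⟩ := hg
  have key : ∀ x, C * sexp b c x + D * sexp b d x ≤ (C + D) * sexp b (min c d) x := by
    intro x
    have h1 := sexp_anti (b := b) (min_le_left c d) x
    have h2 := sexp_anti (b := b) (min_le_right c d) x
    nlinarith
  refine ⟨min c d, C + D, lt_min hc hd, by positivity, fun x => ⟨?_, ?_⟩⟩
  · exact (norm_add_le _ _).trans ((add_le_add (hf x).1 (hg x).1).trans (key x))
  · rw [FourierTransform.fourier_add]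
    exact (norm_add_le _ _).trans ((add_le_add (hf x).2 (hg x).2).trans (key x))

theorem IsSubexp.zero {b : ℝ} : IsSubexp b 0 := by
  refine ⟨1, 1, one_pos, one_pos, fun x => ⟨?_, ?_⟩⟩
  · simpa using sexp_nonneg b 1 x
  · rw [FourierTransform.fourier_zero]; simpa using sexp_nonneg b 1 x

theorem IsSubexp.sum {b : ℝ} {ι : Type*} (s : Finset ι) {f : ι → 𝓢(ℝ, ℂ)}
    (h : ∀ i ∈ s, IsSubexp b (f i)) : IsSubexp b (∑ i ∈ s, f i) := by
  classical
  induction s using Finset.induction_on with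
  | empty => simpa using IsSubexp.zero
  | insert i s hi ih =>
    rw [Finset.sum_insert hi]
    exact (h i (by simp)).add (ih fun j hj => h j (by simp [hj]))

theorem norm_fourier_compSubConst (f : 𝓢(ℝ, ℂ)) (a w : ℝ) :
    ‖𝓕 (compSubConstCLM ℂ a f) w‖ = ‖𝓕 f w‖ := by
  rw [fourier_coe, fourier_coe, ← norm_fourier_comp_add f (-a) w]
  congr 2

theorem IsSubexp.compSubConst {b : ℝ} (hb : 0 < b) (hb1 : b ≤ 1) {f : 𝓢(ℝ, ℂ)}
    (h : IsSubexp b f) (a : ℝ) : IsSubexp b (compSubConstCLM ℂ a f) := by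
  obtain ⟨c, C, hc, hC, h⟩ := h
  have h1 : 1 ≤ Real.exp (c * |-a| ^ b) := Real.one_le_exp (by positivity)
  refine ⟨c, C * Real.exp (c * |-a| ^ b), hc, by positivity, fun x => ⟨?_, ?_⟩⟩
  · rw [compSubConstCLM_apply, mul_assoc]
    refine (h _).1.trans ?_
    gcongr
    exact sexp_add_le hb hb1 hc.le _ _
  · rw [norm_fourier_compSubConst]
    refine (h _).2.trans ?_
    gcongr
    · exact sexp_nonneg _ _ _
    · exact le_mul_of_one_le_right hC.le h1

/-- The dilation `x ↦ f (r x)` of a Schwartz function. -/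
def dilate (r : ℝ) (hr : 0 < r) (f : 𝓢(ℝ, ℂ)) : 𝓢(ℝ, ℂ) :=
  compCLMOfContinuousLinearEquiv ℂ (ContinuousLinearEquiv.unitsEquivAut ℝ (Units.mk0 r hr.ne')) f

@[simp] theorem dilate_apply (r : ℝ) (hr : 0 < r) (f : 𝓢(ℝ, ℂ)) (x : ℝ) :
    dilate r hr f x = f (x * r) := by simp [dilate]

theorem fourier_dilate_apply (r : ℝ) (hr : 0 < r) (f : 𝓢(ℝ, ℂ)) (w : ℝ) :
    𝓕 (dilate r hr f) w = (r⁻¹ : ℝ) * 𝓕 f (w * r⁻¹) := by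
  rw [fourier_coe, fourier_coe, fourier_eq_ec, fourier_eq_ec]
  have := Measure.integral_comp_mul_right (fun v => ec (-(v * (w * r⁻¹))) * f v) r
  rw [abs_of_pos (inv_pos.2 hr)] at this
  rw [← Complex.real_smul, ← this]
  congr 1; ext v
  rw [dilate_apply]
  congr 2
  field_simp

theorem IsSubexp.dilate {b : ℝ} {f : 𝓢(ℝ, ℂ)} (h : IsSubexp b f) {r : ℝ} (hr : 0 < r) :
    IsSubexp b (dilate r hr f) := by
  obtain ⟨c, C, hc, hC, h⟩ := h
  have hr' := inv_pos.2 hr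
  refine ⟨min (c * r ^ b) (c * r⁻¹ ^ b), C * (1 + r⁻¹), by positivity, by positivity,
    fun x => ⟨?_, ?_⟩⟩
  · rw [dilate_apply]
    refine (h _).1.trans ?_
    rw [mul_comm x r, sexp_mul_pos _ hr]
    have := sexp_anti (b := b) (min_le_left (c * r ^ b) (c * r⁻¹ ^ b)) x
    have h2 := sexp_nonneg b (c * r ^ b) x
    gcongr
    exact le_mul_of_one_le_right hC.le (by linarith)
  · rw [fourier_dilate_apply, norm_mul, Complex.norm_real, Real.norm_of_nonneg hr'.le]
    have h1 := (h (x * r⁻¹)).2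
    rw [mul_comm x, sexp_mul_pos _ hr'] at h1
    rw [mul_comm x]
    have := sexp_anti (b := b) (min_le_right (c * r ^ b) (c * r⁻¹ ^ b)) x
    have h2 := sexp_nonneg b (c * r⁻¹ ^ b) x
    calc r⁻¹ * ‖𝓕 f (r⁻¹ * x)‖ ≤ r⁻¹ * (C * sexp b (c * r⁻¹ ^ b) x) := by gcongr
      _ ≤ (1 + r⁻¹) * (C * sexp b (min (c * r ^ b) (c * r⁻¹ ^ b)) x) := by gcongr; linarith
      _ = _ := by ring

theorem exists_le_sexp_of_support {b R : ℝ} {f : ℝ → ℂ} {D : ℝ} (hb : 0 < b) (hD : ∀ x, ‖f x‖ ≤ D)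
    (hR : ∀ x, R ≤ |x| → f x = 0) (c : ℝ) (hc : 0 < c) :
    ∃ C : ℝ, 0 < C ∧ ∀ x, ‖f x‖ ≤ C * sexp b c x := by
  refine ⟨(|D| + 1) * Real.exp (c * |R| ^ b), by positivity, fun x => ?_⟩
  by_cases hx : R ≤ |x|
  · rw [hR x hx, norm_zero]
    exact mul_nonneg (by positivity) (sexp_nonneg _ _ _)
  · push Not at hx
    have h1 : 1 ≤ Real.exp (c * |R| ^ b) * sexp b c x := by
      rw [sexp, ← Real.exp_add, Real.one_le_exp_iff]
      have : |x| ^ b ≤ |R| ^ b :=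
        Real.rpow_le_rpow (abs_nonneg _) (hx.le.trans (le_abs_self R)) hb.le
      nlinarith
    rw [mul_assoc]
    calc ‖f x‖ ≤ (|D| + 1) * 1 := by linarith [hD x, le_abs_self D]
      _ ≤ _ := by gcongr

theorem IsSubexp.of_support {b R : ℝ} {f : 𝓢(ℝ, ℂ)} (hb : 0 < b)
    (hR : ∀ x, R ≤ |x| → f x = 0) {C c : ℝ} (hc : 0 < c) (hC : 0 < C)
    (hF : ∀ x, ‖𝓕 f x‖ ≤ C * sexp b c x) : IsSubexp b f := by
  obtain ⟨C', hC', h⟩ := exists_le_sexp_of_support hb (fun x => f.norm_le_seminorm ℂ x) hR c hc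
  refine ⟨c, C + C', hc, by positivity, fun x => ⟨?_, ?_⟩⟩
  · refine (h x).trans ?_
    gcongr
    · exact sexp_nonneg _ _ _
    · linarith
  · refine (hF x).trans ?_
    gcongr
    · exact sexp_nonneg _ _ _
    · linarith

theorem gaussianWindow_eq (x : ℝ) :
    gaussianWindow x = ((2 : ℝ) ^ (1 / 4 : ℝ) : ℝ) * Complex.exp (-Real.pi * x ^ 2) := by
  rw [gaussianWindow_apply]; push_cast; rfl

theorem fourier_gaussianWindow_apply (w : ℝ) : 𝓕 gaussianWindow w = gaussianWindow w := by
  have h := congrFun (fourier_gaussian_pi (b := 1) (by norm_num)) w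
  rw [fourier_coe, fourier_eq_ec, gaussianWindow_eq]
  rw [fourier_eq_ec] at h
  simp only [gaussianWindow_eq]
  simp only [mul_one, Complex.one_cpow, div_one, one_mul] at h
  rw [← h, ← integral_const_mul]
  congr 1; ext v; ring

theorem gaussianWindow_norm_le {b : ℝ} (hb : 0 < b) (hb1 : b ≤ 1) (x : ℝ) :
    ‖gaussianWindow x‖ ≤ 2 * Real.exp 1 * sexp b 1 x := by
  rw [gaussianWindow_apply, Complex.norm_real, Real.norm_of_nonneg (by positivity)]
  have h1 : (2 : ℝ) ^ (1 / 4 : ℝ) ≤ 2 := by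
    conv_rhs => rw [← Real.rpow_one 2]
    exact Real.rpow_le_rpow_of_exponent_le one_le_two (by norm_num)
  have h2 : Real.exp (-Real.pi * x ^ 2) ≤ Real.exp 1 * sexp b 1 x := by
    rw [sexp, ← Real.exp_add, Real.exp_le_exp, one_mul]
    rcases le_total |x| 1 with h | h
    · have : |x| ^ b ≤ 1 := Real.rpow_le_one (abs_nonneg x) h hb.le
      have := mul_nonneg Real.pi_pos.le (sq_nonneg x)
      linarith
    · have h3 : |x| ^ b ≤ |x| := by
        conv_rhs => rw [← Real.rpow_one |x|]
        exact Real.rpow_le_rpow_of_exponent_le h hb1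
      have h4 : |x| ≤ x ^ 2 := by rw [← sq_abs]; nlinarith
      nlinarith [Real.pi_gt_three, sq_nonneg x]
  rw [mul_assoc]
  gcongr

theorem isSubexp_gaussianWindow {b : ℝ} (hb : 0 < b) (hb1 : b ≤ 1) :
    IsSubexp b gaussianWindow :=
  ⟨1, 2 * Real.exp 1, one_pos, by positivity, fun x => ⟨gaussianWindow_norm_le hb hb1 x, by
    rw [fourier_gaussianWindow_apply]; exact gaussianWindow_norm_le hb hb1 x⟩⟩

/-- The pointwise product of Schwartz functions. -/
def mulS (f g : 𝓢(ℝ, ℂ)) : 𝓢(ℝ, ℂ) := smulLeftCLM ℂ f g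

@[simp] theorem mulS_apply (f g : 𝓢(ℝ, ℂ)) (x : ℝ) : mulS f g x = f x * g x := by
  rw [mulS, smulLeftCLM_apply_apply f.hasTemperateGrowth, smul_eq_mul]

theorem fourier_tfShift_zero (g : 𝓢(ℝ, ℂ)) (w y : ℝ) :
    𝓕 (tfShift 0 (-w) g) y = 𝓕 g (y + w) := by
  rw [fourier_coe, fourier_coe, fourier_eq_ec, fourier_eq_ec]
  congr 1; ext v
  rw [tfShift_eq_ec, sub_zero, ← mul_assoc, ← ec_add]
  ring_nf

theorem fourier_mulS_apply (f g : 𝓢(ℝ, ℂ)) (w : ℝ) :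
    𝓕 (mulS f g) w = ∫ y, 𝓕⁻ f y * 𝓕 g (y + w) := by
  have h := integral_fourier_mul_eq (𝓕⁻ f) (tfShift 0 (-w) g)
  rw [FourierTransform.fourier_fourierInv_eq] at h
  simp only [fourier_tfShift_zero] at h
  rw [← h, fourier_coe, fourier_eq_ec]
  congr 1; ext v
  rw [tfShift_eq_ec, mulS_apply, sub_zero]
  ring_nf

/-- Half of the rate at `y` is kept for integrability in `y`; the other half combines with the
factor at `y + x` through subadditivity. -/
theorem sexp_mul_sexp_shift_le {b c : ℝ} (hb : 0 < b) (hb1 : b ≤ 1) (hc : 0 ≤ c) (x y : ℝ) :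
    sexp b c y * sexp b c (y + x) ≤ sexp b (c / 2) x * sexp b (c / 2) y := by
  have e := sexp_add_rate b (c / 2) (c / 2) y
  rw [add_halves] at e
  rw [e]
  have h1 : sexp b c (y + x) ≤ sexp b (c / 2) (y + x) := sexp_anti (by linarith) _
  have h2 := sexp_mul_sexp_le hb hb1 (by positivity : 0 ≤ c / 2) (-y) (y + x)
  rw [sexp_neg, neg_add_cancel_left] at h2
  have p := sexp_nonneg b (c / 2) y
  calc sexp b (c / 2) y * sexp b (c / 2) y * sexp b c (y + x)
      ≤ sexp b (c / 2) y * sexp b (c / 2) y * sexp b (c / 2) (y + x) := by gcongr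
    _ = sexp b (c / 2) y * (sexp b (c / 2) y * sexp b (c / 2) (y + x)) := by ring
    _ ≤ sexp b (c / 2) y * sexp b (c / 2) x := by gcongr
    _ = _ := mul_comm _ _

theorem norm_fourier_mulS_le {b c C D : ℝ} (hb : 0 < b) (hb1 : b ≤ 1) (hc : 0 < c)
    (hC : 0 ≤ C) {f g : 𝓢(ℝ, ℂ)} (hf : ∀ x, ‖𝓕 f x‖ ≤ C * sexp b c x)
    (hg : ∀ x, ‖𝓕 g x‖ ≤ D * sexp b c x) (w : ℝ) :
    ‖𝓕 (mulS f g) w‖ ≤ (C * D * ∫ y, sexp b (c / 2) y) * sexp b (c / 2) w := by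
  rw [fourier_mulS_apply, mul_right_comm, ← integral_const_mul]
  refine norm_integral_le_of_norm_le ((integrable_sexp hb (half_pos hc)).const_mul _)
    (ae_of_all _ fun y => ?_)
  rw [norm_mul, fourierInv_apply_eq_fourier_neg]
  have hD : 0 ≤ D := by
    have := (norm_nonneg _).trans (hg 0)
    exact nonneg_of_mul_nonneg_left this (sexp_pos _ _ _)
  calc ‖𝓕 f (-y)‖ * ‖𝓕 g (y + w)‖ ≤ (C * sexp b c y) * (D * sexp b c (y + w)) := by
        have := hf (-y)
        rw [sexp_neg] at this
        exact mul_le_mul this (hg _) (norm_nonneg _) (mul_nonneg hC (sexp_nonneg _ _ _))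
    _ = C * D * (sexp b c y * sexp b c (y + w)) := by ring
    _ ≤ C * D * (sexp b (c / 2) w * sexp b (c / 2) y) := by
        exact mul_le_mul_of_nonneg_left (sexp_mul_sexp_shift_le hb hb1 hc.le w y)
          (mul_nonneg hC hD)
    _ = _ := by ring

theorem sexp_triple_le {b c : ℝ} (hb : 0 < b) (hb1 : b ≤ 1) (hc : 0 ≤ c) (x r s t : ℝ) :
    sexp b c (x - r) * sexp b c (x - s) * sexp b c (x - t) ≤
      sexp b (c / 2) (r - t) * sexp b (c / 4) (s - t) * sexp b (c / 4) (x - t) := by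
  have e : ∀ y, sexp b c y ≤ sexp b (c / 2) y := fun y => sexp_anti (by linarith) y
  have e4 : ∀ y, sexp b c y ≤ sexp b (c / 4) y := fun y => sexp_anti (by linarith) y
  have d : ∀ y, sexp b c y = sexp b (c / 2) y * (sexp b (c / 4) y * sexp b (c / 4) y) := by
    intro y
    rw [← sexp_add_rate, ← sexp_add_rate]
    congr 1; ring
  have h1 := sexp_mul_sexp_le hb hb1 (by positivity : 0 ≤ c / 2) (r - x) (x - t)
  have h2 := sexp_mul_sexp_le hb hb1 (by positivity : 0 ≤ c / 4) (s - x) (x - t)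
  rw [sub_add_sub_cancel] at h1 h2
  rw [sexp_sub_comm _ _ x r, sexp_sub_comm _ _ x s, d (x - t)]
  have p1 := sexp_nonneg b (c / 2) (x - t)
  have p2 := sexp_nonneg b (c / 4) (x - t)
  have p3 := sexp_nonneg b (c / 2) (r - x)
  have p4 := sexp_nonneg b (c / 4) (s - x)
  calc sexp b c (r - x) * sexp b c (s - x) *
        (sexp b (c / 2) (x - t) * (sexp b (c / 4) (x - t) * sexp b (c / 4) (x - t)))
      ≤ sexp b (c / 2) (r - x) * sexp b (c / 4) (s - x) *
        (sexp b (c / 2) (x - t) * (sexp b (c / 4) (x - t) * sexp b (c / 4) (x - t))) := by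
        gcongr
        · exact sexp_nonneg _ _ _
        · exact e _
        · exact e4 _
    _ = (sexp b (c / 2) (r - x) * sexp b (c / 2) (x - t)) *
        (sexp b (c / 4) (s - x) * sexp b (c / 4) (x - t)) * sexp b (c / 4) (x - t) := by ring
    _ ≤ _ := by gcongr; exact sexp_nonneg _ _ _

/-- Decay of the integral of a product of three shifted functions against a character. -/
theorem exists_norm_integral_triple_le {b : ℝ} (hb : 0 < b) (hb1 : b ≤ 1) {f g h : 𝓢(ℝ, ℂ)}
    (hf : IsSubexp b f) (hg : IsSubexp b g) (hh : IsSubexp b h) :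
    ∃ c C : ℝ, 0 < c ∧ 0 < C ∧ ∀ r s t w : ℝ,
      ‖∫ x, f (x - r) * g (x - s) * h (x - t) * ec (-(x * w))‖ ≤
        C * (sexp b c w * sexp b c (r - t) * sexp b c (s - t)) := by
  obtain ⟨c₁, C₁, hc₁, hC₁, hf⟩ := hf
  obtain ⟨c₂, C₂, hc₂, hC₂, hg⟩ := hg
  obtain ⟨c₃, C₃, hc₃, hC₃, hh⟩ := hh
  set c := min c₁ (min c₂ c₃)
  have hc : 0 < c := by positivity
  have l1 : c ≤ c₁ := min_le_left _ _
  have l2 : c ≤ c₂ := (min_le_right _ _).trans (min_le_left _ _)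
  have l3 : c ≤ c₃ := (min_le_right _ _).trans (min_le_right _ _)
  have up : ∀ {c' C : ℝ} {k : ℝ → ℝ}, 0 < C → c ≤ c' → (∀ x, k x ≤ C * sexp b c' x) →
      ∀ x, k x ≤ C * sexp b c x := fun hC hl h x => (h x).trans (by
        gcongr; exact sexp_anti hl x)
  have f1 := up hC₁ l1 (fun x => (hf x).1)
  have f2 := up hC₁ l1 (fun x => (hf x).2)
  have g1 := up hC₂ l2 (fun x => (hg x).1)
  have g2 := up hC₂ l2 (fun x => (hg x).2)
  have h1 := up hC₃ l3 (fun x => (hh x).1)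
  have h2 := up hC₃ l3 (fun x => (hh x).2)
  set J₁ := ∫ y, sexp b (c / 4) y
  set J₂ := ∫ y, sexp b (c / 2) y
  set J₃ := ∫ y, sexp b (c / 2 / 2) y
  have nn : ∀ d, 0 ≤ ∫ y, sexp b d y := fun d => integral_nonneg fun y => sexp_nonneg _ _ _
  have hJ₁ : 0 ≤ J₁ := nn _
  have hJ₂ : 0 ≤ J₂ := nn _
  have hJ₃ : 0 ≤ J₃ := nn _
  set D := C₁ * C₂ * C₃ * (1 + J₁ + J₂ * J₃)
  have hD : 0 < D := by positivity
  refine ⟨c / 8, D, by positivity, hD, fun r s t w => ?_⟩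
  set I := ∫ x, f (x - r) * g (x - s) * h (x - t) * ec (-(x * w))
  have b1 : ‖I‖ ≤ D * (sexp b (c / 2) (r - t) * sexp b (c / 4) (s - t)) := by
    have : ‖I‖ ≤ ∫ x, C₁ * C₂ * C₃ * (sexp b (c / 2) (r - t) * sexp b (c / 4) (s - t)) *
        sexp b (c / 4) (x - t) := by
      refine norm_integral_le_of_norm_le
        (((integrable_sexp hb (by positivity)).comp_sub_right t).const_mul _)
        (ae_of_all _ fun x => ?_)
      rw [norm_mul, norm_mul, norm_mul, norm_ec, mul_one]
      have m1 : ‖f (x - r)‖ * ‖g (x - s)‖ ≤ (C₁ * sexp b c (x - r)) * (C₂ * sexp b c (x - s)) :=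
        mul_le_mul (f1 _) (g1 _) (norm_nonneg _) (mul_nonneg hC₁.le (sexp_nonneg _ _ _))
      have m2 := mul_le_mul m1 (h1 (x - t)) (norm_nonneg _)
        (mul_nonneg (mul_nonneg hC₁.le (sexp_nonneg _ _ _))
          (mul_nonneg hC₂.le (sexp_nonneg _ _ _)))
      refine m2.trans ?_
      have m3 := sexp_triple_le hb hb1 hc.le x r s t
      calc _ = C₁ * C₂ * C₃ * (sexp b c (x - r) * sexp b c (x - s) * sexp b c (x - t)) := by ring
        _ ≤ C₁ * C₂ * C₃ * (sexp b (c / 2) (r - t) * sexp b (c / 4) (s - t) *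
            sexp b (c / 4) (x - t)) := by gcongr
        _ = _ := by ring
    rw [integral_const_mul, integral_sub_right_eq_self (sexp b (c / 4))] at this
    refine this.trans ?_
    have p := mul_nonneg (sexp_nonneg b (c / 2) (r - t)) (sexp_nonneg b (c / 4) (s - t))
    have q : C₁ * C₂ * C₃ * J₁ ≤ D := by
      simp only [D]; gcongr; nlinarith [mul_nonneg hJ₂ hJ₃]
    calc _ = (C₁ * C₂ * C₃ * J₁) * (sexp b (c / 2) (r - t) * sexp b (c / 4) (s - t)) := by ring
      _ ≤ _ := by gcongr
  have b2 : ‖I‖ ≤ D * sexp b (c / 4) w := by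
    have e : I = 𝓕 (mulS (mulS (compSubConstCLM ℂ r f) (compSubConstCLM ℂ s g))
        (compSubConstCLM ℂ t h)) w := by
      rw [fourier_coe, fourier_eq_ec]
      refine integral_congr_ae (ae_of_all _ fun x => ?_)
      simp only [mulS_apply, compSubConstCLM_apply]
      ring
    rw [e]
    have m1 := norm_fourier_mulS_le hb hb1 hc hC₁.le
      (f := compSubConstCLM ℂ r f) (g := compSubConstCLM ℂ s g)
      (fun x => by rw [norm_fourier_compSubConst]; exact f2 x)
      (fun x => by rw [norm_fourier_compSubConst]; exact g2 x)
    have m2 := norm_fourier_mulS_le hb hb1 (half_pos hc) (by positivity) m1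
      (g := compSubConstCLM ℂ t h) (D := C₃)
      (fun x => by
        rw [norm_fourier_compSubConst]
        exact (h2 x).trans (by gcongr; exact sexp_anti (by linarith) x)) w
    refine m2.trans ?_
    rw [show c / 2 / 2 = c / 4 by ring]
    have q : C₁ * C₂ * J₂ * C₃ * J₁ ≤ D := by
      have : J₁ = J₃ := by simp only [J₁, J₃]; rw [show c / 2 / 2 = c / 4 by ring]
      calc C₁ * C₂ * J₂ * C₃ * J₁ = C₁ * C₂ * C₃ * (J₂ * J₃) := by rw [this]; ring
        _ ≤ D := by simp only [D]; gcongr; linarith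
    gcongr
    exact sexp_nonneg _ _ _
  have sq8 : ∀ y, sexp b (c / 8) y * sexp b (c / 8) y = sexp b (c / 4) y := by
    intro y; rw [← sexp_add_rate]; congr 1; ring
  have an : ∀ y, sexp b (c / 2) y ≤ sexp b (c / 4) y := fun y => sexp_anti (by linarith) y
  -- `b1` uses absolute values only and decays in the shifts; `b2` uses the transforms only and
  -- decays in the frequency. Their product bounds `‖I‖ ^ 2`, so each kind of decay survives at half
  -- its rate, whence `c / 8`.
  refine (pow_le_pow_iff_left₀ (norm_nonneg _) (mul_nonneg hD.le (mul_nonneg (mul_nonneg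
    (sexp_nonneg _ _ _) (sexp_nonneg _ _ _)) (sexp_nonneg _ _ _))) two_ne_zero).1 ?_
  calc ‖I‖ ^ 2 = ‖I‖ * ‖I‖ := sq _
    _ ≤ (D * sexp b (c / 4) w) * (D * (sexp b (c / 2) (r - t) * sexp b (c / 4) (s - t))) :=
        mul_le_mul b2 b1 (norm_nonneg _) (mul_nonneg hD.le (sexp_nonneg _ _ _))
    _ ≤ (D * sexp b (c / 4) w) * (D * (sexp b (c / 4) (r - t) * sexp b (c / 4) (s - t))) := by
        have p := sexp_nonneg b (c / 4) w
        have q := sexp_nonneg b (c / 4) (s - t)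
        gcongr
        exact an _
    _ = _ := by
        rw [← sq8 w, ← sq8 (r - t), ← sq8 (s - t)]; ring

/-! ### Modulated sums of lattice translates -/

/-- The function `x ↦ ∑ₙ cₙ A(x - na) e^{2πiθ(x - na)}`. -/
def combFun (a : ℝ) (c : ℤ → ℂ) (A : 𝓢(ℝ, ℂ)) (θ x : ℝ) : ℂ :=
  ∑' n : ℤ, c n * A (x - n * a) * ec (θ * (x - n * a))

section Comb

variable {a b : ℝ} {c : ℤ → ℂ} {A : 𝓢(ℝ, ℂ)} {Γ : ℝ}

theorem exists_tsum_norm_translates_le (ha : 0 < a) (hb : 0 < b) (hb1 : b ≤ 1)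
    (hA : IsSubexp b A) :
    ∃ C : ℝ, 0 < C ∧ ∀ x : ℝ, Summable (fun n : ℤ => ‖A (x - n * a)‖) ∧
      ∑' n : ℤ, ‖A (x - n * a)‖ ≤ C := by
  obtain ⟨κ, D, hκ, hD, h⟩ := hA
  obtain ⟨C, hC, hs⟩ := exists_tsum_sexp_le ha hb hb1 hκ
  refine ⟨D * C, by positivity, fun x => ?_⟩
  have h1 : ∀ n : ℤ, ‖A (x - n * a)‖ ≤ D * sexp b κ (n * a - x) := fun n => by
    rw [sexp_sub_comm]; exact (h _).1
  have hsum : Summable fun n : ℤ => ‖A (x - n * a)‖ :=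
    Summable.of_nonneg_of_le (fun n => norm_nonneg _) h1 ((hs x).1.mul_left D)
  refine ⟨hsum, (hsum.tsum_le_tsum h1 ((hs x).1.mul_left D)).trans ?_⟩
  rw [tsum_mul_left]
  exact mul_le_mul_of_nonneg_left (hs x).2 hD.le

theorem norm_combFun_term_le (hc : ∀ n, ‖c n‖ ≤ Γ) (θ x : ℝ) (n : ℤ) :
    ‖c n * A (x - n * a) * ec (θ * (x - n * a))‖ ≤ Γ * ‖A (x - n * a)‖ := by
  rw [norm_mul, norm_mul, norm_ec, mul_one]
  gcongr
  exact hc n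

theorem exists_norm_combFun_le (ha : 0 < a) (hb : 0 < b) (hb1 : b ≤ 1) (hA : IsSubexp b A)
    (hc : ∀ n, ‖c n‖ ≤ Γ) : ∃ C : ℝ, 0 < C ∧ ∀ θ x, ‖combFun a c A θ x‖ ≤ C := by
  obtain ⟨C, hC, h⟩ := exists_tsum_norm_translates_le ha hb hb1 hA
  have hΓ : 0 ≤ Γ := (norm_nonneg _).trans (hc 0)
  refine ⟨Γ * C + 1, by positivity, fun θ x => ?_⟩
  have h1 := tsum_of_norm_bounded ((h x).1.mul_left Γ).hasSum (norm_combFun_term_le hc θ x)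
  rw [tsum_mul_left] at h1
  have : Γ * ∑' n : ℤ, ‖A (x - n * a)‖ ≤ Γ * C := mul_le_mul_of_nonneg_left (h x).2 hΓ
  exact h1.trans (by linarith)

theorem continuous_combFun (ha : 0 < a) (hb : 0 < b) (hb1 : b ≤ 1) (hA : IsSubexp b A)
    (hc : ∀ n, ‖c n‖ ≤ Γ) : Continuous fun p : ℝ × ℝ => combFun a c A p.1 p.2 := by
  have hΓ : 0 ≤ Γ := (norm_nonneg _).trans (hc 0)
  obtain ⟨κ, D, hκ, hD, h⟩ := hA
  rw [continuous_iff_continuousAt]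
  intro p
  set R := |p.2| + 1
  have hopen : IsOpen {p : ℝ × ℝ | |p.2| < R} :=
    isOpen_lt (continuous_abs.comp continuous_snd) continuous_const
  have hp : p ∈ {p : ℝ × ℝ | |p.2| < R} := by simp [R]
  refine (ContinuousOn.continuousAt ?_ (hopen.mem_nhds hp))
  refine continuousOn_tsum (u := fun n : ℤ => Γ * (D * (Real.exp (κ * R ^ b) * sexp b κ (n * a))))
    (fun n => ?_) ?_ (fun n q hq => ?_)
  · have := A.continuous
    fun_prop
  · exact (((summable_sexp ha hb hκ).mul_left _).mul_left _).mul_left _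
  · refine (norm_combFun_term_le hc _ _ _).trans ?_
    gcongr
    refine (h _).1.trans ?_
    gcongr
    rw [sexp_sub_comm, sub_eq_add_neg]
    refine (sexp_add_le hb hb1 hκ.le _ _).trans ?_
    have hq0 : |q.2| < R := hq
    have hq' : |-q.2| ≤ R := by rw [abs_neg]; exact hq0.le
    have := sexp_nonneg b κ (n * a)
    gcongr

theorem exists_integral_norm_mul_le (hb : 0 < b) (hb1 : b ≤ 1) {h : 𝓢(ℝ, ℂ)} (hA : IsSubexp b A)
    (hh : IsSubexp b h) :
    ∃ κ C : ℝ, 0 < κ ∧ 0 < C ∧ ∀ r t : ℝ, Integrable (fun x => ‖A (x - r)‖ * ‖h (x - t)‖) ∧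
      ∫ x, ‖A (x - r)‖ * ‖h (x - t)‖ ≤ C * sexp b κ (r - t) := by
  obtain ⟨c₁, C₁, hc₁, hC₁, hA⟩ := hA
  obtain ⟨c₂, C₂, hc₂, hC₂, hh⟩ := hh
  set κ := min c₁ c₂
  have hκ : 0 < κ := lt_min hc₁ hc₂
  have nn : 0 ≤ ∫ y, sexp b (κ / 2) y := integral_nonneg fun y => sexp_nonneg _ _ _
  refine ⟨κ / 2, C₁ * C₂ * (∫ y, sexp b (κ / 2) y) + 1, by positivity, by positivity,
    fun r t => ?_⟩
  have hbd : ∀ x, ‖A (x - r)‖ * ‖h (x - t)‖ ≤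
      C₁ * C₂ * sexp b (κ / 2) (r - t) * sexp b (κ / 2) (x - t) := by
    intro x
    have h1 := (hA (x - r)).1.trans (mul_le_mul_of_nonneg_left
      (sexp_anti (b := b) (min_le_left c₁ c₂) (x - r)) hC₁.le)
    have h2 := (hh (x - t)).1.trans (mul_le_mul_of_nonneg_left
      (sexp_anti (b := b) (min_le_right c₁ c₂) (x - t)) hC₂.le)
    refine (mul_le_mul h1 h2 (norm_nonneg _) (mul_nonneg hC₁.le (sexp_nonneg _ _ _))).trans ?_
    have h4 := sexp_mul_sexp_shift_le hb hb1 hκ.le (r - t) (t - x)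
    rw [show t - x + (r - t) = r - x by ring, sexp_sub_comm _ _ t x, sexp_sub_comm _ _ r x,
      sexp_sub_comm _ (κ / 2) t x] at h4
    calc _ = C₁ * C₂ * (sexp b κ (x - t) * sexp b κ (x - r)) := by ring
      _ ≤ C₁ * C₂ * (sexp b (κ / 2) (r - t) * sexp b (κ / 2) (x - t)) := by gcongr C₁ * C₂ * ?_
      _ = _ := by ring
  have hi := ((integrable_sexp hb (half_pos hκ)).comp_sub_right t).const_mul
    (C₁ * C₂ * sexp b (κ / 2) (r - t))
  have hint : Integrable (fun x => ‖A (x - r)‖ * ‖h (x - t)‖) := by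
    refine hi.mono' ?_ (ae_of_all _ fun x => ?_)
    · have := A.continuous
      have := h.continuous
      exact Continuous.aestronglyMeasurable (by fun_prop)
    · rw [Real.norm_of_nonneg (by positivity)]; exact hbd x
  refine ⟨hint, (integral_mono hint hi hbd).trans ?_⟩
  rw [integral_const_mul, integral_sub_right_eq_self (sexp b (κ / 2))]
  have p := sexp_nonneg b (κ / 2) (r - t)
  nlinarith

/-- Integrals against modulated sums of lattice translates can be computed termwise. -/
theorem hasSum_integral_combFun (ha : 0 < a) (hb : 0 < b) (hb1 : b ≤ 1) (hA : IsSubexp b A)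
    (hc : ∀ n, ‖c n‖ ≤ Γ) {h : 𝓢(ℝ, ℂ)} (hh : IsSubexp b h) {G : ℝ → ℂ} (hG : Continuous G)
    {B : ℝ} (hB : ∀ x, ‖G x‖ ≤ B) (θ t : ℝ) :
    HasSum (fun n : ℤ => c n * ∫ x, A (x - n * a) * ec (θ * (x - n * a)) * (h (x - t) * G x))
      (∫ x, combFun a c A θ x * (h (x - t) * G x)) := by
  obtain ⟨κ, C, hκ, hC, hi⟩ := exists_integral_norm_mul_le hb hb1 hA hh
  obtain ⟨D, hD, hs⟩ := exists_tsum_sexp_le ha hb hb1 hκ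
  have hΓ : 0 ≤ Γ := (norm_nonneg _).trans (hc 0)
  have hB0 : 0 ≤ B := (norm_nonneg _).trans (hB 0)
  set F : ℤ → ℝ → ℂ := fun n x => c n * A (x - n * a) * ec (θ * (x - n * a)) * (h (x - t) * G x)
  have hFn : ∀ n x, ‖F n x‖ ≤ Γ * B * (‖A (x - n * a)‖ * ‖h (x - t)‖) := by
    intro n x
    simp only [F]
    rw [norm_mul, norm_mul (h _)]
    calc _ ≤ (Γ * ‖A (x - n * a)‖) * (‖h (x - t)‖ * B) := by
          gcongr
          · exact norm_combFun_term_le hc θ x n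
          · exact hB x
      _ = _ := by ring
  have hFi : ∀ n, Integrable (F n) := by
    intro n
    refine ((hi (n * a) t).1.const_mul (Γ * B)).mono' ?_ (ae_of_all _ (hFn n))
    have := A.continuous
    have := h.continuous
    exact Continuous.aestronglyMeasurable (by fun_prop)
  have hsum : Summable fun n => ∫ x, ‖F n x‖ := by
    refine Summable.of_nonneg_of_le (fun n => integral_nonneg fun x => norm_nonneg _) (fun n => ?_)
      ((hs t).1.mul_left (Γ * B * C))
    refine (integral_mono (hFi n).norm ((hi (n * a) t).1.const_mul (Γ * B)) (hFn n)).trans ?_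
    rw [integral_const_mul, mul_assoc _ C]
    exact mul_le_mul_of_nonneg_left (hi _ _).2 (by positivity)
  have := hasSum_integral_of_summable_integral_norm hFi hsum
  have e1 : (fun n : ℤ => c n * ∫ x, A (x - n * a) * ec (θ * (x - n * a)) * (h (x - t) * G x)) =
      fun n => ∫ x, F n x := by
    funext n
    rw [← integral_const_mul]
    refine integral_congr_ae (ae_of_all _ fun x => ?_)
    simp only [F]; ring
  have e2 : ∫ x, combFun a c A θ x * (h (x - t) * G x) = ∫ x, ∑' n, F n x := by
    refine integral_congr_ae (ae_of_all _ fun x => ?_)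
    simp only [combFun, F]
    rw [← tsum_mul_right]
  rw [e1, e2]
  exact this

/-- Termwise, the triple-product estimate applies at frequency `w - θ`, since the modulation by `θ`
shifts the frequency and leaves a unimodular constant. The factor decaying in `n a - t` makes the
series over `n` converge uniformly in `t`. -/
theorem exists_norm_integral_combFun_le (ha : 0 < a) (hb : 0 < b) (hb1 : b ≤ 1) {g h : 𝓢(ℝ, ℂ)}
    (hA : IsSubexp b A) (hg : IsSubexp b g) (hh : IsSubexp b h) (hc : ∀ n, ‖c n‖ ≤ Γ) :
    ∃ κ C : ℝ, 0 < κ ∧ 0 < C ∧ ∀ θ s t w : ℝ,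
      ‖∫ x, combFun a c A θ x * (h (x - t) * (g (x - s) * ec (-(x * w))))‖ ≤
        C * (sexp b κ (w - θ) * sexp b κ (s - t)) := by
  obtain ⟨κ, C, hκ, hC, ht⟩ := exists_norm_integral_triple_le hb hb1 hA hg hh
  obtain ⟨D, hD, hs⟩ := exists_tsum_sexp_le ha hb hb1 hκ
  have hΓ : 0 ≤ Γ := (norm_nonneg _).trans (hc 0)
  refine ⟨κ, Γ * C * D + 1, hκ, by positivity, fun θ s t w => ?_⟩
  have hgc := g.continuous
  have H := hasSum_integral_combFun ha hb hb1 hA hc hh (G := fun x => g (x - s) * ec (-(x * w)))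
    (by fun_prop) (B := SchwartzMap.seminorm ℂ 0 0 g)
    (fun x => by rw [norm_mul, norm_ec, mul_one]; exact g.norm_le_seminorm ℂ _) θ t
  have hterm : ∀ n : ℤ, ‖c n * ∫ x, A (x - n * a) * ec (θ * (x - n * a)) *
      (h (x - t) * (g (x - s) * ec (-(x * w))))‖ ≤
      Γ * C * (sexp b κ (w - θ) * sexp b κ (s - t)) * sexp b κ (n * a - t) := by
    intro n
    have e : ∫ x, A (x - n * a) * ec (θ * (x - n * a)) * (h (x - t) * (g (x - s) * ec (-(x * w)))) =
        ec (-(θ * (n * a))) *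
          ∫ x, A (x - n * a) * g (x - s) * h (x - t) * ec (-(x * (w - θ))) := by
      rw [← integral_const_mul]
      congr 1; ext x
      have e1 : ec (θ * (x - n * a)) * ec (-(x * w)) =
          ec (-(θ * (n * a))) * ec (-(x * (w - θ))) := by
        rw [← ec_add, ← ec_add]; ring_nf
      linear_combination (A (x - n * a) * g (x - s) * h (x - t)) * e1
    rw [e, norm_mul, norm_mul, norm_ec, one_mul]
    calc _ ≤ Γ * (C * (sexp b κ (w - θ) * sexp b κ (n * a - t) * sexp b κ (s - t))) :=
          mul_le_mul (hc n) (ht _ _ _ _) (norm_nonneg _) hΓ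
      _ = _ := by ring
  have h2 := tsum_of_norm_bounded ((hs t).1.mul_left _).hasSum hterm
  rw [H.tsum_eq, tsum_mul_left] at h2
  have p := mul_nonneg (sexp_nonneg b κ (w - θ)) (sexp_nonneg b κ (s - t))
  calc _ ≤ _ := h2
    _ ≤ Γ * C * (sexp b κ (w - θ) * sexp b κ (s - t)) * D := by gcongr; exact (hs t).2
    _ ≤ _ := by nlinarith

end Comb

/-! ### Seminorm estimates for Schwartz functions -/

section Seminorms

variable {E F : Type*} [NormedAddCommGroup E] [NormedSpace ℝ E] [NormedAddCommGroup F]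
  [NormedSpace ℝ F]

/-- The increasing family of Schwartz norms. -/
def schNorm (m : ℕ × ℕ) : Seminorm ℂ 𝓢(E, ℂ) := (Finset.Iic m).sup (schwartzSeminormFamily ℂ E ℂ)

theorem schNorm_nonneg (m : ℕ × ℕ) (φ : 𝓢(E, ℂ)) : 0 ≤ schNorm m φ := apply_nonneg _ _

theorem schNorm_le {m : ℕ × ℕ} {φ : 𝓢(E, ℂ)} {M : ℝ} (hM : 0 ≤ M)
    (h : ∀ k n x, k ≤ m.1 → n ≤ m.2 → ‖x‖ ^ k * ‖iteratedFDeriv ℝ n φ x‖ ≤ M) :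
    schNorm m φ ≤ M := by
  refine Seminorm.finset_sup_apply_le hM fun i hi => ?_
  rw [Finset.mem_Iic] at hi
  exact SchwartzMap.seminorm_le_bound ℂ _ _ _ hM fun x => h _ _ x hi.1 hi.2

theorem one_add_pow_mul_le_schNorm {m : ℕ × ℕ} {k n : ℕ} (hk : k ≤ m.1) (hn : n ≤ m.2)
    (φ : 𝓢(E, ℂ)) (x : E) :
    (1 + ‖x‖) ^ k * ‖iteratedFDeriv ℝ n φ x‖ ≤ 2 ^ m.1 * schNorm m φ :=
  one_add_le_sup_seminorm_apply (𝕜 := ℂ) hk hn φ x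

theorem one_add_pow_mul_norm_le_schNorm (k : ℕ) (φ : 𝓢(E, ℂ)) (x : E) :
    (1 + ‖x‖) ^ k * ‖φ x‖ ≤ 2 ^ k * schNorm (k, 0) φ := by
  have := one_add_pow_mul_le_schNorm (m := (k, 0)) le_rfl le_rfl φ x
  rwa [norm_iteratedFDeriv_zero] at this

theorem norm_iteratedFDeriv_le_schNorm (k n : ℕ) (φ : 𝓢(E, ℂ)) (x : E) :
    ‖x‖ ^ k * ‖iteratedFDeriv ℝ n φ x‖ ≤ schNorm (k, n) φ :=
  (φ.le_seminorm ℂ k n x).trans (Seminorm.le_finset_sup_apply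
    (p := schwartzSeminormFamily ℂ E ℂ) (s := Finset.Iic (k, n)) (i := (k, n)) (by simp))

theorem norm_le_schNorm (φ : 𝓢(E, ℂ)) (x : E) : ‖φ x‖ ≤ schNorm (0, 0) φ := by
  have := norm_iteratedFDeriv_le_schNorm 0 0 φ x
  simpa using this

theorem exists_sup_le_schNorm (s : Finset (ℕ × ℕ)) :
    ∃ m : ℕ × ℕ, s.sup (schwartzSeminormFamily ℂ E ℂ) ≤ schNorm m := by
  refine ⟨s.sup id, Finset.sup_mono fun i hi => ?_⟩
  exact Finset.mem_Iic.mpr (Finset.le_sup (f := id) hi)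

theorem exists_schNorm_map_le (A : 𝓢(E, ℂ) →L[ℂ] 𝓢(F, ℂ)) (m : ℕ × ℕ) :
    ∃ (m' : ℕ × ℕ) (C : ℝ), 0 ≤ C ∧ ∀ φ, schNorm m (A φ) ≤ C * schNorm m' φ := by
  obtain ⟨s, C, -, h⟩ := Seminorm.bound_of_continuous (schwartz_withSeminorms ℂ E ℂ)
    ((schNorm m).comp A.toLinearMap) (by
      have h1 : Continuous (schNorm m : 𝓢(F, ℂ) → ℝ) := by
        refine Seminorm.continuous_of_le (q := (Finset.Iic m).sup (schwartzSeminormFamily ℂ F ℂ))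
          ?_ le_rfl
        exact Seminorm.continuous_finsetSup
          fun i _ => (schwartz_withSeminorms ℂ F ℂ).continuous_seminorm i
      exact h1.comp A.continuous)
  obtain ⟨m', hm'⟩ := exists_sup_le_schNorm (E := E) s
  refine ⟨m', C, C.2, fun φ => (h φ).trans ?_⟩
  exact mul_le_mul_of_nonneg_left (hm' φ) C.2

theorem exists_norm_distribution_le (σ : 𝓢'(E, ℂ)) :
    ∃ (m : ℕ × ℕ) (C : ℝ), 0 ≤ C ∧ ∀ φ, ‖σ φ‖ ≤ C * schNorm m φ := by
  obtain ⟨s, C, -, h⟩ := Seminorm.bound_of_continuous (schwartz_withSeminorms ℂ E ℂ)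
    ((normSeminorm ℂ ℂ).comp (σ : 𝓢(E, ℂ) →ₗ[ℂ] ℂ)) (by
      exact continuous_norm.comp σ.continuous)
  obtain ⟨m', hm'⟩ := exists_sup_le_schNorm (E := E) s
  refine ⟨m', C, C.2, fun φ => (h φ).trans ?_⟩
  exact mul_le_mul_of_nonneg_left (hm' φ) C.2

theorem schNorm_compSubConst_le (m : ℕ × ℕ) (y : E) (φ : 𝓢(E, ℂ)) :
    schNorm m (compSubConstCLM ℂ y φ) ≤ 2 ^ m.1 * (1 + ‖y‖) ^ m.1 * schNorm m φ := by
  have h0 := schNorm_nonneg m φ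
  refine schNorm_le (by positivity) fun k n x hk hn => ?_
  have e : iteratedFDeriv ℝ n (compSubConstCLM ℂ y φ) x = iteratedFDeriv ℝ n φ (x - y) := by
    have : (compSubConstCLM ℂ y φ : E → ℂ) = fun x => φ (x - y) := by ext; simp
    rw [this, iteratedFDeriv_comp_sub]
  rw [e]
  have h1 : ‖x‖ ≤ (1 + ‖y‖) * (1 + ‖x - y‖) := by
    have := norm_add_le (x - y) y
    rw [sub_add_cancel] at this
    nlinarith [norm_nonneg y, norm_nonneg (x - y)]
  calc ‖x‖ ^ k * ‖iteratedFDeriv ℝ n φ (x - y)‖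
      ≤ ((1 + ‖y‖) * (1 + ‖x - y‖)) ^ k * ‖iteratedFDeriv ℝ n φ (x - y)‖ := by gcongr
    _ = (1 + ‖y‖) ^ k * ((1 + ‖x - y‖) ^ k * ‖iteratedFDeriv ℝ n φ (x - y)‖) := by
        rw [mul_pow]; ring
    _ ≤ (1 + ‖y‖) ^ m.1 * (2 ^ m.1 * schNorm m φ) := by
        refine mul_le_mul ?_ (one_add_pow_mul_le_schNorm hk hn φ _) (by positivity) (by positivity)
        exact pow_le_pow_right₀ (by linarith [norm_nonneg y]) hk
    _ = _ := by ring

/-- The product of `φ` with the translate `f(· - s)`. -/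
def mulShift (f : 𝓢(E, ℂ)) (s : E) : 𝓢(E, ℂ) →L[ℂ] 𝓢(E, ℂ) :=
  smulLeftCLM ℂ (compSubConstCLM ℂ s f)

@[simp]
theorem mulShift_apply (f φ : 𝓢(E, ℂ)) (s x : E) : mulShift f s φ x = f (x - s) * φ x := by
  rw [mulShift, smulLeftCLM_apply_apply (SchwartzMap.hasTemperateGrowth _)]
  simp

/-- Since `1 + ‖s‖ ≤ (1 + ‖x - s‖)(1 + ‖x‖)`, growth in the shift is paid half by the decay of `f`
around `s` and half by `N` additional weights on `φ`. -/
theorem exists_schNorm_mulShift_le (f : 𝓢(E, ℂ)) (N : ℕ) (m : ℕ × ℕ) :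
    ∃ C : ℝ, 0 ≤ C ∧ ∀ s φ,
      (1 + ‖s‖) ^ N * schNorm m (mulShift f s φ) ≤ C * schNorm (N + m.1, m.2) φ := by
  set D := 2 ^ N * schNorm (N, m.2) f
  have hD : 0 ≤ D := mul_nonneg (by positivity) (schNorm_nonneg _ f)
  refine ⟨2 ^ m.2 * (D * 2 ^ (N + m.1)), by positivity, fun s φ => ?_⟩
  have hφ := schNorm_nonneg (N + m.1, m.2) φ
  have hs : 0 < (1 + ‖s‖) ^ N := by positivity
  rw [← le_div_iff₀' hs]
  refine schNorm_le (by positivity) fun k n x hk hn => ?_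
  rw [le_div_iff₀' hs]
  have e : (mulShift f s φ : E → ℂ) = fun x => f (x - s) * φ x := by ext; simp
  have hl := norm_iteratedFDeriv_mul_le (𝕜 := ℝ) (N := ((⊤ : ℕ∞) : WithTop ℕ∞))
    (f := fun x : E => f (x - s)) (g := φ) (f.smooth'.comp (contDiff_id.sub contDiff_const))
    φ.smooth' x (n := n) (by exact_mod_cast le_top)
  rw [e]
  have h1 : (1 + ‖s‖) ≤ (1 + ‖x - s‖) * (1 + ‖x‖) := by
    have := norm_sub_le x (x - s)
    rw [sub_sub_cancel] at this
    nlinarith [norm_nonneg x, norm_nonneg (x - s)]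
  have hterm : ∀ i ∈ Finset.range (n + 1), (1 + ‖s‖) ^ N * (‖x‖ ^ k * ((n.choose i : ℝ) *
      ‖iteratedFDeriv ℝ i (fun x : E => f (x - s)) x‖ * ‖iteratedFDeriv ℝ (n - i) φ x‖)) ≤
      (n.choose i : ℝ) * (D * 2 ^ (N + m.1) * schNorm (N + m.1, m.2) φ) := by
    intro i hi
    have hi' : i ≤ n := Nat.lt_succ_iff.mp (Finset.mem_range.mp hi)
    rw [iteratedFDeriv_comp_sub]
    have a1 := one_add_pow_mul_le_schNorm (m := (N, m.2)) le_rfl (hi'.trans hn) f (x - s)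
    have a2 := one_add_pow_mul_le_schNorm (m := (N + m.1, m.2)) (k := N + k) (n := n - i)
      (by simpa using hk) ((Nat.sub_le _ _).trans hn) φ x
    set p := ‖iteratedFDeriv ℝ i f (x - s)‖
    set q := ‖iteratedFDeriv ℝ (n - i) φ x‖
    have hx : ‖x‖ ^ k ≤ (1 + ‖x‖) ^ k := by gcongr; linarith
    calc _ ≤ ((1 + ‖x - s‖) * (1 + ‖x‖)) ^ N * ((1 + ‖x‖) ^ k * ((n.choose i : ℝ) * p * q)) := by
          gcongr
      _ = (n.choose i : ℝ) * (((1 + ‖x - s‖) ^ N * p) * ((1 + ‖x‖) ^ (N + k) * q)) := by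
          rw [mul_pow, pow_add]; ring
      _ ≤ (n.choose i : ℝ) * (D * (2 ^ (N + m.1) * schNorm (N + m.1, m.2) φ)) := by gcongr
      _ = _ := by ring
  calc _ ≤ (1 + ‖s‖) ^ N * (‖x‖ ^ k * ∑ i ∈ Finset.range (n + 1), (n.choose i : ℝ) *
      ‖iteratedFDeriv ℝ i (fun x : E => f (x - s)) x‖ * ‖iteratedFDeriv ℝ (n - i) φ x‖) := by
        gcongr
    _ = ∑ i ∈ Finset.range (n + 1), (1 + ‖s‖) ^ N * (‖x‖ ^ k * ((n.choose i : ℝ) *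
      ‖iteratedFDeriv ℝ i (fun x : E => f (x - s)) x‖ * ‖iteratedFDeriv ℝ (n - i) φ x‖)) := by
        rw [Finset.mul_sum, Finset.mul_sum]
    _ ≤ ∑ i ∈ Finset.range (n + 1),
        (n.choose i : ℝ) * (D * 2 ^ (N + m.1) * schNorm (N + m.1, m.2) φ) :=
        Finset.sum_le_sum hterm
    _ = 2 ^ n * (D * 2 ^ (N + m.1) * schNorm (N + m.1, m.2) φ) := by
        rw [← Finset.sum_mul]
        congr 1
        exact_mod_cast Nat.sum_range_choose n
    _ ≤ 2 ^ m.2 * (D * 2 ^ (N + m.1) * schNorm (N + m.1, m.2) φ) := by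
        gcongr
        norm_num
    _ = _ := by ring

end Seminorms

/-! ### Compactly supported approximation, vanishing outside the support -/

section Cutoff

variable {E : Type*} [NormedAddCommGroup E] [NormedSpace ℝ E] [FiniteDimensional ℝ E]

/-- Smooth cutoff functions converging to `1`. -/
theorem exists_cutoff_tendsto (E : Type*) [NormedAddCommGroup E] [NormedSpace ℝ E]
    [FiniteDimensional ℝ E] :
    ∃ κ : ℕ → 𝓢(E, ℂ), (∀ j, HasCompactSupport (κ j)) ∧ (∀ j x, ‖κ j x‖ ≤ 1) ∧
      (∀ x, Tendsto (fun j => κ j x) atTop (𝓝 1)) ∧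
      ∀ φ : 𝓢(E, ℂ), Tendsto (fun j => smulLeftCLM ℂ (κ j) φ) atTop (𝓝 φ) := by
  let B : ContDiffBump (0 : E) := ⟨1, 2, one_pos, one_lt_two⟩
  have hBc : HasCompactSupport (fun x => (B x : ℂ)) :=
    B.hasCompactSupport.comp_left (g := fun r : ℝ => (r : ℂ)) (by simp)
  have hBs : ContDiff ℝ ((⊤ : ℕ∞) : WithTop ℕ∞) (fun x => (B x : ℂ)) :=
    Complex.ofRealCLM.contDiff.comp B.contDiff
  -- `1 - B` vanishes near the origin, so its derivatives are bounded by a multiple of `‖y‖`. After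
  -- scaling by `ε` this produces the factor `ε ‖x‖` that drives the convergence, at the price of
  -- one more power of `‖x‖` on `φ`.
  have hu : ∀ i : ℕ, ∃ C : ℝ, 0 ≤ C ∧ ∀ y : E,
      ‖iteratedFDeriv ℝ i (fun x => (1 : ℂ) - (B x : ℂ)) y‖ ≤ C * ‖y‖ := by
    intro i
    set Bs : 𝓢(E, ℂ) := hBc.toSchwartzMap hBs
    refine ⟨1 + schNorm (0, i) Bs, by linarith [schNorm_nonneg (0, i) Bs], fun y => ?_⟩
    by_cases hy : ‖y‖ < 1
    · have h0 : (fun x => (1 : ℂ) - (B x : ℂ)) =ᶠ[𝓝 y] fun _ => 0 := by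
        filter_upwards [Metric.isOpen_ball.mem_nhds (mem_ball_zero_iff.mpr hy)] with x hx
        rw [B.one_of_mem_closedBall (Metric.ball_subset_closedBall hx)]
        simp
      rw [(Filter.EventuallyEq.iteratedFDeriv ℝ h0 i).eq_of_nhds]
      have h00 : iteratedFDeriv ℝ i (fun _ : E => (0 : ℂ)) y = 0 := by
        rw [iteratedFDeriv_fun_zero]; rfl
      rw [h00, norm_zero]
      exact mul_nonneg (by linarith [schNorm_nonneg (0, i) Bs]) (norm_nonneg _)
    · push Not at hy
      have h1 : iteratedFDeriv ℝ i (fun x => (1 : ℂ) - (B x : ℂ)) y =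
          iteratedFDeriv ℝ i (fun _ : E => (1 : ℂ)) y - iteratedFDeriv ℝ i Bs y :=
        iteratedFDeriv_sub_apply (contDiff_const.contDiffAt)
          ((hBs.of_le (by exact_mod_cast le_top)).contDiffAt)
      have h2 : ‖iteratedFDeriv ℝ i (fun _ : E => (1 : ℂ)) y‖ ≤ 1 := by
        cases i with
        | zero => simp
        | succ i => rw [iteratedFDeriv_succ_const]; simp
      have h3 := norm_iteratedFDeriv_le_schNorm 0 i Bs y
      rw [pow_zero, one_mul] at h3
      rw [h1]
      calc _ ≤ 1 + schNorm (0, i) Bs := (norm_sub_le _ _).trans (add_le_add h2 h3)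
        _ ≤ _ := le_mul_of_one_le_right (by linarith [schNorm_nonneg (0, i) Bs]) hy
  let ε : ℕ → ℝ := fun j => 1 / ((j : ℝ) + 1)
  have hε : ∀ j, 0 < ε j := fun j => by positivity
  have hε1 : ∀ j, ε j ≤ 1 := fun j => by
    simp only [ε]
    rw [div_le_one (by positivity)]
    linarith [(Nat.cast_nonneg j : (0 : ℝ) ≤ j)]
  have hεt : Tendsto ε atTop (𝓝 0) := tendsto_one_div_add_atTop_nhds_zero_nat
  have hc : ∀ j, HasCompactSupport (fun x => (B (ε j • x) : ℂ)) := fun j =>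
    hBc.comp_homeomorph (Homeomorph.smulOfNeZero (ε j) (hε j).ne')
  have hs : ∀ j, ContDiff ℝ ((⊤ : ℕ∞) : WithTop ℕ∞) (fun x => (B (ε j • x) : ℂ)) := fun j =>
    hBs.comp (contDiff_const_smul (ε j))
  refine ⟨fun j => (hc j).toSchwartzMap (hs j), hc, fun j x => ?_, fun x => ?_, fun φ => ?_⟩
  · change ‖(B (ε j • x) : ℂ)‖ ≤ 1
    rw [Complex.norm_real, Real.norm_of_nonneg B.nonneg]
    exact B.le_one
  · change Tendsto (fun j => (B (ε j • x) : ℂ)) atTop (𝓝 1)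
    have h : Tendsto (fun j => ε j • x) atTop (𝓝 0) := by
      simpa using hεt.smul_const x
    refine tendsto_const_nhds.congr' ?_
    filter_upwards [h.eventually (Metric.closedBall_mem_nhds (0 : E) one_pos)] with j hj
    rw [B.one_of_mem_closedBall hj]; simp
  · rw [(schwartz_withSeminorms ℂ E ℂ).tendsto_nhds]
    rintro ⟨k, n⟩ δ hδ
    choose C hC hu using hu
    set D := ∑ i ∈ Finset.range (n + 1), (n.choose i : ℝ) * (C i * schNorm (k + 1, n - i) φ)
    have hD : 0 ≤ D := Finset.sum_nonneg fun i _ =>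
      mul_nonneg (by positivity) (mul_nonneg (hC i) (schNorm_nonneg _ φ))
    have hbound : ∀ j, schwartzSeminormFamily ℂ E ℂ (k, n)
        (smulLeftCLM ℂ ((hc j).toSchwartzMap (hs j)) φ - φ) ≤ ε j * D := by
      intro j
      rw [map_sub_rev]
      refine SchwartzMap.seminorm_le_bound ℂ _ _ _ (mul_nonneg (hε j).le hD) fun x => ?_
      have hL : ∀ i, ‖iteratedFDeriv ℝ i (fun x => (1 : ℂ) - (B (ε j • x) : ℂ)) x‖ ≤
          C i * (ε j * ‖x‖) := by
        intro i
        have h := (ε j • ContinuousLinearMap.id ℝ E).iteratedFDeriv_comp_right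
          (f := fun x => (1 : ℂ) - (B x : ℂ)) (n := ((⊤ : ℕ∞) : WithTop ℕ∞))
          (contDiff_const.sub hBs) x (i := i) (by exact_mod_cast le_top)
        have h' : iteratedFDeriv ℝ i (fun x => (1 : ℂ) - (B (ε j • x) : ℂ)) x = _ := h
        rw [h']
        refine (ContinuousMultilinearMap.norm_compContinuousLinearMap_le _ _).trans ?_
        have h2 := hu i (ε j • x)
        rw [norm_smul, Real.norm_of_nonneg (hε j).le] at h2
        refine (mul_le_of_le_one_right (norm_nonneg _) ?_).trans h2
        refine Finset.prod_le_one (fun _ _ => norm_nonneg _) fun _ _ => ?_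
        refine (norm_smul_le _ _).trans ?_
        rw [Real.norm_of_nonneg (hε j).le]
        exact mul_le_one₀ (hε1 j) (norm_nonneg _) ContinuousLinearMap.norm_id_le
      have e : ((φ - smulLeftCLM ℂ ((hc j).toSchwartzMap (hs j)) φ : 𝓢(E, ℂ)) : E → ℂ) =
          fun x => ((1 : ℂ) - (B (ε j • x) : ℂ)) * φ x := by
        funext x
        rw [sub_apply, smulLeftCLM_apply_apply (SchwartzMap.hasTemperateGrowth _)]
        change φ x - (B (ε j • x) : ℂ) • φ x = _
        rw [smul_eq_mul]; ring
      have hl := norm_iteratedFDeriv_mul_le (𝕜 := ℝ) (N := ((⊤ : ℕ∞) : WithTop ℕ∞))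
        (f := fun x : E => (1 : ℂ) - (B (ε j • x) : ℂ)) (g := φ) (contDiff_const.sub (hs j))
        φ.smooth' x (n := n) (by exact_mod_cast le_top)
      rw [e]
      refine (mul_le_mul_of_nonneg_left hl (by positivity)).trans ?_
      rw [Finset.mul_sum, Finset.mul_sum]
      refine Finset.sum_le_sum fun i _ => ?_
      calc _ ≤ ‖x‖ ^ k * ((n.choose i : ℝ) * (C i * (ε j * ‖x‖)) *
            ‖iteratedFDeriv ℝ (n - i) φ x‖) := by gcongr; exact hL i
        _ = ε j * ((n.choose i : ℝ) * (C i * (‖x‖ ^ (k + 1) * ‖iteratedFDeriv ℝ (n - i) φ x‖))) := by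
            ring
        _ ≤ _ := by
            have := hC i
            have := (hε j).le
            gcongr
            exact norm_iteratedFDeriv_le_schNorm _ _ φ x
    have ht : Tendsto (fun j => ε j * D) atTop (𝓝 0) := by simpa using hεt.mul_const D
    filter_upwards [ht.eventually (gt_mem_nhds hδ)] with j hj
    exact (hbound j).trans_lt hj

/-- A tempered distribution annihilates the Schwartz functions supported off its support. -/
theorem apply_eq_zero_of_disjoint_dsupport (η : 𝓢'(E, ℂ)) (φ : 𝓢(E, ℂ))
    (h : Disjoint (tsupport φ) (Distribution.dsupport η)) : η φ = 0 := by
  obtain ⟨κ, hκc, -, -, hκ⟩ := exists_cutoff_tendsto E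
  have hlim := (η.continuous.tendsto φ).comp (hκ φ)
  refine tendsto_nhds_unique hlim (tendsto_const_nhds.congr fun j => ?_)
  -- The cut-off function has compact support, which is covered by finitely many open sets on which
  -- `η` vanishes; a partition of unity splits it accordingly.
  set φ' := smulLeftCLM ℂ (κ j) φ
  have hsub := tsupport_smulLeftCLM_subset (F := ℂ) (κ j) φ
  set K := tsupport φ'
  have hK : IsCompact K := (hκc j).isCompact.of_isClosed_subset (isClosed_tsupport _)
    (hsub.trans Set.inter_subset_right)
  have hloc : ∀ x : E, ∃ U : Set E, IsOpen U ∧ (x ∈ K → x ∈ U ∧ Distribution.IsVanishingOn η U) := by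
    intro x
    by_cases hx : x ∈ K
    · have h1 : x ∉ Distribution.dsupport η :=
        Set.disjoint_left.mp h (hsub hx).1
      have h2 : x ∈ (Distribution.dsupport η)ᶜ := h1
      rw [Distribution.dsupport_compl_eq] at h2
      obtain ⟨U, ⟨hU1, hU2⟩, hxU⟩ := h2
      exact ⟨U, hU2, fun _ => ⟨hxU, hU1⟩⟩
    · exact ⟨Set.univ, isOpen_univ, fun h => absurd h hx⟩
  choose U hUo hU using hloc
  obtain ⟨t, htK, ht⟩ := hK.elim_nhds_subcover U fun x hx => (hUo x).mem_nhds (hU x hx).1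
  obtain ⟨ρ, hρ⟩ := SmoothPartitionOfUnity.exists_isSubordinate
    (I := modelWithCornersSelf ℝ E) (isClosed_tsupport φ') (fun x : t => U x) (fun x => hUo x)
    (fun x hx => by
      obtain ⟨i, hi, hxi⟩ := Set.mem_iUnion₂.mp (ht hx)
      exact Set.mem_iUnion.mpr ⟨⟨i, hi⟩, hxi⟩)
  have hφc : HasCompactSupport φ' := hK
  have hφs : ∀ i, ContDiff ℝ ((⊤ : ℕ∞) : WithTop ℕ∞) (fun x => ((ρ i x : ℝ) : ℂ) * φ' x) := fun i =>
    (Complex.ofRealCLM.contDiff.comp (ρ i).contMDiff.contDiff).mul φ'.smooth'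
  have hcs : ∀ i, HasCompactSupport (fun x => ((ρ i x : ℝ) : ℂ) * φ' x) := fun i => hφc.mul_left
  have hsum : φ' = ∑ i, (hcs i).toSchwartzMap (hφs i) := by
    ext x
    rw [sum_apply]
    change φ' x = ∑ i, ((ρ i x : ℝ) : ℂ) * φ' x
    rw [← Finset.sum_mul]
    by_cases hx : x ∈ K
    · have := ρ.sum_eq_one hx
      rw [finsum_eq_sum_of_fintype] at this
      rw [← Complex.ofReal_sum, this]; simp
    · rw [image_eq_zero_of_notMem_tsupport hx]; simp
  change 0 = η φ'
  rw [hsum, map_sum]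
  refine (Finset.sum_eq_zero fun i _ => ?_).symm
  refine (hU i.1 (htK i.1 i.2)).2 _ ?_
  refine (closure_mono ?_).trans (hρ i)
  intro x hx hx0
  apply hx
  change ((ρ i x : ℝ) : ℂ) * φ' x = 0
  rw [hx0]; simp

end Cutoff

/-! ### The symplectic Fourier transform and convolution -/

/-- The symplectic transform is the Fourier transform followed by a quarter turn, and the two
commute because the turn is an isometry. Both the square of the Fourier transform and the square of
the turn are the reflection, and the reflections cancel. -/
theorem symplecticFourierTest_symplecticFourierTest (φ : 𝓢(ℝ × ℝ, ℂ)) :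
    symplecticFourierTest (symplecticFourierTest φ) = φ := by
  let e := WithLp.prodContinuousLinearEquiv 2 ℝ ℝ ℝ
  let u : 𝓢(WithLp 2 (ℝ × ℝ), ℂ) := compCLMOfContinuousLinearEquiv ℂ e φ
  let l : WithLp 2 (ℝ × ℝ) ≃ₗ[ℝ] WithLp 2 (ℝ × ℝ) := (e.trans rotE).toLinearEquiv
  have hl : ∀ z, ‖l z‖ = ‖z‖ := by
    intro z
    have h1 : ‖l z‖ ^ 2 = ‖z‖ ^ 2 := by
      rw [WithLp.prod_norm_sq_eq_of_L2, WithLp.prod_norm_sq_eq_of_L2]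
      simp [l, e, rotE]
      ring
    exact (pow_left_inj₀ (norm_nonneg _) (norm_nonneg _) two_ne_zero).mp h1
  let ρ : WithLp 2 (ℝ × ℝ) ≃ₗᵢ[ℝ] WithLp 2 (ℝ × ℝ) := ⟨l, hl⟩
  have h1 : ∀ ψ : 𝓢(ℝ × ℝ, ℂ), ∀ z, symplecticFourierTest ψ z =
      𝓕 (ψ ∘ e : WithLp 2 (ℝ × ℝ) → ℂ) (rotE z) := fun ψ z => rfl
  have h2 : (symplecticFourierTest φ ∘ e : WithLp 2 (ℝ × ℝ) → ℂ) = 𝓕 (u : _ → ℂ) ∘ ρ := rfl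
  ext z
  rw [h1, h2, Real.fourier_comp_linearIsometry]
  have h3 : 𝓕 (𝓕 (u : WithLp 2 (ℝ × ℝ) → ℂ)) (ρ (rotE z)) = u (-(ρ (rotE z))) := by
    have h : 𝓕⁻ (𝓕 u) (-(ρ (rotE z))) = u (-(ρ (rotE z))) := by
      rw [FourierTransform.fourierInv_fourier_eq]
    rw [← h, fourierInv_coe, fourier_coe, Real.fourierInv_eq_fourier_neg, neg_neg]
  rw [h3]
  change φ (e (-(ρ (rotE z)))) = φ z
  congr 1
  ext <;> simp [ρ, l, e, rotE]

/-- The convolution of Schwartz functions on the plane. -/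
def convS (Φ ψ : 𝓢(ℝ × ℝ, ℂ)) : 𝓢(ℝ × ℝ, ℂ) :=
  symplecticFourierTest (smulLeftCLM ℂ (symplecticFourierTest ψ) (symplecticFourierTest Φ))

theorem symplecticFourierTest_smul_apply (χ ψ : 𝓢(ℝ × ℝ, ℂ)) (z : ℝ × ℝ) :
    symplecticFourierTest (smulLeftCLM ℂ (symplecticFourierTest ψ) χ) z =
      ∫ y, symplecticFourierTest χ (z - y) * ψ y := by
  have hz : ∀ (φ : 𝓢(ℝ × ℝ, ℂ)) (z : ℝ × ℝ), symplecticFourierTest φ z =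
      ∫ y : ℝ × ℝ, ec (z.2 * y.1 - y.2 * z.1) * φ y :=
    fun φ z => symplecticFourierTest_eq_ec φ z.1 z.2
  rw [hz]
  have h1 : ∀ ζ : ℝ × ℝ, ec (z.2 * ζ.1 - ζ.2 * z.1) *
      smulLeftCLM ℂ (symplecticFourierTest ψ) χ ζ =
      ∫ y : ℝ × ℝ, ec ((z - y).2 * ζ.1 - ζ.2 * (z - y).1) * χ ζ * ψ y := by
    intro ζ
    rw [smulLeftCLM_apply_apply (SchwartzMap.hasTemperateGrowth _), hz, smul_eq_mul,
      ← integral_mul_const, ← integral_const_mul]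
    congr 1; ext y
    have : ec (z.2 * ζ.1 - ζ.2 * z.1) * ec (ζ.2 * y.1 - y.2 * ζ.1) =
        ec ((z - y).2 * ζ.1 - ζ.2 * (z - y).1) := by
      rw [← ec_add, Prod.snd_sub, Prod.fst_sub]; ring_nf
    linear_combination (χ ζ * ψ y) * this
  simp_rw [h1, hz]
  rw [integral_integral_swap]
  · congr 1; ext y
    rw [← integral_mul_const]
  · have hi := χ.integrable (μ := volume) |>.mul_prod (ψ.integrable (μ := volume))
    refine hi.mono ?_ (ae_of_all _ fun p => ?_)
    · have := χ.continuous
      have := ψ.continuous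
      apply Continuous.aestronglyMeasurable
      simp only [Function.uncurry_def]
      fun_prop
    · simp [Function.uncurry_def, norm_ec]

theorem convS_apply (Φ ψ : 𝓢(ℝ × ℝ, ℂ)) (z : ℝ × ℝ) : convS Φ ψ z = ∫ y, Φ (z - y) * ψ y := by
  rw [convS, symplecticFourierTest_smul_apply, symplecticFourierTest_symplecticFourierTest]

/-- The transform of `σ` annihilates `(1 - χ)` times any test function, since `χ = 1` on an open
neighbourhood of its support. Multiplication by `χ` on the spreading side is convolution on the
symbol side, so `σ` is reproduced by convolution with the transform of `χ`. -/
theorem apply_eq_apply_convS (σ : 𝓢'(ℝ × ℝ, ℂ)) (χ : 𝓢(ℝ × ℝ, ℂ)) {U : Set (ℝ × ℝ)}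
    (hU : IsOpen U) (hσ : Distribution.dsupport (symplecticFourier σ) ⊆ U)
    (hχ : ∀ z ∈ U, χ z = 1) (ψ : 𝓢(ℝ × ℝ, ℂ)) :
    σ ψ = σ (convS (symplecticFourierTest χ) ψ) := by
  set ψ' := symplecticFourierTest ψ
  have h0 : symplecticFourier σ (ψ' - smulLeftCLM ℂ ψ' χ) = 0 := by
    refine apply_eq_zero_of_disjoint_dsupport _ _ (Disjoint.mono_right hσ ?_)
    refine (Set.disjoint_left.mpr fun z hz hzU => ?_)
    have hc : IsClosed Uᶜ := hU.isClosed_compl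
    have : z ∈ Uᶜ := by
      refine closure_minimal (t := Uᶜ)
        (fun x (hx : x ∈ Function.support _) (hxU : x ∈ U) => hx ?_) hc hz
      rw [sub_apply, smulLeftCLM_apply_apply (SchwartzMap.hasTemperateGrowth _), hχ x hxU]
      simp
    exact this hzU
  rw [map_sub, sub_eq_zero, symplecticFourier_apply, symplecticFourier_apply,
    symplecticFourierTest_symplecticFourierTest] at h0
  rw [h0, convS, symplecticFourierTest_symplecticFourierTest]

theorem integrable_one_add_pow_mul_norm {E : Type*} [NormedAddCommGroup E] [NormedSpace ℝ E]
    [FiniteDimensional ℝ E] [MeasurableSpace E] [BorelSpace E] (μ : Measure E)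
    [μ.IsAddHaarMeasure] (N : ℕ) (ψ : 𝓢(E, ℂ)) :
    Integrable (fun y => (1 + ‖y‖) ^ N * ‖ψ y‖) μ := by
  have h1 := (ψ.integrable_pow_mul μ 0).add (ψ.integrable_pow_mul μ N)
  refine (h1.const_mul (2 ^ N)).mono' ?_ (ae_of_all _ fun y => ?_)
  · have := ψ.continuous
    exact Continuous.aestronglyMeasurable (by fun_prop)
  · rw [Real.norm_of_nonneg (by positivity), Pi.add_apply, pow_zero, ← add_mul, ← mul_assoc]
    gcongr
    refine (add_pow_le zero_le_one (norm_nonneg y) N).trans ?_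
    rw [one_pow]
    gcongr
    · norm_num
    · omega

/-! ### Representation of symbols with bounded spectrum -/

/-- The function `y ↦ σ(Φ(· - y))`. -/
def regularize (σ : 𝓢'(ℝ × ℝ, ℂ)) (Φ : 𝓢(ℝ × ℝ, ℂ)) (y : ℝ × ℝ) : ℂ :=
  σ (compSubConstCLM ℂ y Φ)

theorem exists_norm_regularize_le (σ : 𝓢'(ℝ × ℝ, ℂ)) :
    ∃ (m : ℕ × ℕ) (C : ℝ), 0 ≤ C ∧
      ∀ Φ y, ‖regularize σ Φ y‖ ≤ C * schNorm m Φ * (1 + ‖y‖) ^ m.1 := by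
  obtain ⟨m, C, hC, h⟩ := exists_norm_distribution_le σ
  refine ⟨m, C * 2 ^ m.1, by positivity, fun Φ y => (h _).trans ?_⟩
  calc _ ≤ C * (2 ^ m.1 * (1 + ‖y‖) ^ m.1 * schNorm m Φ) := by
        gcongr; exact schNorm_compSubConst_le _ _ _
    _ = _ := by ring

theorem regularize_eq_integral {σ : 𝓢'(ℝ × ℝ, ℂ)} {s : ℝ × ℝ → ℂ} (hs : IsGivenBy σ s)
    {Φ : 𝓢(ℝ × ℝ, ℂ)} (hΦ : HasCompactSupport Φ) (y : ℝ × ℝ) :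
    regularize σ Φ y = ∫ z, s z * Φ (z - y) := by
  have hc : HasCompactSupport (compSubConstCLM ℂ y Φ) := by
    have : (compSubConstCLM ℂ y Φ : ℝ × ℝ → ℂ) = Φ ∘ (Homeomorph.subRight y) := by ext; simp
    rw [this]
    exact hΦ.comp_homeomorph _
  rw [regularize, hs.2 _ hc]
  simp

-- `s` is merely locally integrable and represents `σ` only on compactly supported tests, so Fubini
-- is available when both factors have compact support. The two support conditions are removed
-- afterwards, in `integral_regularize_mul` and `integral_growth_mul_eq_of_hasCompactSupport`, by
-- cutoffs and the polynomial bound on `regularize`.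
open scoped Pointwise in
theorem integral_regularize_mul_of_hasCompactSupport {σ : 𝓢'(ℝ × ℝ, ℂ)} {s : ℝ × ℝ → ℂ}
    (hs : IsGivenBy σ s) {Φ ψ : 𝓢(ℝ × ℝ, ℂ)} (hΦ : HasCompactSupport Φ)
    (hψ : HasCompactSupport ψ) : ∫ y, regularize σ Φ y * ψ y = σ (convS Φ ψ) := by
  set K := tsupport Φ + tsupport ψ
  have hK : IsCompact K := hΦ.isCompact.add hψ.isCompact
  have hzero : ∀ z y, z ∉ K → Φ (z - y) * ψ y = 0 := by
    intro z y hz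
    by_contra hne
    obtain ⟨h1, h2⟩ := mul_ne_zero_iff.mp hne
    refine hz (Set.mem_add.mpr ⟨z - y, subset_tsupport _ h1, y, subset_tsupport _ h2, ?_⟩)
    simp
  have hconv : HasCompactSupport (convS Φ ψ) := by
    refine HasCompactSupport.intro hK fun z hz => ?_
    rw [convS_apply]
    simp [hzero z _ hz]
  rw [hs.2 _ hconv]
  simp_rw [convS_apply, regularize_eq_integral hs hΦ, ← integral_mul_const, ← integral_const_mul]
  have hg : Integrable (K.indicator s) :=
    (integrable_indicator_iff hK.measurableSet).mpr (hs.1.integrableOn_isCompact hK)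
  have hi := (ψ.integrable (μ := volume)).mul_prod hg
  have hΦc := Φ.continuous
  have hψc := ψ.continuous
  rw [integral_integral_swap]
  · congr 1; ext z; congr 1; ext y; ring
  · refine (hi.norm.const_mul (schNorm (0, 0) Φ)).mono' ?_ (ae_of_all _ fun p => ?_)
    · refine AEStronglyMeasurable.mul (AEStronglyMeasurable.mul ?_ ?_) ?_
      · exact hs.1.aestronglyMeasurable.comp_snd
      · exact Continuous.aestronglyMeasurable (by fun_prop)
      · exact Continuous.aestronglyMeasurable (by fun_prop)
    · simp only [Function.uncurry_def, norm_mul]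
      by_cases hz : p.2 ∈ K
      · rw [Set.indicator_of_mem hz]
        have := norm_le_schNorm Φ (p.2 - p.1)
        calc _ = ‖Φ (p.2 - p.1)‖ * (‖ψ p.1‖ * ‖s p.2‖) := by ring
          _ ≤ _ := by gcongr
      · have := hzero p.2 p.1 hz
        rw [Set.indicator_of_notMem hz, mul_assoc, ← norm_mul, this]
        simp

theorem tendsto_schNorm {E : Type*} [NormedAddCommGroup E] [NormedSpace ℝ E] (m : ℕ × ℕ)
    {u : ℕ → 𝓢(E, ℂ)} {φ : 𝓢(E, ℂ)} (h : Tendsto u atTop (𝓝 φ)) :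
    Tendsto (fun j => schNorm m (u j)) atTop (𝓝 (schNorm m φ)) := by
  have h1 : Continuous (schNorm m : 𝓢(E, ℂ) → ℝ) :=
    Seminorm.continuous_finsetSup
      fun i _ => (schwartz_withSeminorms ℂ E ℂ).continuous_seminorm i
  exact (h1.tendsto φ).comp h

/-- Cutting off `Φ` gives parameter integrals of `s`, which are measurable; the general case is
their pointwise limit. -/
theorem measurable_regularize {σ : 𝓢'(ℝ × ℝ, ℂ)} {s : ℝ × ℝ → ℂ} (hs : IsGivenBy σ s)
    (Φ : 𝓢(ℝ × ℝ, ℂ)) : Measurable (regularize σ Φ) := by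
  obtain ⟨κ, hκc, -, -, hκ⟩ := exists_cutoff_tendsto (ℝ × ℝ)
  refine measurable_of_tendsto_metrizable (f := fun j => regularize σ (smulLeftCLM ℂ (κ j) Φ))
    (fun j => ?_) ?_
  · set Φ' := smulLeftCLM ℂ (κ j) Φ
    have hc : HasCompactSupport Φ' := (hκc j).isCompact.of_isClosed_subset (isClosed_tsupport _)
      ((tsupport_smulLeftCLM_subset (F := ℂ) (κ j) Φ).trans Set.inter_subset_right)
    obtain ⟨s', hs', he⟩ := hs.1.aestronglyMeasurable
    have : regularize σ Φ' = fun y => ∫ z, s' z * Φ' (z - y) := by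
      funext y
      rw [regularize_eq_integral hs hc]
      refine integral_congr_ae ?_
      filter_upwards [he] with z hz
      rw [hz]
    rw [this]
    refine StronglyMeasurable.measurable ?_
    have hΦ' := Φ'.continuous
    refine StronglyMeasurable.integral_prod_right
      (f := fun y z : ℝ × ℝ => s' z * Φ' (z - y)) ?_
    refine StronglyMeasurable.mul (hs'.comp_measurable measurable_snd) ?_
    exact Continuous.stronglyMeasurable (by fun_prop)
  · rw [tendsto_pi_nhds]
    intro y
    exact ((σ.continuous.comp (compSubConstCLM ℂ y).continuous).tendsto Φ).comp (hκ Φ)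

theorem integral_regularize_mul {σ : 𝓢'(ℝ × ℝ, ℂ)} {s : ℝ × ℝ → ℂ} (hs : IsGivenBy σ s)
    (Φ ψ : 𝓢(ℝ × ℝ, ℂ)) (hψ : HasCompactSupport ψ) :
    ∫ y, regularize σ Φ y * ψ y = σ (convS Φ ψ) := by
  obtain ⟨κ, hκc, -, -, hκ⟩ := exists_cutoff_tendsto (ℝ × ℝ)
  obtain ⟨m, C, hC, hb⟩ := exists_norm_regularize_le σ
  set u := fun j => smulLeftCLM ℂ (κ j) Φ
  obtain ⟨B, hB⟩ := (tendsto_schNorm m (hκ Φ)).bddAbove_range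
  have hB' : ∀ j, schNorm m (u j) ≤ B := fun j => hB ⟨j, rfl⟩
  have hc : ∀ j, HasCompactSupport (u j) := fun j =>
    (hκc j).isCompact.of_isClosed_subset (isClosed_tsupport _)
      ((tsupport_smulLeftCLM_subset (F := ℂ) (κ j) Φ).trans Set.inter_subset_right)
  have h1 : Tendsto (fun j => ∫ y, regularize σ (u j) y * ψ y) atTop
      (𝓝 (∫ y, regularize σ Φ y * ψ y)) := by
    refine tendsto_integral_of_dominated_convergence
      (fun y => C * B * ((1 + ‖y‖) ^ m.1 * ‖ψ y‖)) (fun j => ?_)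
      ((integrable_one_add_pow_mul_norm volume m.1 ψ).const_mul _) (fun j => ae_of_all _ fun y => ?_)
      (ae_of_all _ fun y => ?_)
    · exact (measurable_regularize hs _).aestronglyMeasurable.mul
        ψ.continuous.aestronglyMeasurable
    · rw [norm_mul]
      calc _ ≤ C * schNorm m (u j) * (1 + ‖y‖) ^ m.1 * ‖ψ y‖ := by gcongr; exact hb _ _
        _ ≤ C * B * (1 + ‖y‖) ^ m.1 * ‖ψ y‖ := by gcongr; exact hB' j
        _ = _ := by ring
    · refine Tendsto.mul_const _ ?_
      exact ((σ.continuous.comp (compSubConstCLM ℂ y).continuous).tendsto Φ).comp (hκ Φ)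
  have h2 : Tendsto (fun j => σ (convS (u j) ψ)) atTop (𝓝 (σ (convS Φ ψ))) := by
    have hcont : Continuous fun Φ => σ (convS Φ ψ) := by
      refine σ.continuous.comp ?_
      exact symplecticFourierTest.continuous.comp
        ((smulLeftCLM ℂ (symplecticFourierTest ψ)).continuous.comp symplecticFourierTest.continuous)
    exact (hcont.tendsto Φ).comp (hκ Φ)
  refine tendsto_nhds_unique h1 (h2.congr fun j => ?_)
  exact (integral_regularize_mul_of_hasCompactSupport hs (hc j) hψ).symm

theorem integral_growth_mul_eq_of_hasCompactSupport {σ : 𝓢'(ℝ × ℝ, ℂ)} {S : ℝ × ℝ → ℂ}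
    (hS : Measurable S) {C : ℝ} {N : ℕ} (hC : 0 ≤ C) (hb : ∀ y, ‖S y‖ ≤ C * (1 + ‖y‖) ^ N)
    (h : ∀ ψ : 𝓢(ℝ × ℝ, ℂ), HasCompactSupport ψ → σ ψ = ∫ y, S y * ψ y) (ψ : 𝓢(ℝ × ℝ, ℂ)) :
    σ ψ = ∫ y, S y * ψ y := by
  obtain ⟨κ, hκc, hκ1, hκt, hκ⟩ := exists_cutoff_tendsto (ℝ × ℝ)
  have hc : ∀ j, HasCompactSupport (smulLeftCLM ℂ (κ j) ψ) := fun j =>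
    (hκc j).isCompact.of_isClosed_subset (isClosed_tsupport _)
      ((tsupport_smulLeftCLM_subset (F := ℂ) (κ j) ψ).trans Set.inter_subset_right)
  have h1 := (σ.continuous.tendsto ψ).comp (hκ ψ)
  refine tendsto_nhds_unique h1 ?_
  have h2 : (σ ∘ fun j => smulLeftCLM ℂ (κ j) ψ) =
      fun j => ∫ y, S y * smulLeftCLM ℂ (κ j) ψ y := funext fun j => h _ (hc j)
  change Tendsto (σ ∘ fun j => smulLeftCLM ℂ (κ j) ψ) atTop _
  rw [h2]
  refine tendsto_integral_of_dominated_convergence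
      (fun y => C * ((1 + ‖y‖) ^ N * ‖ψ y‖)) (fun j => ?_)
      ((integrable_one_add_pow_mul_norm volume N ψ).const_mul _) (fun j => ae_of_all _ fun y => ?_)
      (ae_of_all _ fun y => ?_)
  · exact hS.aestronglyMeasurable.mul (SchwartzMap.continuous _).aestronglyMeasurable
  · rw [smulLeftCLM_apply_apply (SchwartzMap.hasTemperateGrowth _), norm_mul, norm_smul]
    calc _ ≤ C * (1 + ‖y‖) ^ N * (1 * ‖ψ y‖) := by
          gcongr
          · exact hb y
          · exact hκ1 j y
      _ = _ := by ring
  · refine Tendsto.const_mul _ ?_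
    simp_rw [smulLeftCLM_apply_apply (SchwartzMap.hasTemperateGrowth _)]
    simpa using (hκt y).smul_const (ψ y)

theorem ae_eq_of_forall_integral_mul_eq {s S : ℝ × ℝ → ℂ} (hs : LocallyIntegrable s)
    (hS : LocallyIntegrable S)
    (h : ∀ ψ : 𝓢(ℝ × ℝ, ℂ), HasCompactSupport ψ → ∫ y, s y * ψ y = ∫ y, S y * ψ y) :
    s =ᵐ[volume] S := by
  refine ae_eq_of_integral_contDiff_smul_eq hs hS fun g hg hgc => ?_
  have hgc' : HasCompactSupport (fun x => (g x : ℂ)) :=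
    hgc.comp_left (g := fun r : ℝ => (r : ℂ)) (by simp)
  have h1 := h (hgc'.toSchwartzMap (Complex.ofRealCLM.contDiff.comp hg)) hgc'
  have h2 : ∀ f : ℝ × ℝ → ℂ, ∫ y, g y • f y =
      ∫ y, f y * hgc'.toSchwartzMap (Complex.ofRealCLM.contDiff.comp hg) y := fun f => by
    refine integral_congr_ae (ae_of_all _ fun y => ?_)
    change g y • f y = f y * (g y : ℂ)
    rw [Complex.real_smul, mul_comm]
  rw [h2, h2, h1]

/-- A symbol whose spreading function has bounded support, and which is a function, is a function
of polynomial growth. -/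
theorem exists_symbol_function {σ : 𝓢'(ℝ × ℝ, ℂ)} {s : ℝ × ℝ → ℂ} (hs : IsGivenBy σ s)
    {χ : 𝓢(ℝ × ℝ, ℂ)} {U : Set (ℝ × ℝ)} (hU : IsOpen U)
    (hσ : Distribution.dsupport (symplecticFourier σ) ⊆ U) (hχ : ∀ z ∈ U, χ z = 1) :
    Measurable (regularize σ (symplecticFourierTest χ)) ∧
    (∃ (N : ℕ) (C : ℝ), 0 ≤ C ∧
      ∀ y, ‖regularize σ (symplecticFourierTest χ) y‖ ≤ C * (1 + ‖y‖) ^ N) ∧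
    (∀ ψ, σ ψ = ∫ y, regularize σ (symplecticFourierTest χ) y * ψ y) ∧
    ∀ s', IsGivenBy σ s' → s' =ᵐ[volume] regularize σ (symplecticFourierTest χ) := by
  obtain ⟨m, C, hC, hb⟩ := exists_norm_regularize_le σ
  have hm := measurable_regularize hs (symplecticFourierTest χ)
  have hint : ∀ ψ : 𝓢(ℝ × ℝ, ℂ), HasCompactSupport ψ →
      σ ψ = ∫ y, regularize σ (symplecticFourierTest χ) y * ψ y := fun ψ hψ =>
    (apply_eq_apply_convS σ χ hU hσ hχ ψ).trans (integral_regularize_mul hs _ _ hψ).symm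
  have hb' := hb (symplecticFourierTest χ)
  have hC' : 0 ≤ C * schNorm m (symplecticFourierTest χ) := mul_nonneg hC (schNorm_nonneg _ _)
  generalize C * schNorm m (symplecticFourierTest χ) = D at hb' hC'
  generalize regularize σ (symplecticFourierTest χ) = S at hm hint hb' ⊢
  refine ⟨hm, ⟨m.1, _, hC', hb'⟩,
    integral_growth_mul_eq_of_hasCompactSupport hm hC' hb' hint, fun s' hs' => ?_⟩
  have hSl : LocallyIntegrable S := by
    have hg : LocallyIntegrable fun y : ℝ × ℝ =>
        D * (1 + ‖y‖) ^ m.1 :=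
      Continuous.locallyIntegrable (by fun_prop)
    exact hg.mono hm.aestronglyMeasurable (ae_of_all _ fun y => (hb' y).trans (le_abs_self _))
  exact ae_eq_of_forall_integral_mul_eq hs'.1 hSl fun ψ hψ => by
    rw [← hs'.2 ψ hψ, hint ψ hψ]

/-! ### Integrals of Schwartz functions depending on a parameter -/

/-- Measurable functions of at most polynomial growth. -/
structure IsPolyBounded (S : ℝ × ℝ → ℂ) : Prop where
  measurable : Measurable S
  exists_bound : ∃ (N : ℕ) (C : ℝ), 0 ≤ C ∧ ∀ y, ‖S y‖ ≤ C * (1 + ‖y‖) ^ N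

theorem integrable_inv_one_add_pow_three :
    Integrable fun z : ℝ × ℝ => ((1 + ‖z‖) ^ 3)⁻¹ := by
  have h := integrable_one_add_norm (E := ℝ × ℝ) (μ := volume) (r := 3) (by simp; norm_num)
  refine h.congr (ae_of_all _ fun z => ?_)
  simp only
  rw [Real.rpow_neg (by positivity)]
  norm_cast

/-- The `N` powers cancel the growth of `S`, and the three spare ones leave a function integrable
over the plane. -/
theorem integrable_mul_of_rapid_decay {S : ℝ × ℝ → ℂ} {C : ℝ} {N : ℕ}
    (hS : ∀ y, ‖S y‖ ≤ C * (1 + ‖y‖) ^ N) {g : ℝ} {A D : ℝ} (z : ℝ × ℝ) (hA : 0 ≤ A) (hg : 0 ≤ g)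
    (h : (1 + ‖z‖) ^ (N + 3) * (A * g) ≤ D) : A * (‖S z‖ * g) ≤ C * D * ((1 + ‖z‖) ^ 3)⁻¹ := by
  have hC : 0 ≤ C := by simpa using (norm_nonneg _).trans (hS 0)
  rw [← div_eq_mul_inv, le_div_iff₀ (by positivity)]
  calc A * (‖S z‖ * g) * (1 + ‖z‖) ^ 3 ≤ A * ((C * (1 + ‖z‖) ^ N) * g) * (1 + ‖z‖) ^ 3 := by
        gcongr; exact hS z
    _ = C * ((1 + ‖z‖) ^ (N + 3) * (A * g)) := by rw [pow_add]; ring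
    _ ≤ _ := by gcongr

theorem measurable_iteratedDeriv_param {Z : Type*} [MeasurableSpace Z] (G : Z → 𝓢(ℝ, ℂ))
    (h : ∀ y, Measurable fun z => G z y) (n : ℕ) (y : ℝ) :
    Measurable fun z => iteratedDeriv n (G z) y := by
  induction n generalizing y with
  | zero => simpa using h y
  | succ n ih =>
    refine measurable_of_tendsto_metrizable (f := fun (k : ℕ) z =>
      ((1 : ℝ) / ((k : ℝ) + 1))⁻¹ • (iteratedDeriv n (G z) (y + 1 / ((k : ℝ) + 1)) -
        iteratedDeriv n (G z) y)) (fun k => ?_) ?_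
    · exact Measurable.const_smul ((ih _).sub (ih y)) (((1 : ℝ) / ((k : ℝ) + 1))⁻¹)
    · rw [tendsto_pi_nhds]
      intro z
      have hd : HasDerivAt (iteratedDeriv n (G z)) (iteratedDeriv (n + 1) (G z) y) y := by
        rw [iteratedDeriv_succ]
        exact (((G z).smooth'.differentiable_iteratedDeriv n
          (by exact_mod_cast ENat.natCast_lt_top n)) y).hasDerivAt
      refine hd.tendsto_slope_zero_right.comp (tendsto_nhdsWithin_iff.mpr
        ⟨tendsto_one_div_add_atTop_nhds_zero_nat, Eventually.of_forall fun k => ?_⟩)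
      simp only [Set.mem_Ioi]
      positivity

/-- The seminorms of `Q z φ` decay in `z` faster than any power, uniformly relative to a seminorm of
`φ`. This beats the polynomial growth of `S`, so one may differentiate under the integral and bound
all seminorms of the result. -/
theorem exists_weakIntegral_clm {S : ℝ × ℝ → ℂ} (hS : IsPolyBounded S)
    (Q : ℝ × ℝ → 𝓢(ℝ, ℂ) →L[ℂ] 𝓢(ℝ, ℂ)) (hQm : ∀ φ y, Measurable fun z => Q z φ y)
    (hQb : ∀ N m, ∃ (m' : ℕ × ℕ) (C : ℝ), 0 ≤ C ∧
      ∀ z φ, (1 + ‖z‖) ^ N * schNorm m (Q z φ) ≤ C * schNorm m' φ) :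
    ∃ T : 𝓢(ℝ, ℂ) →L[ℂ] 𝓢(ℝ, ℂ), ∀ φ y, T φ y = ∫ z, S z * Q z φ y := by
  obtain ⟨hSm, N, C, hC, hSb⟩ := hS
  have hb : ∀ k n, ∃ (m' : ℕ × ℕ) (D : ℝ), 0 ≤ D ∧ ∀ φ y z,
      ‖y‖ ^ k * ‖S z * iteratedDeriv n (Q z φ) y‖ ≤
        C * (D * schNorm m' φ) * ((1 + ‖z‖) ^ 3)⁻¹ := by
    intro k n
    obtain ⟨m', D, hD, h⟩ := hQb (N + 3) (k, n)
    refine ⟨m', D, hD, fun φ y z => ?_⟩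
    rw [norm_mul]
    refine integrable_mul_of_rapid_decay hSb z (by positivity) (norm_nonneg _) ?_
    refine le_trans ?_ (h z φ)
    gcongr
    rw [← norm_iteratedFDeriv_eq_norm_iteratedDeriv]
    exact norm_iteratedFDeriv_le_schNorm k n (Q z φ) y
  have hm : ∀ n φ y, Measurable fun z => S z * iteratedDeriv n (Q z φ) y := fun n φ y =>
    hSm.mul (measurable_iteratedDeriv_param (fun z => Q z φ) (hQm φ) n y)
  have hi : ∀ n φ y, Integrable fun z => S z * iteratedDeriv n (Q z φ) y := by
    intro n φ y
    obtain ⟨m', D, hD, h⟩ := hb 0 n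
    refine (integrable_inv_one_add_pow_three.const_mul (C * (D * schNorm m' φ))).mono'
      (hm n φ y).aestronglyMeasurable (ae_of_all _ fun z => ?_)
    simpa using h φ y z
  have hderiv : ∀ n φ y, HasDerivAt (fun y => ∫ z, S z * iteratedDeriv n (Q z φ) y)
      (∫ z, S z * iteratedDeriv (n + 1) (Q z φ) y) y := by
    intro n φ y
    obtain ⟨m', D, hD, h⟩ := hb 0 (n + 1)
    refine (hasDerivAt_integral_of_dominated_loc_of_deriv_le (s := Set.univ)
      (F := fun y z => S z * iteratedDeriv n (Q z φ) y)
      (F' := fun y z => S z * iteratedDeriv (n + 1) (Q z φ) y)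
      (bound := fun z => C * (D * schNorm m' φ) * ((1 + ‖z‖) ^ 3)⁻¹)
      univ_mem (Eventually.of_forall fun y => (hm n φ y).aestronglyMeasurable) (hi n φ y)
      (hm (n + 1) φ y).aestronglyMeasurable (ae_of_all _ fun z y _ => ?_)
      (integrable_inv_one_add_pow_three.const_mul _) (ae_of_all _ fun z y _ => ?_)).2
    · simpa using h φ y z
    · refine HasDerivAt.const_mul _ ?_
      rw [iteratedDeriv_succ]
      exact (((Q z φ).smooth'.differentiable_iteratedDeriv n
        (by exact_mod_cast ENat.natCast_lt_top n)) y).hasDerivAt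
  have hid : ∀ n φ, iteratedDeriv n (fun y => ∫ z, S z * Q z φ y) =
      fun y => ∫ z, S z * iteratedDeriv n (Q z φ) y := by
    intro n φ
    induction n with
    | zero => simp
    | succ n ih => rw [iteratedDeriv_succ, ih]; funext y; exact (hderiv n φ y).deriv
  refine ⟨SchwartzMap.mkCLM (𝕜 := ℂ) (σ := RingHom.id ℂ) (fun φ y => ∫ z, S z * Q z φ y)
    (fun φ ψ y => ?_) (fun a φ y => ?_) (fun φ => ?_) (fun ⟨k, n⟩ => ?_), fun φ y => rfl⟩
  · have h1 := hi 0 φ y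
    have h2 := hi 0 ψ y
    simp only [iteratedDeriv_zero] at h1 h2
    rw [← integral_add h1 h2]
    congr 1; ext z
    rw [map_add, add_apply, mul_add]
  · rw [RingHom.id_apply, ← integral_smul]
    congr 1; ext z
    rw [map_smul, smul_apply, smul_eq_mul, smul_eq_mul]
    ring
  · refine contDiff_of_differentiable_iteratedDeriv fun n _ => ?_
    rw [hid]
    exact fun y => (hderiv n φ y).differentiableAt
  · obtain ⟨m', D, hD, h⟩ := hb k n
    set J := ∫ z : ℝ × ℝ, ((1 + ‖z‖) ^ 3)⁻¹
    have hJ : 0 ≤ J := integral_nonneg fun z => by positivity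
    refine ⟨Finset.Iic m', C * D * J, by positivity, fun φ y => ?_⟩
    rw [norm_iteratedFDeriv_eq_norm_iteratedDeriv, hid]
    have h1 : ‖y‖ ^ k * ‖∫ z, S z * iteratedDeriv n (Q z φ) y‖ =
        ‖∫ z, ((‖y‖ ^ k : ℝ) : ℂ) * (S z * iteratedDeriv n (Q z φ) y)‖ := by
      rw [integral_const_mul, norm_mul, Complex.norm_real,
        Real.norm_of_nonneg (show 0 ≤ ‖y‖ ^ k by positivity)]
    simp only
    rw [h1]
    refine (norm_integral_le_of_norm_le
      (integrable_inv_one_add_pow_three.const_mul (C * (D * schNorm m' φ)))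
      (ae_of_all _ fun z => ?_)).trans ?_
    · rw [norm_mul, Complex.norm_real, Real.norm_of_nonneg (show 0 ≤ ‖y‖ ^ k by positivity)]
      exact h φ y z
    · rw [integral_const_mul]
      change _ ≤ C * D * J * schNorm m' φ
      apply le_of_eq; ring

/-! ### The transpose of an operator with bounded spreading support -/

/-- The operators out of which the transpose of an operator is assembled. -/
def kernelOp (χ₁ χ₂ : 𝓢(ℝ, ℂ)) (z : ℝ × ℝ) : 𝓢(ℝ, ℂ) →L[ℂ] 𝓢(ℝ, ℂ) :=
  (fourierCLM ℂ 𝓢(ℝ, ℂ)).comp ((mulShift (𝓕 χ₁) z.2).comp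
    ((fourierInvCLM ℂ 𝓢(ℝ, ℂ)).comp (mulShift (𝓕⁻ χ₂) z.1)))

/-- The two multiplications localize in time near `z.1` and in frequency near `z.2`; each yields
arbitrary polynomial decay in its own coordinate, and the Fourier transforms in between are
continuous on Schwartz space. -/
theorem exists_schNorm_kernelOp_le (χ₁ χ₂ : 𝓢(ℝ, ℂ)) (N : ℕ) (m : ℕ × ℕ) :
    ∃ (m' : ℕ × ℕ) (C : ℝ), 0 ≤ C ∧
      ∀ z φ, (1 + ‖z‖) ^ N * schNorm m (kernelOp χ₁ χ₂ z φ) ≤ C * schNorm m' φ := by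
  obtain ⟨m₁, C₁, hC₁, h₁⟩ := exists_schNorm_map_le (fourierCLM ℂ 𝓢(ℝ, ℂ)) m
  obtain ⟨C₂, hC₂, h₂⟩ := exists_schNorm_mulShift_le (𝓕 χ₁) N m₁
  obtain ⟨m₃, C₃, hC₃, h₃⟩ := exists_schNorm_map_le (fourierInvCLM ℂ 𝓢(ℝ, ℂ)) (N + m₁.1, m₁.2)
  obtain ⟨C₄, hC₄, h₄⟩ := exists_schNorm_mulShift_le (𝓕⁻ χ₂) N m₃
  refine ⟨(N + m₃.1, m₃.2), C₁ * (C₂ * (C₃ * C₄)), by positivity, fun z φ => ?_⟩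
  have hz : 1 + ‖z‖ ≤ (1 + ‖z.1‖) * (1 + ‖z.2‖) := by
    have : ‖z‖ ≤ ‖z.1‖ + ‖z.2‖ := by
      rw [Prod.norm_def]
      exact max_le_add_of_nonneg (norm_nonneg _) (norm_nonneg _)
    nlinarith [norm_nonneg z.1, norm_nonneg z.2]
  set φ₁ := mulShift (𝓕⁻ χ₂) z.1 φ
  set φ₂ := fourierInvCLM ℂ 𝓢(ℝ, ℂ) φ₁
  set φ₃ := mulShift (𝓕 χ₁) z.2 φ₂
  have e : kernelOp χ₁ χ₂ z φ = fourierCLM ℂ 𝓢(ℝ, ℂ) φ₃ := rfl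
  rw [e]
  have n0 := schNorm_nonneg m (fourierCLM ℂ 𝓢(ℝ, ℂ) φ₃)
  have n3 := schNorm_nonneg m₁ φ₃
  calc _ ≤ ((1 + ‖z.1‖) * (1 + ‖z.2‖)) ^ N * (C₁ * schNorm m₁ φ₃) := by gcongr; exact h₁ _
    _ = C₁ * ((1 + ‖z.1‖) ^ N * ((1 + ‖z.2‖) ^ N * schNorm m₁ φ₃)) := by rw [mul_pow]; ring
    _ ≤ C₁ * ((1 + ‖z.1‖) ^ N * (C₂ * (C₃ * schNorm m₃ φ₁))) := by
        gcongr C₁ * (_ * ?_)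
        exact (h₂ _ _).trans (mul_le_mul_of_nonneg_left (h₃ _) hC₂)
    _ = C₁ * (C₂ * (C₃ * ((1 + ‖z.1‖) ^ N * schNorm m₃ φ₁))) := by ring
    _ ≤ C₁ * (C₂ * (C₃ * (C₄ * schNorm (N + m₃.1, m₃.2) φ))) := by
        gcongr C₁ * (C₂ * (C₃ * ?_))
        exact h₄ _ _
    _ = _ := by ring

/-- Carrying out the frequency integral by Fourier inversion exhibits the integral kernel. In this
form the value at a lattice point `n a` becomes a term of a modulated lattice sum. -/
theorem kernelOp_apply (χ₁ χ₂ φ : 𝓢(ℝ, ℂ)) (z : ℝ × ℝ) (y : ℝ) :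
    kernelOp χ₁ χ₂ z φ y = ∫ x, 𝓕⁻ χ₂ (x - z.1) * φ x * (χ₁ (x - y) * ec (z.2 * (x - y))) := by
  have hin : ∀ x, ∫ v, ec ((x - y) * v) * 𝓕 χ₁ (v - z.2) = χ₁ (x - y) * ec (z.2 * (x - y)) := by
    intro x
    have h1 : ∫ v, ec ((x - y) * v) * 𝓕 χ₁ (v - z.2) =
        ∫ v, ec ((x - y) * (v + z.2)) * 𝓕 χ₁ v := by
      rw [← integral_sub_right_eq_self (fun v => ec ((x - y) * (v + z.2)) * 𝓕 χ₁ v) z.2]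
      congr 1; ext v; simp
    have h2 : 𝓕⁻ (𝓕 χ₁) (x - y) = χ₁ (x - y) := by rw [FourierTransform.fourierInv_fourier_eq]
    rw [h1, ← h2, fourierInv_coe, fourierInv_eq_ec, ← integral_mul_const]
    congr 1; ext v
    rw [show (x - y) * (v + z.2) = v * (x - y) + z.2 * (x - y) by ring, ec_add]
    ring
  have e : kernelOp χ₁ χ₂ z φ y = 𝓕 (mulShift (𝓕 χ₁) z.2
    (𝓕⁻ (mulShift (𝓕⁻ χ₂) z.1 φ))) y := rfl
  rw [e, fourier_coe, fourier_eq_ec]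
  simp_rw [mulShift_apply, fourierInv_coe, fourierInv_eq_ec, ← hin, ← integral_const_mul]
  rw [integral_integral_swap]
  · congr 1; ext x
    congr 1; ext v
    have : ec (-(v * y)) * ec (x * v) = ec ((x - y) * v) := by rw [← ec_add]; ring_nf
    rw [mulShift_apply, fourierInv_coe, fourierInv_eq_ec]
    linear_combination (𝓕 χ₁ (v - z.2) * ((∫ t, ec (t * (x - z.1)) * χ₂ t) * φ x)) * this
  · have hi := ((𝓕 χ₁).integrable (μ := volume)).comp_sub_right z.2 |>.mul_prod
      ((mulShift (𝓕⁻ χ₂) z.1 φ).integrable (μ := volume))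
    refine hi.mono ?_ (ae_of_all _ fun p => ?_)
    · have := (𝓕 χ₁).continuous
      have := (mulShift (𝓕⁻ χ₂) z.1 φ).continuous
      apply Continuous.aestronglyMeasurable
      simp only [Function.uncurry_def]
      fun_prop
    · simp [Function.uncurry_def, norm_ec]

theorem measurable_kernelOp (χ₁ χ₂ φ : 𝓢(ℝ, ℂ)) :
    Measurable fun p : (ℝ × ℝ) × ℝ => kernelOp χ₁ χ₂ p.1 φ p.2 := by
  simp_rw [kernelOp_apply]
  refine StronglyMeasurable.measurable (StronglyMeasurable.integral_prod_right
    (f := fun (p : (ℝ × ℝ) × ℝ) (x : ℝ) => 𝓕⁻ χ₂ (x - p.1.1) * φ x *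
      (χ₁ (x - p.2) * ec (p.1.2 * (x - p.2)))) ?_)
  have h1 := (𝓕⁻ χ₂).continuous
  have h2 := φ.continuous
  have h3 := χ₁.continuous
  apply Continuous.stronglyMeasurable
  simp only [Function.uncurry_def]
  fun_prop

theorem symplecticFourierTest_tensor (χ₁ χ₂ : 𝓢(ℝ, ℂ)) (z : ℝ × ℝ) :
    symplecticFourierTest (tensor χ₁ χ₂) z = 𝓕 χ₂ z.1 * 𝓕⁻ χ₁ z.2 := by
  have h := symplecticFourierTest_eq_ec (tensor χ₁ χ₂) z.1 z.2
  rw [show symplecticFourierTest (tensor χ₁ χ₂) z =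
    symplecticFourierTest (tensor χ₁ χ₂) (z.1, z.2) from rfl, h, fourier_coe, fourierInv_coe,
    fourier_eq_ec, fourierInv_eq_ec, mul_comm, ← integral_prod_mul]
  congr 1; ext p
  rw [tensor_apply, show z.2 * p.1 - p.2 * z.1 = p.1 * z.2 + -(p.2 * z.1) by ring, ec_add]
  ring

/-- The bridge from symbols to operators: the smoothed test function for the symbol is itself a
pairing of `f` with a Schwartz function. Integrating against `S` therefore moves the whole operator
onto `φ`. -/
theorem convS_symbolTest (χ₁ χ₂ f φ : 𝓢(ℝ, ℂ)) (z : ℝ × ℝ) :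
    convS (symplecticFourierTest (tensor χ₁ χ₂)) (symbolTest f φ) z =
      ∫ y, f y * kernelOp χ₁ χ₂ z φ y := by
  set R := mulShift (𝓕 χ₁) z.2 (𝓕⁻ (mulShift (𝓕⁻ χ₂) z.1 φ))
  have e : ∀ y, kernelOp χ₁ χ₂ z φ y = 𝓕 R y := fun y => rfl
  simp_rw [e]
  rw [← integral_fourier_mul_eq, convS_apply]
  have hR : ∀ ξ, 𝓕 f ξ * R ξ = ∫ x, symplecticFourierTest (tensor χ₁ χ₂) (z - (x, ξ)) *
      symbolTest f φ (x, ξ) := by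
    intro ξ
    simp only [R, mulShift_apply]
    rw [fourierInv_coe (mulShift (𝓕⁻ χ₂) z.1 φ), fourierInv_eq_ec, ← integral_const_mul,
      ← integral_const_mul]
    congr 1; ext x
    have h1 : 𝓕⁻ χ₂ (x - z.1) = 𝓕 χ₂ (z.1 - x) := by
      rw [fourierInv_apply_eq_fourier_neg, neg_sub]
    have h2 : 𝓕⁻ χ₁ (z.2 - ξ) = 𝓕 χ₁ (ξ - z.2) := by
      rw [fourierInv_apply_eq_fourier_neg, neg_sub]
    rw [symplecticFourierTest_tensor, symbolTest_eq_ec, mulShift_apply, h1, Prod.fst_sub,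
      Prod.snd_sub, h2, ← fourier_coe]
    ring
  simp_rw [hR]
  have hi : Integrable (fun p : ℝ × ℝ => symplecticFourierTest (tensor χ₁ χ₂) (z - p) *
      symbolTest f φ p) := by
    refine (((symbolTest f φ).integrable (μ := volume)).norm.const_mul
      (schNorm (0, 0) (symplecticFourierTest (tensor χ₁ χ₂)))).mono' ?_ (ae_of_all _ fun p => ?_)
    · have := (symplecticFourierTest (tensor χ₁ χ₂)).continuous
      have := (symbolTest f φ).continuous
      exact Continuous.aestronglyMeasurable (by fun_prop)
    · rw [norm_mul]
      gcongr
      exact norm_le_schNorm _ _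
  exact integral_prod_symm (μ := volume) (ν := volume) _ hi

/-- The transpose of an operator with bounded spreading support maps Schwartz functions to
Schwartz functions. -/
theorem exists_transpose {S : ℝ × ℝ → ℂ} (hS : IsPolyBounded S) (χ₁ χ₂ : 𝓢(ℝ, ℂ)) :
    ∃ T : 𝓢(ℝ, ℂ) →L[ℂ] 𝓢(ℝ, ℂ), (∀ φ y, T φ y = ∫ z, S z * kernelOp χ₁ χ₂ z φ y) ∧
      ∀ f φ : 𝓢(ℝ, ℂ), ∫ z, S z * convS (symplecticFourierTest (tensor χ₁ χ₂)) (symbolTest f φ) z =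
        ∫ y, f y * T φ y := by
  have hm : ∀ φ y, Measurable fun z => kernelOp χ₁ χ₂ z φ y := fun φ y =>
    Measurable.comp (g := fun p : (ℝ × ℝ) × ℝ => kernelOp χ₁ χ₂ p.1 φ p.2)
      (f := fun z : ℝ × ℝ => (z, y)) (measurable_kernelOp χ₁ χ₂ φ) (by fun_prop)
  have hb := exists_schNorm_kernelOp_le χ₁ χ₂
  obtain ⟨T, hT⟩ := exists_weakIntegral_clm hS (kernelOp χ₁ χ₂) hm hb
  refine ⟨T, hT, fun f φ => ?_⟩
  simp_rw [convS_symbolTest, hT, ← integral_const_mul]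
  rw [integral_integral_swap]
  · congr 1; ext y
    congr 1; ext z
    ring
  · obtain ⟨hSm, N, C, hC, hSb⟩ := hS
    obtain ⟨m', D, hD, h⟩ := exists_schNorm_kernelOp_le χ₁ χ₂ (N + 3) (0, 0)
    have hi := (integrable_inv_one_add_pow_three.const_mul (C * (D * schNorm m' φ))).mul_prod
      (f.integrable (μ := volume)).norm
    refine hi.mono' ?_ (ae_of_all _ fun p => ?_)
    · refine Measurable.aestronglyMeasurable ?_
      have hf := f.continuous.measurable
      exact (hSm.comp measurable_fst).mul ((hf.comp measurable_snd).mul (measurable_kernelOp _ _ φ))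
    · simp only [Function.uncurry_def, norm_mul]
      have h1 := integrable_mul_of_rapid_decay hSb (g := ‖kernelOp χ₁ χ₂ p.1 φ p.2‖) (A := 1)
        (D := D * schNorm m' φ) p.1 zero_le_one (norm_nonneg _) (by
          refine le_trans ?_ (h p.1 φ)
          rw [one_mul]
          gcongr
          exact norm_le_schNorm _ _)
      rw [one_mul] at h1
      calc _ = (‖S p.1‖ * ‖kernelOp χ₁ χ₂ p.1 φ p.2‖) * ‖f p.2‖ := by ring
        _ ≤ _ := by gcongr

/-! ### Mixed norm estimates -/

section Minkowski

variable {X A : Type*} [MeasurableSpace X] [MeasurableSpace A] {μ : Measure X} {ν : Measure A}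

/-- For `p = ∞`, the essential supremum exceeds `c` exactly when the section of `{G > c}` has
positive measure, and the measure of sections is measurable. -/
theorem measurable_eLpNorm_param [SFinite μ] {G : X → A → ℝ≥0∞}
    (hG : Measurable (Function.uncurry G)) (p : ℝ≥0∞) :
    Measurable fun a => eLpNorm (fun x => G x a) p μ := by
  by_cases h0 : p = 0
  · simp [h0]
  by_cases ht : p = ∞
  · subst ht
    simp only [eLpNorm_exponent_top, eLpNormEssSup, enorm_eq_self]
    refine measurable_of_Ioi fun c => ?_
    have : (fun a => essSup (fun x => G x a) μ) ⁻¹' Set.Ioi c =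
        {a | μ ((fun x => (x, a)) ⁻¹' (Function.uncurry G ⁻¹' Set.Ioi c)) ≠ 0} := by
      ext a
      simp only [Set.mem_preimage, Set.mem_Ioi, Set.mem_ofPred_eq, ← not_le, ne_eq, not_iff_not]
      constructor
      · intro h
        have := ae_le_essSup (f := fun x => G x a) (μ := μ)
        refine measure_mono_null (fun x hx => ?_) this
        intro hx'
        exact (not_lt.mpr (hx'.trans h)) hx
      · intro h
        refine essSup_le_of_ae_le c ?_
        change μ _ = 0
        refine measure_mono_null (fun x hx => ?_) h
        exact not_le.mp (show ¬ G x a ≤ c from hx)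
    rw [this]
    exact (measurable_measure_prodMk_right (hG measurableSet_Ioi)) (measurableSet_singleton 0).compl
  · simp only [eLpNorm_eq_lintegral_rpow_enorm_toReal h0 ht, enorm_eq_self]
    refine Measurable.pow_const ?_ _
    exact (hG.pow_const _).lintegral_prod_left'

/-- Monotone convergence along truncations in height and in domain. It lets the proof of Minkowski's
inequality divide by a finite quantity. -/
theorem rpow_lintegral_le_of_truncation [SigmaFinite μ] {F : X → ℝ≥0∞} (hF : Measurable F) {r : ℝ}
    (hr : 0 < r) {R : ℝ≥0∞} (h : ∀ (s : Set X) (n : ℕ), MeasurableSet s → μ s < ∞ →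
      (∫⁻ x, (s.indicator (fun x => min (F x) n) x) ^ r ∂μ) ^ (1 / r) ≤ R) :
    (∫⁻ x, F x ^ r ∂μ) ^ (1 / r) ≤ R := by
  set f : ℕ → X → ℝ≥0∞ := fun n x =>
    ((spanningSets μ n).indicator (fun x => min (F x) n) x) ^ r
  have hmono : ∀ x, Monotone fun n => f n x := by
    intro x n m hnm
    refine ENNReal.rpow_le_rpow ?_ hr.le
    refine (Set.indicator_le_indicator_of_subset (monotone_spanningSets μ hnm)
      (fun _ => zero_le) x).trans ?_
    refine Set.indicator_le_indicator ?_
    exact min_le_min_left _ (by exact_mod_cast hnm)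
  have hlim : ∀ x, Tendsto (fun n => f n x) atTop (𝓝 (F x ^ r)) := by
    intro x
    refine (ENNReal.continuous_rpow_const.tendsto _).comp ?_
    have h1 : Tendsto (fun n : ℕ => min (F x) n) atTop (𝓝 (F x)) := by
      have := (tendsto_const_nhds (x := F x)).min ENNReal.tendsto_nat_nhds_top
      simpa using this
    refine h1.congr' ?_
    filter_upwards [eventually_ge_atTop (spanningSetsIndex μ x)] with n hn
    rw [Set.indicator_of_mem]
    exact monotone_spanningSets μ hn (mem_spanningSetsIndex μ x)
  have hmeas : ∀ n, Measurable (f n) := fun n =>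
    ((hF.min measurable_const).indicator (measurableSet_spanningSets μ n)).pow_const _
  have ht := lintegral_tendsto_of_tendsto_of_monotone (fun n => (hmeas n).aemeasurable)
    (ae_of_all μ hmono) (ae_of_all μ hlim)
  refine le_of_tendsto ((ENNReal.continuous_rpow_const (y := 1 / r)).tendsto _ |>.comp ht)
    (Eventually.of_forall fun n => ?_)
  exact h _ n (measurableSet_spanningSets μ n) (measure_spanningSets_lt_top μ n)

/-- Minkowski's integral inequality. -/
theorem eLpNorm_lintegral_le [SigmaFinite μ] [SFinite ν] {G : X → A → ℝ≥0∞}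
    (hG : Measurable (Function.uncurry G)) {p : ℝ≥0∞} (hp : 1 ≤ p) :
    eLpNorm (fun x => ∫⁻ a, G x a ∂ν) p μ ≤ ∫⁻ a, eLpNorm (fun x => G x a) p μ ∂ν := by
  have h0 : p ≠ 0 := (zero_lt_one.trans_le hp).ne'
  have hFm : Measurable fun x => ∫⁻ a, G x a ∂ν := hG.lintegral_prod_right'
  have hNm := measurable_eLpNorm_param (μ := μ) hG p
  by_cases ht : p = ∞
  · subst ht
    simp only [eLpNorm_exponent_top, eLpNormEssSup, enorm_eq_self] at hNm ⊢
    have h1 : ∀ᵐ z ∂(ν.prod μ), G z.2 z.1 ≤ essSup (fun x => G x z.1) μ := by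
      have hms : MeasurableSet {z : A × X | G z.2 z.1 ≤ essSup (fun x => G x z.1) μ} :=
        measurableSet_le (hG.comp measurable_swap) (hNm.comp measurable_fst)
      rw [Measure.ae_prod_iff_ae_ae hms]
      exact ae_of_all _ fun a => ae_le_essSup
    have h2 : ∀ᵐ x ∂μ, ∀ᵐ a ∂ν, G x a ≤ essSup (fun x => G x a) μ :=
      Measure.ae_ae_of_ae_prod (Measure.measurePreserving_swap.quasiMeasurePreserving.ae h1)
    refine essSup_le_of_ae_le _ ?_
    filter_upwards [h2] with x hx
    exact lintegral_mono_ae hx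
  simp only [eLpNorm_eq_lintegral_rpow_enorm_toReal h0 ht, enorm_eq_self] at hNm ⊢
  set r := p.toReal
  have hr1 : 1 ≤ r := by
    have := ENNReal.toReal_mono ht hp
    simpa using this
  rcases hr1.eq_or_lt with hr | hr
  · rw [← hr]
    simp only [ENNReal.rpow_one, div_one]
    rw [lintegral_lintegral_swap hG.aemeasurable]
  set R := ∫⁻ a, (∫⁻ x, G x a ^ r ∂μ) ^ (1 / r) ∂ν
  have hr0 : 0 < r := zero_lt_one.trans hr
  set r' := r / (r - 1)
  have hc : r'.HolderConjugate r := by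
    refine Real.HolderConjugate.symm ?_
    exact Real.HolderConjugate.conjExponent hr
  refine rpow_lintegral_le_of_truncation hFm hr0 fun s n hs hμs => ?_
  set f := s.indicator (fun x => min (∫⁻ a, G x a ∂ν) n)
  have hfm : Measurable f := (hFm.min measurable_const).indicator hs
  have hfle : ∀ x, f x ≤ ∫⁻ a, G x a ∂ν := fun x => by
    simp only [f]
    by_cases hx : x ∈ s
    · rw [Set.indicator_of_mem hx]; exact min_le_left _ _
    · rw [Set.indicator_of_notMem hx]; exact zero_le
  have hfn : ∀ x, f x ≤ s.indicator (fun _ => (n : ℝ≥0∞)) x := fun x =>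
    Set.indicator_le_indicator (min_le_right _ _)
  set I := ∫⁻ x, f x ^ r ∂μ
  have hI : I ≠ ∞ := by
    refine ne_top_of_le_ne_top (b := (n : ℝ≥0∞) ^ r * μ s) ?_ ?_
    · exact ENNReal.mul_ne_top (ENNReal.rpow_ne_top_of_nonneg hr0.le (by simp)) hμs.ne
    · refine (lintegral_mono fun x => ENNReal.rpow_le_rpow (hfn x) hr0.le).trans ?_
      have : ∀ x, (s.indicator (fun _ => (n : ℝ≥0∞)) x) ^ r =
          s.indicator (fun _ => (n : ℝ≥0∞) ^ r) x := fun x => by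
        by_cases hx : x ∈ s <;> simp [hx, hr0]
      simp_rw [this]
      rw [lintegral_indicator_const hs]
  -- In `f ^ r` one factor is replaced by the inner integral of `G` and the others are kept; after
  -- interchanging integrals, Hölder's inequality applies for each `a`. The factor `I ^ (1 / r')` is
  -- then cancelled, as `I` is finite.
  have hkey : I ≤ I ^ (1 / r') * R := by
    have h1 : I ≤ ∫⁻ x, ∫⁻ a, f x ^ (r - 1) * G x a ∂ν ∂μ := by
      refine lintegral_mono fun x => ?_
      rw [lintegral_const_mul _ (hG.of_uncurry_left)]
      calc f x ^ r = f x ^ ((r - 1) + 1) := by ring_nf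
        _ = f x ^ (r - 1) * f x := by
            rw [ENNReal.rpow_add_of_nonneg _ _ (by linarith) zero_le_one, ENNReal.rpow_one]
        _ ≤ _ := by gcongr; exact hfle x
    have h2 : ∫⁻ x, ∫⁻ a, f x ^ (r - 1) * G x a ∂ν ∂μ = ∫⁻ a, ∫⁻ x, f x ^ (r - 1) * G x a ∂μ ∂ν := by
      rw [lintegral_lintegral_swap]
      exact (((hfm.pow_const _).comp measurable_fst).mul hG).aemeasurable
    refine h1.trans (h2.le.trans ?_)
    rw [← lintegral_const_mul _ hNm]
    refine lintegral_mono fun a => ?_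
    have h3 := ENNReal.lintegral_mul_le_Lp_mul_Lq μ hc (f := fun x => f x ^ (r - 1))
      (g := fun x => G x a) (hfm.pow_const _).aemeasurable
      (hG.comp measurable_prodMk_right).aemeasurable
    have h4 : ∀ x, (f x ^ (r - 1)) ^ r' = f x ^ r := fun x => by
      rw [← ENNReal.rpow_mul]
      congr 1
      simp only [r']
      field_simp [(sub_pos.mpr hr).ne']
    simp only [h4] at h3
    exact h3
  by_cases hI0 : I = 0
  · rw [hI0, ENNReal.zero_rpow_of_pos (by positivity)]; exact zero_le
  have hsum : 1 / r' + 1 / r = 1 := by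
    have := hc.inv_add_inv_eq_one
    simpa [one_div] using this
  have hr'0 : 0 < r' := hc.pos
  have e : I = I ^ (1 / r') * I ^ (1 / r) := by
    rw [← ENNReal.rpow_add _ _ hI0 hI, hsum, ENNReal.rpow_one]
  have hne0 : I ^ (1 / r') ≠ 0 := by
    simp only [ne_eq, ENNReal.rpow_eq_zero_iff, hI0, hI, false_and, or_self, not_false_eq_true]
  have hnet : I ^ (1 / r') ≠ ∞ := ENNReal.rpow_ne_top_of_nonneg (by positivity) hI
  exact (ENNReal.mul_le_mul_iff_right hne0 hnet).mp (e.symm.le.trans hkey)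

end Minkowski

theorem eLpNorm_coe_mul_le {X : Type*} [MeasurableSpace X] {μ : Measure X} (c : ℝ≥0) (p : ℝ≥0∞)
    {f g : X → ℝ≥0∞} (h : ∀ x, f x ≤ c * g x) : eLpNorm f p μ ≤ c * eLpNorm g p μ :=
  eLpNorm_le_nnreal_smul_eLpNorm_of_ae_le_mul' (ae_of_all _ fun x => by simpa using h x) p

/-- Young's inequality for mixed norms and product kernels. -/
theorem eLpNorm_eLpNorm_le_of_le_convolution {p q : ℝ≥0∞} (hp : 1 ≤ p) (hq : 1 ≤ q)
    {u g : ℝ × ℝ → ℝ≥0∞} (hg : Measurable g) {k₁ k₂ : ℝ → ℝ≥0} (hk₁ : Measurable k₁)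
    (hk₂ : Measurable k₂)
    (hu : ∀ z, u z ≤ ∫⁻ y, g y * ((k₁ (y.1 - z.1) * k₂ (y.2 - z.2) : ℝ≥0) : ℝ≥0∞)) :
    eLpNorm (fun ξ : ℝ => eLpNorm (fun x : ℝ => u (x, ξ)) p volume) q volume ≤
      ((∫⁻ x, k₁ x) * ∫⁻ x, k₂ x) *
        eLpNorm (fun ξ : ℝ => eLpNorm (fun x : ℝ => g (x, ξ)) p volume) q volume := by
  set N : ℝ → ℝ≥0∞ := fun ξ => eLpNorm (fun x : ℝ => g (x, ξ)) p volume
  have hN : Measurable N := measurable_eLpNorm_param (G := fun x ξ => g (x, ξ)) hg p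
  set k : ℝ × ℝ → ℝ≥0 := fun y => k₁ y.1 * k₂ y.2
  have hk : Measurable k := (hk₁.comp measurable_fst).mul (hk₂.comp measurable_snd)
  -- Translating the variable writes the convolution as a superposition of translates of `g` with
  -- weights `k`. Minkowski's inequality is applied to the inner and then to the outer norm, each
  -- being translation invariant. No measurability of `u` is needed.
  have hu' : ∀ x ξ, u (x, ξ) ≤ ∫⁻ y : ℝ × ℝ, k y * g (y.1 + x, y.2 + ξ) := by
    intro x ξ
    refine (hu (x, ξ)).trans (le_of_eq ?_)
    rw [← lintegral_add_right_eq_self _ (x, ξ)]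
    refine lintegral_congr fun y => ?_
    simp only [k, Prod.fst_add, Prod.snd_add, add_sub_cancel_right]
    rw [mul_comm]
    rfl
  have h1 : ∀ ξ, eLpNorm (fun x : ℝ => u (x, ξ)) p volume ≤
      ∫⁻ y : ℝ × ℝ, k y * N (y.2 + ξ) := by
    intro ξ
    refine (eLpNorm_mono_enorm (g := fun x => ∫⁻ y : ℝ × ℝ, k y * g (y.1 + x, y.2 + ξ))
      (fun x => by simpa using hu' x ξ)).trans ?_
    refine (eLpNorm_lintegral_le (G := fun x (y : ℝ × ℝ) => k y * g (y.1 + x, y.2 + ξ))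
      ?_ hp).trans (lintegral_mono fun y => ?_)
    · simp only [Function.uncurry_def]
      exact ((hk.comp measurable_snd).coe_nnreal_ennreal).mul (hg.comp (by fun_prop))
    · refine (eLpNorm_coe_mul_le (k y) p (g := fun x => g (y.1 + x, y.2 + ξ))
        fun x => le_rfl).trans ?_
      gcongr
      have := eLpNorm_comp_measurePreserving (p := p) (g := fun x => g (x, y.2 + ξ))
        (f := fun x => y.1 + x) (μ := volume) (ν := volume)
        (hg.comp (by fun_prop)).aestronglyMeasurable (measurePreserving_add_left volume y.1)
      exact this.le
  refine (eLpNorm_mono_enorm (g := fun ξ => ∫⁻ y : ℝ × ℝ, k y * N (y.2 + ξ))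
      (fun ξ => by simpa using h1 ξ)).trans ?_
  refine (eLpNorm_lintegral_le (G := fun ξ (y : ℝ × ℝ) => k y * N (y.2 + ξ)) ?_ hq).trans ?_
  · simp only [Function.uncurry_def]
    exact ((hk.comp measurable_snd).coe_nnreal_ennreal).mul (hN.comp (by fun_prop))
  · refine (lintegral_mono (g := fun y : ℝ × ℝ => (k₁ y.1 * k₂ y.2 : ℝ≥0∞) * eLpNorm N q volume)
      fun y => ?_).trans (le_of_eq ?_)
    · refine (eLpNorm_coe_mul_le (k y) q (g := fun ξ => N (y.2 + ξ)) fun x => le_rfl).trans ?_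
      have := eLpNorm_comp_measurePreserving (p := q) (g := N)
        (f := fun x => y.2 + x) (μ := volume) (ν := volume)
        hN.aestronglyMeasurable (measurePreserving_add_left volume y.2)
      simp only [k, ENNReal.coe_mul]
      gcongr
      exact this.le
    · rw [lintegral_mul_const _ (by fun_prop), Measure.volume_eq_prod,
        lintegral_prod_mul (f := fun x => (k₁ x : ℝ≥0∞)) (g := fun x => (k₂ x : ℝ≥0∞))
          (by fun_prop) (by fun_prop)]

/-! ### Weighted estimates -/

theorem exists_exp_mul_sexp_le {β b γ κ : ℝ} (hβ : 0 < β) (hβb : β < b) (hγ : 0 < γ)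
    (hκ : 0 < κ) : ∃ G : ℝ, 0 < G ∧ ∀ t : ℝ,
      Real.exp (γ * |t| ^ β) * sexp b κ t ≤ G * sexp b (κ / 2) t := by
  -- At `T` the growth `γ T^β` equals half of the decay, `(κ/2) T^b`. Beyond `T` the exponential is
  -- absorbed by half the rate; below it is bounded by its value at `T`.
  set T := (2 * γ / κ) ^ (1 / (b - β))
  have hT : 0 ≤ T := by positivity
  refine ⟨Real.exp (γ * T ^ β), Real.exp_pos _, fun t => ?_⟩
  simp only [sexp]
  rw [← Real.exp_add, ← Real.exp_add]
  refine Real.exp_le_exp.mpr ?_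
  have h0 := abs_nonneg t
  rcases le_total |t| T with h | h
  · have h1 : |t| ^ β ≤ T ^ β := Real.rpow_le_rpow h0 h hβ.le
    have h2 : 0 ≤ |t| ^ b := Real.rpow_nonneg h0 _
    nlinarith
  · have h1 : T ^ (b - β) ≤ |t| ^ (b - β) := Real.rpow_le_rpow hT h (by linarith)
    rw [← Real.rpow_mul (by positivity), one_div_mul_cancel (by linarith), Real.rpow_one] at h1
    have h2 : |t| ^ b = |t| ^ (b - β) * |t| ^ β := by
      rcases h0.eq_or_lt with h | h
      · rw [← h, Real.zero_rpow hβ.ne', Real.zero_rpow (by linarith), mul_zero]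
      · rw [← Real.rpow_add h]; ring_nf
    have h3 : 0 ≤ |t| ^ β := Real.rpow_nonneg h0 _
    have h4 : 0 ≤ T ^ β := Real.rpow_nonneg hT _
    rw [div_le_iff₀ hκ] at h1
    nlinarith

theorem exists_mixedNorm_le {v w : ℝ × ℝ → ℝ} (hw : IsModerate v w) {γ Cv β b κ C₀ : ℝ}
    (hγ : 0 < γ) (hCv : 0 < Cv) (hβ : 0 < β) (hv : ∀ z, v z ≤ Cv * Real.exp (γ * ‖z‖ ^ β))
    (hβb : β < b) (hκ : 0 < κ) (hC₀ : 0 < C₀) :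
    ∃ C : ℝ≥0, 0 < C ∧ ∀ p q : ℝ≥0∞, 1 ≤ p → 1 ≤ q → ∀ f h : ℝ × ℝ → ℂ, Measurable f →
      (∀ z, ‖h z‖ₑ ≤ ∫⁻ y, ‖f y‖ₑ *
        ENNReal.ofReal (C₀ * (sexp b κ (y.1 - z.1) * sexp b κ (y.2 - z.2)))) →
      mixedNorm p q w h ≤ C * mixedNorm p q w f := by
  obtain ⟨hw0, -, Cw, hCw, hmod⟩ := hw
  have hb : 0 < b := hβ.trans hβb
  set D := Cw * Cv
  have hD : 0 < D := by positivity
  have hmod' : ∀ y z, w z ≤ D * w y * Real.exp (γ * ‖z - y‖ ^ β) := by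
    intro y z
    have h1 := hmod y (z - y)
    rw [add_sub_cancel] at h1
    calc w z ≤ Cw * w y * v (z - y) := h1
      _ ≤ Cw * w y * (Cv * Real.exp (γ * ‖z - y‖ ^ β)) :=
          mul_le_mul_of_nonneg_left (hv _) (mul_nonneg hCw.le (hw0 y))
      _ = _ := by ring
  -- The weight is replaced by its values at integer points. By moderateness the two are comparable
  -- up to the factor `E`, and the step function is Borel measurable, as Young's inequality demands.
  set fl : ℝ × ℝ → ℝ × ℝ := fun z => ((⌊z.1⌋ : ℝ), (⌊z.2⌋ : ℝ))
  set W : ℝ × ℝ → ℝ := fun z => w (fl z)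
  have hWm : Measurable W := by
    have h1 : Measurable fun n : ℤ × ℤ => w ((n.1 : ℝ), (n.2 : ℝ)) := measurable_of_countable _
    have h2 : Measurable fun z : ℝ × ℝ => (⌊z.1⌋, ⌊z.2⌋) :=
      (Int.measurable_floor.comp measurable_fst).prodMk (Int.measurable_floor.comp measurable_snd)
    exact h1.comp h2
  have hW0 : ∀ z, 0 ≤ W z := fun z => hw0 _
  set E := D * Real.exp γ
  have hE : 0 < E := by positivity
  have hfl : ∀ z, ‖z - fl z‖ ≤ 1 := by
    intro z
    rw [Prod.norm_def]
    refine max_le ?_ ?_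
    · simp only [fl, Prod.fst_sub, Real.norm_eq_abs]
      rw [Int.self_sub_floor, abs_of_nonneg (Int.fract_nonneg _)]
      exact (Int.fract_lt_one _).le
    · simp only [fl, Prod.snd_sub, Real.norm_eq_abs]
      rw [Int.self_sub_floor, abs_of_nonneg (Int.fract_nonneg _)]
      exact (Int.fract_lt_one _).le
  have hexp : ∀ z, Real.exp (γ * ‖z - fl z‖ ^ β) ≤ Real.exp γ := by
    intro z
    refine Real.exp_le_exp.mpr ?_
    have := Real.rpow_le_one (norm_nonneg _) (hfl z) hβ.le
    nlinarith
  have hwW : ∀ z, w z ≤ E * W z := by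
    intro z
    refine (hmod' (fl z) z).trans ?_
    have := hW0 z
    calc _ ≤ D * w (fl z) * Real.exp γ := mul_le_mul_of_nonneg_left (hexp z) (by positivity)
      _ = _ := by simp only [E, W]; ring
  have hWw : ∀ z, W z ≤ E * w z := by
    intro z
    refine (hmod' z (fl z)).trans ?_
    rw [norm_sub_rev]
    have := hw0 z
    calc _ ≤ D * w z * Real.exp γ := mul_le_mul_of_nonneg_left (hexp z) (by positivity)
      _ = _ := by simp only [E]; ring
  obtain ⟨G, hG, hGle⟩ := exists_exp_mul_sexp_le hβ hβb hγ hκ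
  set M := E * D * E * C₀ * (G * G)
  have hM : 0 < M := by positivity
  set k₁ : ℝ → ℝ≥0 := fun t => (M * sexp b (κ / 2) t).toNNReal
  set k₂ : ℝ → ℝ≥0 := fun t => (sexp b (κ / 2) t).toNNReal
  have hsm : Measurable (sexp b (κ / 2)) := (continuous_sexp hb).measurable
  have hk₁ : Measurable k₁ := (hsm.const_mul M).real_toNNReal
  have hk₂ : Measurable k₂ := hsm.real_toNNReal
  -- Moving the weight from `z` to `y` costs `exp (γ ‖z - y‖ ^ β)`, which is bounded by a product
  -- over the coordinates; each factor is absorbed by half of the kernel's rate because `β < b`.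
  have hker : ∀ z y, W z * (C₀ * (sexp b κ (y.1 - z.1) * sexp b κ (y.2 - z.2))) ≤
      W y * ((M * sexp b (κ / 2) (y.1 - z.1)) * sexp b (κ / 2) (y.2 - z.2)) := by
    intro z y
    have h1 : W z ≤ E * (D * (E * W y) * Real.exp (γ * ‖z - y‖ ^ β)) := by
      refine (hWw z).trans ?_
      gcongr
      refine (hmod' y z).trans ?_
      gcongr
      exact hwW y
    have h2 : Real.exp (γ * ‖z - y‖ ^ β) ≤
        Real.exp (γ * |y.1 - z.1| ^ β) * Real.exp (γ * |y.2 - z.2| ^ β) := by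
      rw [← Real.exp_add]
      refine Real.exp_le_exp.mpr ?_
      rw [norm_sub_rev, Prod.norm_def]
      have a1 : 0 ≤ γ * |y.1 - z.1| ^ β := by positivity
      have a2 : 0 ≤ γ * |y.2 - z.2| ^ β := by positivity
      rcases max_choice ‖(y - z).1‖ ‖(y - z).2‖ with h | h <;> rw [h]
      · simp only [Prod.fst_sub, Real.norm_eq_abs]; linarith
      · simp only [Prod.snd_sub, Real.norm_eq_abs]; linarith
    have g1 := hGle (y.1 - z.1)
    have g2 := hGle (y.2 - z.2)
    have s1 := sexp_nonneg b κ (y.1 - z.1)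
    have s2 := sexp_nonneg b κ (y.2 - z.2)
    have s3 := sexp_nonneg b (κ / 2) (y.1 - z.1)
    have := hW0 y
    calc _ ≤ (E * (D * (E * W y) * (Real.exp (γ * |y.1 - z.1| ^ β) *
          Real.exp (γ * |y.2 - z.2| ^ β)))) *
            (C₀ * (sexp b κ (y.1 - z.1) * sexp b κ (y.2 - z.2))) := by
          gcongr
          refine h1.trans ?_
          gcongr
      _ = E * D * E * C₀ * W y * ((Real.exp (γ * |y.1 - z.1| ^ β) * sexp b κ (y.1 - z.1)) *
          (Real.exp (γ * |y.2 - z.2| ^ β) * sexp b κ (y.2 - z.2))) := by ring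
      _ ≤ E * D * E * C₀ * W y * ((G * sexp b (κ / 2) (y.1 - z.1)) *
          (G * sexp b (κ / 2) (y.2 - z.2))) := by gcongr
      _ = _ := by simp only [M]; ring
  have hi : ∀ r : ℝ, (∫⁻ t, ((r * sexp b (κ / 2) t).toNNReal : ℝ≥0∞)) ≠ ∞ := fun r =>
    (((integrable_sexp hb (half_pos hκ)).const_mul r).lintegral_lt_top).ne
  have hI : (∫⁻ t, (k₁ t : ℝ≥0∞)) * ∫⁻ t, (k₂ t : ℝ≥0∞) ≠ ∞ :=
    ENNReal.mul_ne_top (hi M) (by simpa [k₂] using hi 1)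
  obtain ⟨I, hIe⟩ := WithTop.ne_top_iff_exists.mp hI
  set E' : ℝ≥0 := E.toNNReal
  have hE' : (E' : ℝ≥0∞) = ENNReal.ofReal E := rfl
  refine ⟨E' * I * E' + 1, by positivity, fun p q hp hq f h hf hh => ?_⟩
  set g : ℝ × ℝ → ℝ≥0∞ := fun y => ENNReal.ofReal (W y) * ‖f y‖ₑ
  set u : ℝ × ℝ → ℝ≥0∞ := fun y => ENNReal.ofReal (W y) * ‖h y‖ₑ
  have hgm : Measurable g := hWm.ennreal_ofReal.mul hf.enorm
  have hu : ∀ z, u z ≤ ∫⁻ y, g y * ((k₁ (y.1 - z.1) * k₂ (y.2 - z.2) : ℝ≥0) : ℝ≥0∞) := by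
    intro z
    refine (mul_le_mul_right (hh z) _).trans ?_
    rw [← lintegral_const_mul' _ _ ENNReal.ofReal_ne_top]
    refine lintegral_mono fun y => ?_
    have e1 : ((k₁ (y.1 - z.1) * k₂ (y.2 - z.2) : ℝ≥0) : ℝ≥0∞) = ENNReal.ofReal
        ((M * sexp b (κ / 2) (y.1 - z.1)) * sexp b (κ / 2) (y.2 - z.2)) := by
      rw [ENNReal.ofReal_mul (mul_nonneg hM.le (sexp_nonneg _ _ _)), ENNReal.coe_mul]
      rfl
    have e2 := ENNReal.ofReal_le_ofReal (hker z y)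
    rw [ENNReal.ofReal_mul (hW0 z), ENNReal.ofReal_mul (hW0 y)] at e2
    rw [e1]
    simp only [g]
    calc _ = ‖f y‖ₑ * (ENNReal.ofReal (W z) * ENNReal.ofReal
          (C₀ * (sexp b κ (y.1 - z.1) * sexp b κ (y.2 - z.2)))) := by ring
      _ ≤ ‖f y‖ₑ * (ENNReal.ofReal (W y) * ENNReal.ofReal
          ((M * sexp b (κ / 2) (y.1 - z.1)) * sexp b (κ / 2) (y.2 - z.2))) := by gcongr
      _ = _ := by ring
  have hY := eLpNorm_eLpNorm_le_of_le_convolution hp hq hgm hk₁ hk₂ hu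
  rw [← hIe] at hY
  change _ ≤ (I : ℝ≥0∞) * _ at hY
  have hwn : ∀ (F : ℝ × ℝ → ℂ) z, ‖(w z : ℂ) * F z‖ₑ = ENNReal.ofReal (w z) * ‖F z‖ₑ := by
    intro F z
    rw [enorm_mul, ← ofReal_norm, Complex.norm_real, Real.norm_of_nonneg (hw0 z)]
  have hle1 : mixedNorm p q w h ≤
      E' * eLpNorm (fun ξ : ℝ => eLpNorm (fun x : ℝ => u (x, ξ)) p volume) q volume := by
    refine eLpNorm_coe_mul_le E' q fun ξ => ?_
    rw [← eLpNorm_enorm]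
    refine eLpNorm_coe_mul_le E' p fun x => ?_
    rw [hwn, hE', ← mul_assoc, ← ENNReal.ofReal_mul hE.le]
    gcongr
    exact hwW _
  have hle2 : eLpNorm (fun ξ : ℝ => eLpNorm (fun x : ℝ => g (x, ξ)) p volume) q volume ≤
      E' * mixedNorm p q w f := by
    refine eLpNorm_coe_mul_le E' q fun ξ => ?_
    rw [← eLpNorm_enorm (fun x : ℝ => (w (x, ξ) : ℂ) * f (x, ξ))]
    refine eLpNorm_coe_mul_le E' p fun x => ?_
    rw [hwn f, hE', ← mul_assoc, ← ENNReal.ofReal_mul hE.le]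
    change ENNReal.ofReal (W (x, ξ)) * ‖f (x, ξ)‖ₑ ≤ _
    gcongr
    exact hWw _
  calc _ ≤ _ := hle1
    _ ≤ E' * (I * (E' * mixedNorm p q w f)) := by gcongr; exact hY.trans (by gcongr)
    _ = ((E' * I * E' : ℝ≥0) : ℝ≥0∞) * mixedNorm p q w f := by push_cast; ring
    _ ≤ _ := by gcongr; simp

theorem mixedNorm_congr_ae {p q : ℝ≥0∞} {w : ℝ × ℝ → ℝ} {f g : ℝ × ℝ → ℂ} (h : f =ᵐ[volume] g) :
    mixedNorm p q w f = mixedNorm p q w g := by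
  have h1 : ∀ᵐ ξ : ℝ, ∀ᵐ x : ℝ, f (x, ξ) = g (x, ξ) := by
    have h2 : ∀ᵐ z : ℝ × ℝ, f z.swap = g z.swap :=
      Measure.measurePreserving_swap.quasiMeasurePreserving.ae h
    exact Measure.ae_ae_of_ae_prod h2
  refine eLpNorm_congr_ae ?_
  filter_upwards [h1] with ξ hξ
  refine eLpNorm_congr_ae ?_
  filter_upwards [hξ] with x hx
  rw [hx]

/-! ### Grids and coefficient sequences -/

theorem mem_cell_iff {K L : ℕ} (hK : 0 < K) (hL : 0 < L) (j : ℤ × ℤ) (z : ℝ × ℝ) :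
    z ∈ cell K L j ↔ (j.1 ≤ z.1 * K ∧ z.1 * K < j.1 + 1) ∧
      (j.2 ≤ z.2 * (L / K) ∧ z.2 * (L / K) < j.2 + 1) := by
  have hK' : (0 : ℝ) < K := by exact_mod_cast hK
  have hL' : (0 : ℝ) < L := by exact_mod_cast hL
  simp only [cell, Set.mem_prod, Set.mem_Ico]
  rw [← add_div, div_le_iff₀ hK', lt_div_iff₀ hK', ← add_div, div_le_iff₀ hL', lt_div_iff₀ hL',
    ← mul_div_assoc, le_div_iff₀ hK', div_lt_iff₀ hK', add_mul, one_mul]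

theorem volume_biUnion_cell {K L : ℕ} (hK : 0 < K) (hL : 0 < L) (J : Finset (ℤ × ℤ)) :
    volume (⋃ j ∈ J, cell K L j) = J.card * ENNReal.ofReal (1 / L) := by
  have hK' : (0 : ℝ) < K := by exact_mod_cast hK
  have hL' : (0 : ℝ) < L := by exact_mod_cast hL
  rw [measure_biUnion_finset]
  · have : ∀ j, volume (cell K L j) = ENNReal.ofReal (1 / L) := by
      intro j
      rw [cell, Measure.volume_eq_prod, Measure.prod_prod, Real.volume_Ico, Real.volume_Ico,
        add_sub_cancel_left, add_sub_cancel_left, ← ENNReal.ofReal_mul (by positivity)]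
      congr 1
      field_simp
    simp [this]
  · intro i _ j _ hij
    refine Set.disjoint_left.mpr fun z hi hj => hij ?_
    rw [mem_cell_iff hK hL] at hi hj
    obtain ⟨⟨a1, a2⟩, a3, a4⟩ := hi
    obtain ⟨⟨b1, b2⟩, b3, b4⟩ := hj
    ext
    · have h1 : (i.1 : ℝ) < j.1 + 1 := by linarith
      have h2 : (j.1 : ℝ) < i.1 + 1 := by linarith
      have h1' : i.1 < j.1 + 1 := by exact_mod_cast h1
      have h2' : j.1 < i.1 + 1 := by exact_mod_cast h2
      omega
    · have h1 : (i.2 : ℝ) < j.2 + 1 := by linarith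
      have h2 : (j.2 : ℝ) < i.2 + 1 := by linarith
      have h1' : i.2 < j.2 + 1 := by exact_mod_cast h1
      have h2' : j.2 < i.2 + 1 := by exact_mod_cast h2
      omega
  · intro j _
    exact measurableSet_Ico.prod measurableSet_Ico

/-- A set of outer Jordan content less than `1` meets few cells of a sufficiently fine grid. -/
theorem exists_grid {M : Set (ℝ × ℝ)} (hM : outerContent M < 1) :
    ∃ (K L : ℕ) (Λ : Finset (ℤ × ℤ)) (k₀ : ℤ) (R : ℕ), 0 < K ∧ 0 < L ∧
      (∀ l ∈ Λ, k₀ ≤ l.1 ∧ l.1 < k₀ + R) ∧ Λ.card + R ≤ L ∧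
      (∀ l ∈ Λ, ∀ l' ∈ Λ, l.1 = l'.1 → (L : ℤ) ∣ l.2 - l'.2 → l = l') ∧
      ∀ l, l ∉ Λ → ∀ z ∈ M, 1 < |z.1 * K - l.1| ∨ 1 < |z.2 * (L / K) - l.2| := by
  simp only [outerContent, iInf_lt_iff] at hM
  obtain ⟨K, L, hK, hL, J, hMJ, hvol⟩ := hM
  have hK' : (0 : ℝ) < K := by exact_mod_cast hK
  have hL' : (0 : ℝ) < L := by exact_mod_cast hL
  rw [volume_biUnion_cell hK hL, ← ENNReal.ofReal_natCast, ← ENNReal.ofReal_mul (by positivity),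
    ENNReal.ofReal_lt_one, mul_one_div, div_lt_one hL'] at hvol
  have hJ : J.card < L := by exact_mod_cast hvol
  obtain ⟨B, hB⟩ : ∃ B : ℕ, ∀ j ∈ J, |j.1| ≤ B ∧ |j.2| ≤ B := by
    refine ⟨J.sup fun j => max j.1.natAbs j.2.natAbs, fun j hj => ?_⟩
    have h := Finset.le_sup (f := fun j : ℤ × ℤ => max j.1.natAbs j.2.natAbs) hj
    have h1 := (le_max_left _ _).trans h
    have h2 := (le_max_right _ _).trans h
    rw [Int.abs_eq_natAbs, Int.abs_eq_natAbs]
    exact ⟨by exact_mod_cast h1, by exact_mod_cast h2⟩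
  -- Refinement factor per direction. The margin `L N² - (L - 1)(N + 2)²` grows like `N²`, while the
  -- loss from the enlarged cells and the range of the first index is linear in `N`; this size is
  -- sufficient.
  set N : ℕ := 4 * L + 2 * B + 11
  have hN : 0 < N := by omega
  have hN' : (0 : ℝ) < N := by exact_mod_cast hN
  -- An old cell contains `N × N` new ones. A bump reaches one step to either side of its centre, so
  -- `N + 2` centres per direction can meet an old cell.
  set Λ : Finset (ℤ × ℤ) := J.biUnion fun j =>
    Finset.Icc (j.1 * N - 1) (j.1 * N + N) ×ˢ Finset.Icc (j.2 * N - 1) (j.2 * N + N)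
  have hmem : ∀ l ∈ Λ, ∃ j ∈ J, (j.1 * N - 1 ≤ l.1 ∧ l.1 ≤ j.1 * N + N) ∧
      (j.2 * N - 1 ≤ l.2 ∧ l.2 ≤ j.2 * N + N) := by
    intro l hl
    simpa [Λ] using hl
  have hrange : ∀ l ∈ Λ, (-(B * N : ℤ) - 1 ≤ l.1 ∧ l.1 ≤ B * N + N) ∧
      (-(B * N : ℤ) - 1 ≤ l.2 ∧ l.2 ≤ B * N + N) := by
    intro l hl
    obtain ⟨j, hj, h⟩ := hmem l hl
    obtain ⟨h1, h2⟩ := hB j hj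
    rw [abs_le] at h1 h2
    have hNz : (0 : ℤ) < N := by exact_mod_cast hN
    refine ⟨⟨?_, ?_⟩, ?_, ?_⟩ <;> nlinarith
  have hcard : Λ.card ≤ J.card * ((N + 2) * (N + 2)) := by
    refine Finset.card_biUnion_le_card_mul _ _ _ fun j _ => ?_
    rw [Finset.card_product, Int.card_Icc, Int.card_Icc]
    apply le_of_eq
    congr 1 <;> omega
  -- With `K N` and `L N²` both sides of the cells shrink by `N`. The period `L N²` exceeds the
  -- spread of the second indices in `Λ`, so congruent indices coincide.
  refine ⟨K * N, L * (N * N), Λ, -(B * N : ℤ) - 1, 2 * (B * N) + N + 2, by positivity,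
    by positivity, fun l hl => ?_, ?_, fun l hl l' hl' he hd => ?_, fun l hl z hz => ?_⟩
  · obtain ⟨⟨h1, h2⟩, -⟩ := hrange l hl
    refine ⟨h1, ?_⟩
    push_cast
    linarith
  · have h1 : J.card * ((N + 2) * (N + 2)) ≤ (L - 1) * ((N + 2) * (N + 2)) := by
      gcongr; omega
    obtain ⟨L', rfl⟩ : ∃ L', L = L' + 1 := ⟨L - 1, by omega⟩
    rw [Nat.add_sub_cancel] at h1
    have h2 : N * N = N * (4 * (L' + 1) + 2 * B + 11) := rfl
    have h3 : L' + 1 ≤ N := by omega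
    nlinarith
  · obtain ⟨-, h1, h2⟩ := hrange l hl
    obtain ⟨-, h3, h4⟩ := hrange l' hl'
    refine Prod.ext he ?_
    have hlt : |l.2 - l'.2| < ((L * (N * N) : ℕ) : ℤ) := by
      have h5 : (2 * B + 2 : ℤ) ≤ N := by simp only [N]; push_cast; linarith
      have h6 : (1 : ℤ) ≤ L := by exact_mod_cast hL
      have h7 : (11 : ℤ) ≤ N := by simp only [N]; push_cast; linarith
      have h8 : |l.2 - l'.2| ≤ 2 * (B * N) + N + 1 := by
        rw [abs_le]; constructor <;> linarith
      push_cast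
      nlinarith
    have := Int.eq_zero_of_abs_lt_dvd hd hlt
    linarith
  · by_contra hcon
    push Not at hcon
    obtain ⟨h1, h2⟩ := hcon
    obtain ⟨j, hj, hzj⟩ := Set.mem_iUnion₂.mp (hMJ hz)
    rw [mem_cell_iff hK hL] at hzj
    obtain ⟨⟨a1, a2⟩, a3, a4⟩ := hzj
    have e1 : z.1 * ((K * N : ℕ) : ℝ) = z.1 * K * N := by push_cast; ring
    have e2 : z.2 * (((L * (N * N) : ℕ) : ℝ) / ((K * N : ℕ) : ℝ)) = z.2 * (L / K) * N := by
      push_cast; field_simp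
    rw [e1, abs_le] at h1
    rw [e2, abs_le] at h2
    have key : ∀ (x : ℝ) (i k : ℤ), (i : ℝ) ≤ x → x < i + 1 → -1 ≤ x * N - k → x * N - k ≤ 1 →
        i * N - 1 ≤ k ∧ k ≤ i * N + N := by
      intro x i k h1 h2 h3 h4
      have f1 : (i : ℝ) * N ≤ x * N := by gcongr
      have f2 : x * N < (i + 1) * N := by gcongr
      have g1 : ((i * N - 1 : ℤ) : ℝ) ≤ k := by push_cast; linarith
      have g2 : ((k : ℤ) : ℝ) < ((i * N + N + 1 : ℤ) : ℝ) := by push_cast; linarith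
      exact ⟨by exact_mod_cast g1, Int.lt_add_one_iff.mp (by exact_mod_cast g2)⟩
    apply hl
    simp only [Λ, Finset.mem_biUnion, Finset.mem_product, Finset.mem_Icc]
    exact ⟨j, hj, key _ _ _ a1 a2 h1.1 h1.2, key _ _ _ a3 a4 h2.1 h2.2⟩

theorem sum_range_add_of_periodic {L : ℕ} {h : ℤ → ℂ} (hp : Function.Periodic h L) (t : ℤ) :
    ∑ r ∈ Finset.range L, h (t + r) = ∑ r ∈ Finset.range L, h r := by
  have hstep : ∀ t : ℤ, ∑ r ∈ Finset.range L, h (t + 1 + r) = ∑ r ∈ Finset.range L, h (t + r) := by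
    intro t
    have h1 := Finset.sum_range_succ (fun r : ℕ => h (t + r)) L
    rw [Finset.sum_range_succ'] at h1
    have h2 : h (t + L) = h t := hp t
    simp only [h2, Nat.cast_zero, add_zero] at h1
    rw [← add_right_cancel h1]
    refine Finset.sum_congr rfl fun r _ => ?_
    push_cast
    ring_nf
  induction t using Int.induction_on with
  | zero => simp
  | succ i ih => rw [hstep, ih]
  | pred i ih =>
    rw [← hstep, sub_add_cancel, ih]

theorem exists_norm_le_of_periodic {L : ℕ} (hL : 0 < L) {h : ℤ → ℂ}
    (hp : Function.Periodic h L) : ∃ Γ : ℝ, ∀ n, ‖h n‖ ≤ Γ := by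
  refine ⟨∑ r ∈ Finset.range L, ‖h r‖, fun n => ?_⟩
  have hL' : (0 : ℤ) < L := by exact_mod_cast hL
  have h1 : h n = h (n % L) := by
    have := hp.int_mul (n / L) (n % L)
    rw [Int.cast_id, mul_comm, Int.emod_add_mul_ediv] at this
    exact this
  obtain ⟨r, hr⟩ := Int.eq_ofNat_of_zero_le (Int.emod_nonneg n hL'.ne')
  have hlt := Int.emod_lt_of_pos n hL'
  rw [h1, hr]
  refine Finset.single_le_sum (f := fun r : ℕ => ‖h r‖) (fun _ _ => norm_nonneg _) ?_
  rw [Finset.mem_range]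
  omega

/-- Periodic coefficients together with dual sequences for a set of lattice points. -/
theorem exists_dual_sequences {L : ℕ} (hL : 0 < L) (Λ : Finset (ℤ × ℤ)) (k₀ : ℤ) (R : ℕ)
    (hΛ : ∀ l ∈ Λ, k₀ ≤ l.1 ∧ l.1 < k₀ + R) (hcard : Λ.card + R ≤ L)
    (hinj : ∀ l ∈ Λ, ∀ l' ∈ Λ, l.1 = l'.1 → (L : ℤ) ∣ l.2 - l'.2 → l = l') :
    ∃ (c : ℤ → ℂ) (d : ℤ × ℤ → ℤ → ℂ), Function.Periodic c L ∧ (∀ l, Function.Periodic (d l) L) ∧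
      ∀ l₀ ∈ Λ, ∀ l ∈ Λ, ∑ r ∈ Finset.range L, c r * d l₀ (r + l.1) * ec (l.2 * r / L) =
        if l = l₀ then 1 else 0 := by
  have hL' : (0 : ℤ) < L := by exact_mod_cast hL
  have hLr : (L : ℝ) ≠ 0 := by exact_mod_cast hL.ne'
  have two : (2 : ℂ) ≠ 0 := two_ne_zero
  set N₀ : ℤ := k₀ + R
  -- Vandermonde nodes: the modulus encodes the first index and the phase the second index modulo
  -- `L`, so distinct elements of `Λ` have distinct nodes.
  set x : ℤ × ℤ → ℂ := fun l => (2 : ℂ) ^ (-2 * l.1) * ec (l.2 / L)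
  have hx0 : ∀ l, x l ≠ 0 := fun l => mul_ne_zero (zpow_ne_zero _ two) (ec_ne_zero _)
  have hxinj : Set.InjOn x Λ := by
    intro l hl l' hl' h
    have h1 : ‖x l‖ = ‖x l'‖ := by rw [h]
    simp only [x, norm_mul, norm_ec, mul_one, norm_zpow, Complex.norm_two] at h1
    have h2 : l.1 = l'.1 := by
      have := zpow_right_injective₀ (a := (2 : ℝ)) (by norm_num) (by norm_num) h1
      omega
    simp only [x, h2] at h
    have h3 := mul_left_cancel₀ (zpow_ne_zero _ two) h
    have h4 : ec ((l.2 : ℝ) / L - l'.2 / L) = 1 := by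
      rw [ec_sub, h3, mul_comm, ec_neg_mul_self]
    obtain ⟨n, hn⟩ := (ec_eq_one_iff _).mp h4
    refine hinj l hl l' hl' h2 ⟨n, ?_⟩
    rw [← sub_div, div_eq_iff hLr] at hn
    have : ((l.2 - l'.2 : ℤ) : ℝ) = ((L * n : ℤ) : ℝ) := by push_cast; linarith
    exact_mod_cast this
  set D : ℤ × ℤ → ℂ := fun l => (2 : ℂ) ^ (l.1 ^ 2) * ec (-(l.2 * l.1 / L)) * x l ^ N₀
  have hD0 : ∀ l, D l ≠ 0 := fun l =>
    mul_ne_zero (mul_ne_zero (zpow_ne_zero _ two) (ec_ne_zero _)) (zpow_ne_zero _ (hx0 l))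
  set P : ℤ × ℤ → Polynomial ℂ := fun l₀ =>
    Lagrange.interpolate Λ x fun l => if l = l₀ then (D l)⁻¹ else 0
  have hPdeg : ∀ l₀ i, Λ.card ≤ i → (P l₀).coeff i = 0 := fun l₀ i hi =>
    Polynomial.coeff_eq_zero_of_degree_lt
      ((Lagrange.degree_interpolate_lt _ hxinj).trans_le (by exact_mod_cast hi))
  have hPeval : ∀ l₀, ∀ l ∈ Λ, (P l₀).eval (x l) = if l = l₀ then (D l)⁻¹ else 0 := fun l₀ l hl =>
    Lagrange.eval_interpolate_at_node _ hxinj hl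
  -- Expanding `(N₀ - k + i)²` separates a factor in `k`, a factor in `i`, and the cross term
  -- `(2^{-2k})^i`. `D l` collects the factors depending on `l`, and the prefactor of `d` cancels
  -- the one depending on `i`; what remains is the value at `x l` of the polynomial with
  -- coefficients taken from `d`.
  set c : ℤ → ℂ := fun n => (2 : ℂ) ^ ((n % L) ^ 2)
  set d : ℤ × ℤ → ℤ → ℂ := fun l₀ n => (2 : ℂ) ^ (-(N₀ + (n - N₀) % L) ^ 2) *
    (P l₀).coeff ((n - N₀) % L).toNat
  have hc : Function.Periodic c L := fun n => by simp [c]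
  have hd : ∀ l, Function.Periodic (d l) L := fun l n => by
    simp only [d]
    rw [show n + (L : ℤ) - N₀ = n - N₀ + L by ring, Int.add_emod_right]
  refine ⟨c, d, hc, hd, fun l₀ _ l hl => ?_⟩
  set h : ℤ → ℂ := fun r => c r * d l₀ (r + l.1) * ec (l.2 * r / L)
  have hh : Function.Periodic h L := by
    intro r
    have e : ec (l.2 * ((r + L : ℤ) : ℝ) / L) = ec (l.2 * r / L) := by
      have : (l.2 * ((r + L : ℤ) : ℝ) / L) = l.2 * r / L + l.2 := by
        push_cast; field_simp
      rw [this, ec_add, ec_intCast, mul_one]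
    simp only [h]
    rw [hc r, e, show r + (L : ℤ) + l.1 = r + l.1 + L by ring, hd l₀]
  -- The window of summation is moved so that the argument of `d` starts at `N₀` for every `l`.
  have hsum := sum_range_add_of_periodic hh (N₀ - l.1)
  have e0 : ∑ r ∈ Finset.range L, c r * d l₀ (r + l.1) * ec (l.2 * r / L) =
      ∑ r ∈ Finset.range L, h r := by
    refine Finset.sum_congr rfl fun r _ => ?_
    simp [h]
  rw [e0, ← hsum]
  have hterm : ∀ i ∈ Finset.range L, h (N₀ - l.1 + i) = D l * ((P l₀).coeff i * x l ^ i) := by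
    intro i hi
    rw [Finset.mem_range] at hi
    have hmod : ((N₀ - l.1 + i + l.1 - N₀) % L : ℤ) = i := by
      rw [show N₀ - l.1 + i + l.1 - N₀ = (i : ℤ) by ring]
      exact Int.emod_eq_of_lt (by positivity) (by exact_mod_cast hi)
    have hd' : d l₀ (N₀ - l.1 + i + l.1) = (2 : ℂ) ^ (-(N₀ + i) ^ 2) * (P l₀).coeff i := by
      simp only [d, hmod, Int.toNat_natCast]
    simp only [h, hd']
    -- Here `1 ≤ N₀ - l.1 ≤ R` and `i < Λ.card`, so `Λ.card + R ≤ L` prevents wrap-around in `c`.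
    -- For larger `i` the coefficient vanishes because the interpolation polynomial has degree below
    -- `Λ.card`.
    by_cases hiΛ : i < Λ.card
    · obtain ⟨g1, g2⟩ := hΛ l hl
      have hmod2 : ((N₀ - l.1 + i) % L : ℤ) = N₀ - l.1 + i :=
        Int.emod_eq_of_lt (by omega) (by omega)
      simp only [c, hmod2, D, x]
      have e1 : (2 : ℂ) ^ ((N₀ - l.1 + i) ^ 2) * (2 : ℂ) ^ (-(N₀ + (i : ℤ)) ^ 2) =
          (2 : ℂ) ^ (l.1 ^ 2) * ((2 : ℂ) ^ (-2 * l.1)) ^ N₀ * ((2 : ℂ) ^ (-2 * l.1)) ^ i := by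
        rw [← zpow_natCast ((2 : ℂ) ^ (-2 * l.1)) i, ← zpow_mul, ← zpow_mul, ← zpow_add₀ two,
          ← zpow_add₀ two, ← zpow_add₀ two]
        congr 1
        ring
      have ecz : ∀ (t : ℝ) (n : ℤ), ec (n * t) = ec t ^ n := fun t n => by
        simp only [ec]
        rw [← Complex.exp_int_mul]
        congr 1
        push_cast; ring
      have e2 : ec (l.2 * ((N₀ - l.1 + i : ℤ) : ℝ) / L) =
          ec (-(l.2 * l.1 / L)) * ec (l.2 / L) ^ N₀ * ec (l.2 / L) ^ i := by
        rw [← zpow_natCast (ec (l.2 / L)) i, ← ecz, ← ecz, ← ec_add, ← ec_add]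
        congr 1
        push_cast; field_simp; ring
      rw [e2, mul_zpow, mul_pow]
      linear_combination ((P l₀).coeff i * ec (-(l.2 * l.1 / L)) * ec (l.2 / L) ^ N₀ *
        ec (l.2 / L) ^ i) * e1
    · rw [hPdeg l₀ i (not_lt.mp hiΛ)]
      ring
  rw [Finset.sum_congr rfl hterm, ← Finset.mul_sum]
  have hev : (P l₀).eval (x l) = ∑ i ∈ Finset.range L, (P l₀).coeff i * x l ^ i := by
    refine Polynomial.eval_eq_sum_range' ?_ _
    by_contra hcon
    push Not at hcon
    have := hPdeg l₀ (P l₀).natDegree (by omega)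
    rw [Polynomial.coeff_natDegree, Polynomial.leadingCoeff_eq_zero] at this
    rw [this, Polynomial.natDegree_zero] at hcon
    omega
  rw [← hev, hPeval l₀ l hl]
  split_ifs with hll
  · exact mul_inv_cancel₀ (hD0 l)
  · rw [mul_zero]

/-! ### Weighted delta trains -/

theorem norm_le_schNorm_mul_inv (φ : 𝓢(ℝ, ℂ)) (x : ℝ) :
    ‖φ x‖ ≤ 4 * schNorm (2, 0) φ * (1 + x ^ 2)⁻¹ := by
  rw [← div_eq_mul_inv, le_div_iff₀' (by positivity)]
  have h := one_add_pow_mul_norm_le_schNorm 2 φ x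
  have h1 : 1 + x ^ 2 ≤ (1 + ‖x‖) ^ 2 := by
    rw [Real.norm_eq_abs, ← sq_abs x]; nlinarith [abs_nonneg x]
  calc _ ≤ (1 + ‖x‖) ^ 2 * ‖φ x‖ := by gcongr
    _ ≤ _ := h.trans (by norm_num)

section DeltaTrain

variable {a Γ : ℝ} {c : ℤ → ℂ}

theorem norm_deltaTrain_term_le (hc : ∀ n, ‖c n‖ ≤ Γ) (φ : 𝓢(ℝ, ℂ)) (n : ℤ) :
    ‖c n * φ (n * a)‖ ≤ Γ * (4 * schNorm (2, 0) φ) * (1 + (n * a) ^ 2)⁻¹ := by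
  have hΓ : 0 ≤ Γ := (norm_nonneg _).trans (hc 0)
  rw [norm_mul, mul_assoc]
  exact mul_le_mul (hc n) (norm_le_schNorm_mul_inv φ _) (norm_nonneg _) hΓ

theorem summable_deltaTrain (ha : 0 < a) (hc : ∀ n, ‖c n‖ ≤ Γ) (φ : 𝓢(ℝ, ℂ)) :
    Summable fun n : ℤ => c n * φ (n * a) :=
  Summable.of_norm_bounded ((summable_inv_one_add_sq ha).mul_left _)
    (norm_deltaTrain_term_le hc φ)

/-- The weighted delta train `∑ₙ cₙ δ_{na}` exists as a tempered distribution. -/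
theorem exists_deltaTrain (ha : 0 < a) (hc : ∀ n, ‖c n‖ ≤ Γ) :
    ∃ g : 𝓢'(ℝ, ℂ), (∀ φ, g φ = ∑' n : ℤ, c n * φ (n * a)) ∧
      IsDeltaSeries c (fun n => n * a) g := by
  have hs := summable_deltaTrain ha hc
  have hΓ : 0 ≤ Γ := (norm_nonneg _).trans (hc 0)
  let G : 𝓢(ℝ, ℂ) →L[ℂ] ℂ := SchwartzMap.mkCLMtoNormedSpace (𝕜 := ℂ) (σ := RingHom.id ℂ)
    (fun φ => ∑' n : ℤ, c n * φ (n * a))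
    (fun φ ψ => by
      simp only [add_apply, mul_add]
      exact (hs φ).tsum_add (hs ψ))
    (fun r φ => by
      simp only [smul_apply, smul_eq_mul, RingHom.id_apply]
      rw [← tsum_mul_left]
      refine tsum_congr fun n => ?_
      ring)
    (by
      refine ⟨Finset.Iic (2, 0), Γ * 4 * ∑' n : ℤ, (1 + (n * a) ^ 2)⁻¹, ?_, fun φ => ?_⟩
      · have : 0 ≤ ∑' n : ℤ, (1 + (n * a) ^ 2)⁻¹ := tsum_nonneg fun n => by positivity
        positivity
      · have h := tsum_of_norm_bounded ((summable_inv_one_add_sq ha).mul_left _).hasSum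
          (norm_deltaTrain_term_le (a := a) hc φ)
        refine h.trans (le_of_eq ?_)
        rw [tsum_mul_left]
        change _ = Γ * 4 * _ * schNorm (2, 0) φ
        ring)
  refine ⟨ContinuousLinearMap.toPointwiseConvergenceCLM ℂ (RingHom.id ℂ) _ _ G, fun φ => rfl, ?_⟩
  rw [IsDeltaSeries, HasSum, PointwiseConvergenceCLM.tendsto_iff_forall_tendsto]
  intro φ
  have h := (hs φ).hasSum
  rw [HasSum] at h
  refine h.congr fun s => ?_
  simp

theorem modulationNorm_top_le {F : 𝓢'(ℝ, ℂ)} {C : ℝ} (h : ∀ z, ‖stft F z‖ ≤ C) :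
    modulationNorm ∞ ∞ (fun _ => 1) F ≤ ENNReal.ofReal C := by
  rw [modulationNorm, mixedNorm, eLpNorm_exponent_top]
  refine eLpNormEssSup_le_of_ae_enorm_bound (ae_of_all _ fun ξ => ?_)
  rw [enorm_eq_self, eLpNorm_exponent_top]
  refine eLpNormEssSup_le_of_ae_bound (ae_of_all _ fun x => ?_)
  simpa using h (x, ξ)

theorem exists_sum_norm_gaussianWindow_le (ha : 0 < a) :
    ∃ C : ℝ, 0 < C ∧ ∀ x : ℝ, Summable (fun n : ℤ => ‖gaussianWindow (n * a - x)‖) ∧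
      ∑' n : ℤ, ‖gaussianWindow (n * a - x)‖ ≤ C := by
  obtain ⟨C, hC, h⟩ := exists_tsum_norm_translates_le ha one_pos le_rfl
    (isSubexp_gaussianWindow one_pos le_rfl)
  refine ⟨C, hC, fun x => ?_⟩
  have e : ∀ n : ℤ, gaussianWindow (n * a - x) = gaussianWindow (x - n * a) := fun n => by
    rw [gaussianWindow_apply, gaussianWindow_apply, sub_sq_comm]
  simp_rw [e]
  exact h x

theorem modulationNorm_deltaTrain_lt_top (ha : 0 < a) (hc : ∀ n, ‖c n‖ ≤ Γ) {g : 𝓢'(ℝ, ℂ)}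
    (hg : ∀ φ, g φ = ∑' n : ℤ, c n * φ (n * a)) :
    modulationNorm ∞ ∞ (fun _ => 1) g < ∞ := by
  obtain ⟨C, hC, h⟩ := exists_sum_norm_gaussianWindow_le ha
  have hΓ : 0 ≤ Γ := (norm_nonneg _).trans (hc 0)
  refine (modulationNorm_top_le (C := Γ * C) fun z => ?_).trans_lt ENNReal.ofReal_lt_top
  rw [stft, hg]
  have h1 := tsum_of_norm_bounded ((h z.1).1.mul_left Γ).hasSum
    (f := fun n : ℤ => c n * tfShift z.1 (-z.2) gaussianWindow (n * a)) (fun n => by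
      rw [norm_mul, tfShift_eq_ec, norm_mul, norm_ec, one_mul]
      gcongr
      exact hc n)
  refine h1.trans ?_
  rw [tsum_mul_left]
  exact mul_le_mul_of_nonneg_left (h z.1).2 hΓ

theorem integral_rescaled_mul (ρ : ℝ → ℂ) (F : ℝ → ℂ) {r : ℝ} (hr : 0 < r) (s : ℝ) :
    ∫ x, r * ρ ((x - s) * r) * F x = ∫ u, ρ u * F (s + u / r) := by
  have h1 := integral_sub_right_eq_self (μ := volume)
    (fun x => r * ρ (x * r) * F (s + x)) s
  have h2 := Measure.integral_comp_mul_right (fun u => (r : ℂ) * (ρ u * F (s + u / r))) r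
  have h3 : (|r⁻¹| • ∫ u, (r : ℂ) * (ρ u * F (s + u / r))) = ∫ u, ρ u * F (s + u / r) := by
    rw [abs_of_pos (inv_pos.mpr hr), integral_const_mul, Complex.real_smul, ← mul_assoc,
      ← Complex.ofReal_mul, inv_mul_cancel₀ hr.ne', Complex.ofReal_one, one_mul]
  rw [← h3, ← h2]
  calc _ = ∫ x, r * ρ ((x - s) * r) * F (s + (x - s)) := by simp
    _ = _ := h1
    _ = _ := by
      refine integral_congr_ae (ae_of_all _ fun x => ?_)
      simp only
      rw [mul_div_cancel_right₀ _ hr.ne']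
      ring

theorem integral_gaussianWindow_ne_zero : ∫ x, gaussianWindow x ≠ 0 := by
  have h := fourier_gaussianWindow_apply 0
  rw [fourier_coe, fourier_eq_ec, gaussianWindow_apply] at h
  simp only [mul_zero, neg_zero, ec_zero, one_mul] at h
  rw [h, Complex.ofReal_ne_zero]
  positivity

/-- Weighted delta trains are limits of bounded sequences of Schwartz functions. -/
theorem exists_boundedWeakStarTendsto (ha : 0 < a) (hc : ∀ n, ‖c n‖ ≤ Γ) {g : 𝓢'(ℝ, ℂ)}
    (hg : ∀ φ, g φ = ∑' n : ℤ, c n * φ (n * a)) : ∃ f, BoundedWeakStarTendsto f g := by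
  have hΓ : 0 ≤ Γ := (norm_nonneg _).trans (hc 0)
  set ρ : 𝓢(ℝ, ℂ) := (∫ x, gaussianWindow x)⁻¹ • gaussianWindow
  have hρ1 : ∫ x, ρ x = 1 := by
    simp only [ρ, smul_apply, smul_eq_mul]
    rw [integral_const_mul, inv_mul_cancel₀ integral_gaussianWindow_ne_zero]
  have hr : ∀ k : ℕ, (0 : ℝ) < (k : ℝ) + 1 := fun k => by positivity
  -- Truncated trains in which each delta is replaced by a rescaled Gaussian of integral one.
  let f : ℕ → 𝓢(ℝ, ℂ) := fun k => ∑ n ∈ Finset.Icc (-k : ℤ) k,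
    c n • compSubConstCLM ℂ (n * a) ((((k : ℝ) + 1 : ℝ) : ℂ) • dilate ((k : ℝ) + 1) (hr k) ρ)
  have hf : ∀ k φ, toTemperedDistributionCLM ℝ ℂ volume (f k) φ =
      ∑ n ∈ Finset.Icc (-k : ℤ) k, c n * ∫ u, ρ u * φ (n * a + u / ((k : ℝ) + 1)) := by
    intro k φ
    have e : ∀ x, φ x • f k x = ∑ n ∈ Finset.Icc (-k : ℤ) k,
        c n * ((((k : ℝ) + 1 : ℝ) : ℂ) * ρ ((x - n * a) * ((k : ℝ) + 1)) * φ x) := by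
      intro x
      simp only [f, sum_apply, smul_apply, compSubConstCLM_apply, dilate_apply, smul_eq_mul]
      rw [Finset.mul_sum]
      refine Finset.sum_congr rfl fun n _ => ?_
      ring
    refine (SchwartzMap.toTemperedDistributionCLM_apply_apply (μ := volume) (f k) φ).trans ?_
    simp_rw [e]
    rw [integral_finsetSum]
    · refine Finset.sum_congr rfl fun n _ => ?_
      rw [integral_const_mul, integral_rescaled_mul ρ φ (hr k)]
    · intro n _
      refine Integrable.const_mul ?_ _
      have hi := (mulS (compSubConstCLM ℂ (n * a)
        ((((k : ℝ) + 1 : ℝ) : ℂ) • dilate ((k : ℝ) + 1) (hr k) ρ)) φ).integrable (μ := volume)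
      refine hi.congr (ae_of_all _ fun x => ?_)
      simp
  have hρi : ∀ N : ℕ, Integrable fun u => (1 + ‖u‖) ^ N * ‖ρ u‖ :=
    fun N => integrable_one_add_pow_mul_norm volume N ρ
  refine ⟨f, ?_, ?_⟩
  · rw [PointwiseConvergenceCLM.tendsto_iff_forall_tendsto]
    intro φ
    simp_rw [hf, hg]
    set S := 4 * schNorm (2, 0) φ
    have hS : 0 ≤ S := mul_nonneg (by norm_num) (schNorm_nonneg _ _)
    have hbd : ∀ (n : ℤ) (k : ℕ) (u : ℝ), ‖ρ u * φ (n * a + u / ((k : ℝ) + 1))‖ ≤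
        2 * S * (1 + (n * a) ^ 2)⁻¹ * ((1 + ‖u‖) ^ 2 * ‖ρ u‖) := by
      intro n k u
      rw [norm_mul]
      set s := u / ((k : ℝ) + 1)
      have hs : s ^ 2 ≤ u ^ 2 := by
        simp only [s, div_pow]
        refine div_le_self (sq_nonneg _) ?_
        nlinarith [(Nat.cast_nonneg k : (0 : ℝ) ≤ k)]
      have h1 := norm_le_schNorm_mul_inv φ (n * a + s)
      have h2 : (1 + (n * a + s) ^ 2)⁻¹ ≤ 2 * (1 + ‖u‖) ^ 2 * (1 + (n * a) ^ 2)⁻¹ := by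
        rw [← div_eq_mul_inv, le_div_iff₀ (by positivity), inv_mul_le_iff₀ (by positivity)]
        have h3 : 1 + s ^ 2 ≤ (1 + ‖u‖) ^ 2 := by
          rw [Real.norm_eq_abs]
          nlinarith [abs_nonneg u, sq_abs u]
        -- Peetre's inequality: displacing the lattice point by `s` costs a factor `1 + s²`, which
        -- the decay of `ρ` absorbs. It supplies a summable majorant independent of `k`.
        have h4 : 1 + (n * a) ^ 2 ≤ 2 * ((1 + s ^ 2) * (1 + (n * a + s) ^ 2)) := by
          nlinarith [sq_nonneg (n * a + 2 * s), mul_nonneg (sq_nonneg s) (sq_nonneg (n * a + s))]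
        have h5 : 0 ≤ (1 + (n * a + s) ^ 2) := by positivity
        calc _ ≤ _ := h4
          _ ≤ 2 * ((1 + ‖u‖) ^ 2 * (1 + (n * a + s) ^ 2)) := by gcongr
          _ = _ := by ring
      calc _ ≤ ‖ρ u‖ * (S * (2 * (1 + ‖u‖) ^ 2 * (1 + (n * a) ^ 2)⁻¹)) := by
            gcongr
            exact h1.trans (mul_le_mul_of_nonneg_left h2 hS)
        _ = _ := by ring
    set J := ∫ u, (1 + ‖u‖) ^ 2 * ‖ρ u‖
    have hJ : 0 ≤ J := integral_nonneg fun u => by positivity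
    let t : ℕ → ℤ → ℂ := fun k => Set.indicator (Finset.Icc (-k : ℤ) k)
      fun n => c n * ∫ u, ρ u * φ (n * a + u / ((k : ℝ) + 1))
    have ht : ∀ k : ℕ, ∑ n ∈ Finset.Icc (-k : ℤ) k,
        c n * ∫ u, ρ u * φ (n * a + u / ((k : ℝ) + 1)) = ∑' n : ℤ, t k n := fun k => sum_eq_tsum_indicator _ _
    simp_rw [ht]
    refine tendsto_tsum_of_dominated_convergence
      (bound := fun n : ℤ => Γ * (2 * S * J) * (1 + (n * a) ^ 2)⁻¹)
      ((summable_inv_one_add_sq ha).mul_left _) (fun n => ?_)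
      (Eventually.of_forall fun k n => ?_)
    · have hlim : Tendsto (fun k : ℕ => ∫ u, ρ u * φ (n * a + u / ((k : ℝ) + 1))) atTop
          (𝓝 (∫ u, ρ u * φ (n * a))) := by
        refine tendsto_integral_of_dominated_convergence
          (fun u => 2 * S * (1 + (n * a) ^ 2)⁻¹ * ((1 + ‖u‖) ^ 2 * ‖ρ u‖)) (fun k => ?_)
          ((hρi 2).const_mul _) (fun k => ae_of_all _ (hbd n k)) (ae_of_all _ fun u => ?_)
        · have := ρ.continuous
          have := φ.continuous
          exact Continuous.aestronglyMeasurable (by fun_prop)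
        · refine Tendsto.const_mul _ ((φ.continuous.tendsto _).comp ?_)
          have h1 : Tendsto (fun k : ℕ => u / ((k : ℝ) + 1)) atTop (𝓝 0) := by
            have := tendsto_one_div_add_atTop_nhds_zero_nat (𝕜 := ℝ)
            simpa [div_eq_mul_inv] using this.const_mul u
          simpa using h1.const_add (n * a)
      rw [integral_mul_const, hρ1, one_mul] at hlim
      refine (hlim.const_mul (c n)).congr' ?_
      filter_upwards [eventually_ge_atTop n.natAbs] with k hk
      have hn : n ∈ (Finset.Icc (-k : ℤ) k : Set ℤ) := by
        simp only [Finset.coe_Icc, Set.mem_Icc]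
        omega
      simp only [t]
      rw [Set.indicator_of_mem hn]
    · refine (norm_indicator_le_norm_self _ _).trans ?_
      rw [norm_mul, mul_assoc]
      refine mul_le_mul (hc n) ?_ (norm_nonneg _) hΓ
      refine (norm_integral_le_of_norm_le ((hρi 2).const_mul _)
        (ae_of_all _ (hbd n k))).trans (le_of_eq ?_)
      rw [integral_const_mul]
      ring
  -- The transform of each approximant is dominated by an average, with density `|ρ|`, of lattice
  -- sums of the Gaussian. These are bounded uniformly in the translation, hence also in `k`.
  · obtain ⟨C, hC, h⟩ := exists_sum_norm_gaussianWindow_le ha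
    have hρi0 : Integrable fun u => ‖ρ u‖ := by simpa using hρi 0
    refine (iSup_le fun k => modulationNorm_top_le (C := Γ * ∫ u, C * ‖ρ u‖) fun z => ?_).trans_lt
      ENNReal.ofReal_lt_top
    rw [stft, hf]
    refine (norm_sum_le _ _).trans ?_
    have hgi : ∀ n : ℤ, Integrable fun u =>
        ‖ρ u‖ * ‖gaussianWindow (n * a - (z.1 - u / ((k : ℝ) + 1)))‖ := by
      intro n
      refine (hρi0.mul_const (schNorm (0, 0) gaussianWindow)).mono' ?_ (ae_of_all _ fun u => ?_)
      · have := ρ.continuous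
        have := gaussianWindow.continuous
        exact Continuous.aestronglyMeasurable (by fun_prop)
      · rw [Real.norm_of_nonneg (by positivity)]
        gcongr
        exact norm_le_schNorm _ _
    calc _ ≤ ∑ n ∈ Finset.Icc (-k : ℤ) k, Γ * ∫ u,
          ‖ρ u‖ * ‖gaussianWindow (n * a - (z.1 - u / ((k : ℝ) + 1)))‖ := by
          refine Finset.sum_le_sum fun n _ => ?_
          rw [norm_mul]
          refine mul_le_mul (hc n) ?_ (norm_nonneg _) hΓ
          refine norm_integral_le_of_norm_le (hgi n) (ae_of_all _ fun u => ?_)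
          rw [norm_mul, tfShift_eq_ec, norm_mul, norm_ec, one_mul]
          apply le_of_eq
          congr 3
          ring
      _ = Γ * ∫ u, ∑ n ∈ Finset.Icc (-k : ℤ) k,
          ‖ρ u‖ * ‖gaussianWindow (n * a - (z.1 - u / ((k : ℝ) + 1)))‖ := by
          rw [← Finset.mul_sum, integral_finsetSum _ fun n _ => hgi n]
      _ ≤ _ := by
          refine mul_le_mul_of_nonneg_left (integral_mono (integrable_finsetSum _ fun n _ => hgi n)
            (hρi0.const_mul C) fun u => ?_) hΓ
          simp only
          rw [← Finset.mul_sum, mul_comm]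
          gcongr
          exact ((h _).1.sum_le_tsum _ fun n _ => norm_nonneg _).trans (h _).2

end DeltaTrain

/-! ### Poisson summation with periodic coefficients -/

theorem fourier_eq_ec_mul (j : ℤ) (x : ℝ) : fourier j (x : UnitAddCircle) = ec (j * x) := by
  rw [fourier_coe_apply, ec]
  congr 1
  push_cast
  ring

theorem tsum_int_eq_sum_residues {L : ℕ} (hL : 0 < L) {f : ℤ → ℂ} (hf : Summable f) :
    ∑' n, f n = ∑ r ∈ Finset.range L, ∑' q : ℤ, f (q * L + r) := by
  have : NeZero L := ⟨hL.ne'⟩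
  have h1 : ∑' n, f n = ∑' p : Fin L × ℤ, f (p.2 * L + p.1) :=
    (((Equiv.prodComm _ _).trans (Int.divModEquiv L).symm).tsum_eq f).symm
  have h2 : Summable fun p : Fin L × ℤ => f (p.2 * L + p.1) :=
    ((Equiv.prodComm _ _).trans (Int.divModEquiv L).symm).summable_iff.mpr hf
  rw [h1, h2.tsum_prod, tsum_fintype, Finset.sum_range]

/-- Poisson summation on each residue class modulo `L`, a lattice of step `L a`. Collecting the
classes puts the discrete Fourier transform of the weights on the dual lattice; this is where
aliasing enters. -/
theorem tsum_periodic_mul_eq {L : ℕ} (hL : 0 < L) {a : ℝ} (ha : 0 < a) {u : ℤ → ℂ}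
    (hu : Function.Periodic u L) (C : 𝓢(ℝ, ℂ)) :
    ∑' n : ℤ, u n * C (n * a) = ((L * a)⁻¹ : ℝ) * ∑' j : ℤ, 𝓕 C (j * (L * a)⁻¹) *
      ∑ r ∈ Finset.range L, u r * ec (j * r / L) := by
  have hL' : (0 : ℝ) < L := by exact_mod_cast hL
  have hLa : 0 < L * a := by positivity
  obtain ⟨Γ, hΓ⟩ := exists_norm_le_of_periodic hL hu
  have hs := summable_deltaTrain ha hΓ C
  have h1 : ∑' n : ℤ, u n * C (n * a) =
      ∑ r ∈ Finset.range L, ∑' q : ℤ, u r * C ((r / L + q) * (L * a)) := by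
    rw [tsum_int_eq_sum_residues hL hs]
    refine Finset.sum_congr rfl fun r _ => tsum_congr fun q => ?_
    have e1 : u (q * L + r) = u r := by
      have := hu.int_mul q r
      rwa [add_comm] at this
    have e2 : (((q * L + r : ℤ) : ℝ)) * a = (r / L + q) * (L * a) := by
      push_cast; field_simp; ring
    rw [e1, ← e2]
  have hb : ∀ x : ℝ, Summable fun j : ℤ => 𝓕 C (j * (L * a)⁻¹) * ec (j * x) := by
    intro x
    refine (summable_deltaTrain (inv_pos.mpr hLa) (c := fun j : ℤ => ec (j * x)) (Γ := 1)
      (fun n => (norm_ec _).le) (𝓕 C)).congr fun j => ?_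
    rw [mul_comm]
  have h2 : ∀ x : ℝ, ∑' q : ℤ, C ((x + q) * (L * a)) =
      ((L * a)⁻¹ : ℝ) * ∑' j : ℤ, 𝓕 C (j * (L * a)⁻¹) * ec (j * x) := by
    intro x
    have h := SchwartzMap.tsum_eq_tsum_fourier (dilate (L * a) hLa C) x
    simp only [dilate_apply] at h
    rw [h, ← tsum_mul_left]
    refine tsum_congr fun j => ?_
    rw [fourier_dilate_apply, fourier_eq_ec_mul, mul_assoc]
  rw [h1]
  simp_rw [tsum_mul_left, h2]
  simp_rw [Finset.mul_sum]
  rw [Summable.tsum_finsetSum, Finset.mul_sum]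
  · refine Finset.sum_congr rfl fun r _ => ?_
    rw [mul_left_comm, ← tsum_mul_left]
    congr 1
    refine tsum_congr fun j => ?_
    rw [mul_div_assoc]
    ring
  · intro r _
    refine ((hb (r / L)).mul_left (u r)).congr fun j => ?_
    rw [mul_div_assoc]
    ring

/-! ### Cutoffs adapted to a lattice -/

/-- A subexponential bump whose lattice translates add up to one, and a cutoff that meets finitely
many of them. -/
structure IsLatticePartition (b a : ℝ) (ψ χ : 𝓢(ℝ, ℂ)) (J : Finset ℤ) : Prop where
  isSubexp_bump : IsSubexp b ψ
  isSubexp_cutoff : IsSubexp b χ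
  bump_eq_zero : ∀ x, a ≤ |x| → ψ x = 0
  sum_eq : ∀ x, ∑ k ∈ J, χ x * ψ (x - k * a) = χ x
  mul_eq_zero : ∀ k ∉ J, ∀ x, χ x * ψ (x - k * a) = 0

theorem exists_isLatticePartition {b : ℝ} (hb : 0 < b) (hb1 : b ≤ 1) {ψ : 𝓢(ℝ, ℂ)}
    (hψ : ∀ x, 1 ≤ |x| → ψ x = 0) (hsum : ∀ x, HasSum (fun k : ℤ => ψ (x - k)) 1)
    (hψb : IsSubexp b ψ) {r : ℝ} (hr : 0 < r) (R : ℝ) :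
    ∃ ψ' χ J, IsLatticePartition b r⁻¹ ψ' χ J ∧ ∀ x, |x| < R → χ x = 1 := by
  obtain ⟨N, hN⟩ := exists_nat_ge (R * r)
  -- The cutoff is a partial sum of the partition: it equals one for `|x| ≤ N` and vanishes for `|x|
  -- ≥ N + 2`. Accordingly indices up to `N + 3` suffice to resolve it.
  set χ₀ : 𝓢(ℝ, ℂ) := ∑ k ∈ Finset.Icc (-(N + 1) : ℤ) (N + 1), compSubConstCLM ℂ (k : ℝ) ψ
  have h0 : ∀ x, χ₀ x = ∑ k ∈ Finset.Icc (-(N + 1) : ℤ) (N + 1), ψ (x - k) := fun x => by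
    simp only [χ₀, sum_apply, compSubConstCLM_apply]
  have h1 : ∀ (M : ℕ) (x : ℝ), |x| ≤ M →
      ∑ k ∈ Finset.Icc (-(M + 1) : ℤ) (M + 1), ψ (x - k) = 1 := by
    intro M x hx
    rw [← (hsum x).tsum_eq, tsum_eq_sum]
    intro k hk
    refine hψ _ ?_
    rw [Finset.mem_Icc, not_and_or, not_le, not_le] at hk
    rw [abs_le] at hx
    rw [le_abs]
    rcases hk with hk | hk
    · left
      have : (k : ℝ) + 1 ≤ -(M + 1) := by exact_mod_cast hk
      linarith [hx.1]
    · right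
      have : (M : ℝ) + 1 + 1 ≤ k := by exact_mod_cast hk
      linarith [hx.2]
  have h2 : ∀ x : ℝ, ((N + 2 : ℕ) : ℝ) ≤ |x| → χ₀ x = 0 := by
    intro x hx
    rw [h0]
    refine Finset.sum_eq_zero fun k hk => hψ _ ?_
    rw [Finset.mem_Icc] at hk
    have : |(k : ℝ)| ≤ N + 1 := abs_le.mpr ⟨by exact_mod_cast hk.1, by exact_mod_cast hk.2⟩
    have := abs_sub_abs_le_abs_sub x k
    push_cast at hx
    linarith
  have hm : ∀ (k : ℤ) (x : ℝ), (x - k * r⁻¹) * r = x * r - k := fun k x => by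
    field_simp
  refine ⟨dilate r hr ψ, dilate r hr χ₀, Finset.Icc (-((N + 2 : ℕ) + 1) : ℤ) ((N + 2 : ℕ) + 1),
    ⟨hψb.dilate hr, IsSubexp.dilate (IsSubexp.sum _ fun k _ => hψb.compSubConst hb hb1 _) hr,
      fun x hx => ?_, fun x => ?_, fun k hk x => ?_⟩, fun x hx => ?_⟩
  · rw [dilate_apply]
    refine hψ _ ?_
    rw [abs_mul, abs_of_pos hr]
    rwa [inv_le_iff_one_le_mul₀ hr] at hx
  · simp only [dilate_apply, hm]
    rw [← Finset.mul_sum]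
    by_cases hx : |x * r| ≤ (N + 2 : ℕ)
    · rw [h1 _ _ hx, mul_one]
    · rw [h2 _ (not_le.mp hx).le, zero_mul]
  · simp only [dilate_apply, hm]
    by_cases hx : |x * r| < (N + 2 : ℕ)
    · rw [hψ, mul_zero]
      rw [Finset.mem_Icc, not_and_or, not_le, not_le] at hk
      rw [abs_lt] at hx
      rw [le_abs]
      rcases hk with hk | hk
      · left
        have : (k : ℝ) + 1 ≤ -((N + 2 : ℕ) + 1) := by exact_mod_cast hk
        linarith [hx.1]
      · right
        have : ((N + 2 : ℕ) : ℝ) + 1 + 1 ≤ k := by exact_mod_cast hk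
        linarith [hx.2]
    · rw [h2 _ (not_lt.mp hx), zero_mul]
  · rw [dilate_apply, h0, h1]
    rw [abs_mul, abs_of_pos hr]
    exact (mul_le_mul_of_nonneg_right hx.le hr.le).trans hN

/-! ### Pairing of modulated lattice sums -/

theorem fourier_compSubConst_apply (f : 𝓢(ℝ, ℂ)) (s w : ℝ) :
    𝓕 (compSubConstCLM ℂ s f) w = ec (-(w * s)) * 𝓕 f w := by
  rw [fourier_coe, fourier_coe, fourier_eq_ec, fourier_eq_ec, ← integral_const_mul,
    ← integral_add_right_eq_self _ s]
  refine integral_congr_ae (ae_of_all _ fun v => ?_)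
  simp only [compSubConstCLM_apply, add_sub_cancel_right]
  rw [← mul_assoc, ← ec_add]
  ring_nf

theorem fourierInv_fourierInv_apply (f : 𝓢(ℝ, ℂ)) (x : ℝ) : 𝓕⁻ (𝓕⁻ f) x = f (-x) := by
  rw [fourierInv_apply_eq_fourier_neg, FourierTransform.fourier_fourierInv_eq]

theorem fourierInv_compSubConst_apply (f : 𝓢(ℝ, ℂ)) (s w : ℝ) :
    𝓕⁻ (compSubConstCLM ℂ s f) w = ec (w * s) * 𝓕⁻ f w := by
  rw [fourierInv_apply_eq_fourier_neg, fourier_compSubConst_apply, fourierInv_apply_eq_fourier_neg]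
  ring_nf

/-- The correlation of two Schwartz functions. -/
theorem exists_correlation (B G : 𝓢(ℝ, ℂ)) : ∃ C : 𝓢(ℝ, ℂ),
    (∀ y, C y = ∫ u, B u * G (u + y)) ∧ ∀ w, 𝓕 C w = 𝓕⁻ B w * 𝓕 G w := by
  refine ⟨𝓕 (mulS (𝓕 B) (𝓕⁻ G)), fun y => ?_, fun w => ?_⟩
  · rw [fourier_mulS_apply, FourierTransform.fourierInv_fourier_eq,
      FourierTransform.fourier_fourierInv_eq]
  · rw [fourier_fourier_apply, mulS_apply, fourierInv_apply_eq_fourier_neg,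
      fourierInv_apply_eq_fourier_neg, neg_neg]

/-- Evaluating the transform at `w` translates `ψ` by `w` on the other side, so at a dual lattice
point the compactly supported product `χ ψ(· - w)` appears. It vanishes for all but finitely many of
these points. -/
theorem fourier_mulS_compSubConst_apply (χ ψ : 𝓢(ℝ, ℂ)) (s t w : ℝ) :
    𝓕 (mulS (compSubConstCLM ℂ s (𝓕⁻ χ)) (compSubConstCLM ℂ t (𝓕 ψ))) w =
      ec (-(w * t)) * 𝓕 (mulS χ (compSubConstCLM ℂ w ψ)) (s - t) := by
  rw [fourier_mulS_apply, fourier_coe (mulS χ _), fourier_eq_ec, ← integral_const_mul,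
    ← integral_neg_eq_self]
  refine integral_congr_ae (ae_of_all _ fun v => ?_)
  simp only [fourierInv_compSubConst_apply, fourier_compSubConst_apply, fourier_fourier_apply,
    fourierInv_fourierInv_apply, mulS_apply, compSubConstCLM_apply, neg_neg]
  rw [show -(-v + w) = v - w by ring]
  have : ec (-v * s) * ec (-((-v + w) * t)) = ec (-(w * t)) * ec (-(v * (s - t))) := by
    rw [← ec_add, ← ec_add]; ring_nf
  linear_combination (χ v * ψ (v - w)) * this

section Pairing

variable {a b Γ Δ : ℝ} {c d : ℤ → ℂ} {χ₁ χ₂ ψ₁ ψ₂ : 𝓢(ℝ, ℂ)} {J₁ J₂ : Finset ℤ}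

/-- The pairing of a function `G` with the lattice sum attached to the point `z`. -/
def combPairing (a : ℝ) (c : ℤ → ℂ) (χ₁ χ₂ : 𝓢(ℝ, ℂ)) (G : ℝ → ℂ) (z : ℝ × ℝ) : ℂ :=
  ∫ x, combFun a c χ₁ z.2 x * (𝓕⁻ χ₂ (x - z.1) * G x)

/-- Near the lattice point `n a` the cutoff meets only the bumps with index `n + k`, `k ∈ J₁`.
Reindexing makes the coefficient depend on `n + k` while the function depends on `k` alone. -/
theorem mul_combFun_add_eq (h₁ : IsLatticePartition b a ψ₁ χ₁ J₁) (θ u : ℝ) (n : ℤ) :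
    χ₁ u * combFun a d ψ₁ θ (u + n * a) =
      ∑ k ∈ J₁, d (n + k) * (ec (-(θ * (k * a))) * (ec (θ * u) *
        mulS χ₁ (compSubConstCLM ℂ (k * a) ψ₁) u)) := by
  have e : ∀ k : ℤ, χ₁ u * (d (n + k) * ψ₁ (u + n * a - (n + k : ℤ) * a) *
      ec (θ * (u + n * a - (n + k : ℤ) * a))) = d (n + k) * (ec (-(θ * (k * a))) * (ec (θ * u) *
        mulS χ₁ (compSubConstCLM ℂ (k * a) ψ₁) u)) := by
    intro k
    have e1 : u + n * a - (n + k : ℤ) * a = u - k * a := by push_cast; ring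
    rw [e1, mulS_apply, compSubConstCLM_apply, mul_sub, ec_sub]
    ring
  rw [combFun, ← (Equiv.addLeft n).tsum_eq, ← tsum_mul_left, tsum_eq_sum (s := J₁)]
  · exact Finset.sum_congr rfl fun k _ => e k
  · intro k hk
    simp only [Equiv.coe_addLeft]
    rw [e, mulS_apply, compSubConstCLM_apply, h₁.mul_eq_zero k hk]
    simp

/-- Expanding the train and using the preceding lemma, the pairing becomes a finite sum over `k` of
series `∑ c_n d_{n+k} C_k(n a)`, where `C_k` is a correlation. Poisson summation with the periodic
weights `c_n d_{n+k}` gives the double sum. The transform of `C_k` factors, and its second factor is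
zero for `j ∉ J₂`. The dual sequences act only through the inner sum over `r`. -/
theorem combPairing_combFun (ha : 0 < a) (hb : 0 < b) (hb1 : b ≤ 1) {L : ℕ} (hL : 0 < L)
    (hc : Function.Periodic c L) (hd : Function.Periodic d L)
    (h₁ : IsLatticePartition b a ψ₁ χ₁ J₁) (h₂ : IsLatticePartition b (L * a)⁻¹ ψ₂ χ₂ J₂)
    (θ x₀ : ℝ) (z : ℝ × ℝ) :
    combPairing a c χ₁ χ₂ (fun x => combFun a d ψ₁ θ x * 𝓕 ψ₂ (x - x₀)) z =
      ((L * a)⁻¹ : ℝ) * ∑ k ∈ J₁, ∑ j ∈ J₂,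
        (∑ r ∈ Finset.range L, c r * d (r + k) * ec (j * r / L)) *
        (ec (-(θ * (k * a))) * ec (-(j * (L * a)⁻¹ * x₀)) *
          (𝓕⁻ (mulS χ₁ (compSubConstCLM ℂ (k * a) ψ₁)) (z.2 + θ + j * (L * a)⁻¹) *
          𝓕 (mulS χ₂ (compSubConstCLM ℂ (j * (L * a)⁻¹) ψ₂)) (z.1 - x₀))) := by
  obtain ⟨Γ, hΓ⟩ := exists_norm_le_of_periodic hL hc
  obtain ⟨Δ, hΔ⟩ := exists_norm_le_of_periodic hL hd
  obtain ⟨D, hD, hDb⟩ := exists_norm_combFun_le ha hb hb1 h₁.isSubexp_bump hΔ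
  have hcont := (continuous_combFun ha hb hb1 h₁.isSubexp_bump hΔ).comp
    (Continuous.prodMk_right θ)
  have hψ₂ := (𝓕 ψ₂).continuous
  have hsum := hasSum_integral_combFun ha hb hb1 h₁.isSubexp_cutoff hΓ
    h₂.isSubexp_cutoff.fourierInv (G := fun x => combFun a d ψ₁ θ x * 𝓕 ψ₂ (x - x₀))
    (B := D * schNorm (0, 0) (𝓕 ψ₂)) (hcont.mul (by fun_prop)) (fun x => by
      rw [norm_mul]
      exact mul_le_mul (hDb _ _) (norm_le_schNorm _ _) (norm_nonneg _) hD.le) z.2 z.1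
  set G₀ := mulS (compSubConstCLM ℂ z.1 (𝓕⁻ χ₂)) (compSubConstCLM ℂ x₀ (𝓕 ψ₂)) with hG₀
  set P : ℤ → 𝓢(ℝ, ℂ) := fun k => mulS χ₁ (compSubConstCLM ℂ (k * a) ψ₁) with hP
  choose C hC hCF using fun k : ℤ => exists_correlation (tfShift 0 (z.2 + θ) (P k)) G₀
  have hterm : ∀ n : ℤ, c n * ∫ x, χ₁ (x - n * a) * ec (z.2 * (x - n * a)) *
      (𝓕⁻ χ₂ (x - z.1) * (combFun a d ψ₁ θ x * 𝓕 ψ₂ (x - x₀))) =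
      ∑ k ∈ J₁, ec (-(θ * (k * a))) * ((c n * d (n + k)) * C k (n * a)) := by
    intro n
    rw [← integral_add_right_eq_self _ (n * a)]
    have e : ∀ u : ℝ, χ₁ (u + n * a - n * a) * ec (z.2 * (u + n * a - n * a)) *
        (𝓕⁻ χ₂ (u + n * a - z.1) * (combFun a d ψ₁ θ (u + n * a) * 𝓕 ψ₂ (u + n * a - x₀))) =
        ∑ k ∈ J₁, d (n + k) * ec (-(θ * (k * a))) *
          (tfShift 0 (z.2 + θ) (P k) u * G₀ (u + n * a)) := by
      intro u
      have h := mul_combFun_add_eq (d := d) h₁ θ u n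
      rw [add_sub_cancel_right]
      calc _ = (χ₁ u * combFun a d ψ₁ θ (u + n * a)) * (ec (z.2 * u) *
            (𝓕⁻ χ₂ (u + n * a - z.1) * 𝓕 ψ₂ (u + n * a - x₀))) := by ring
        _ = _ := by
          rw [h, Finset.sum_mul]
          refine Finset.sum_congr rfl fun k _ => ?_
          have e2 : G₀ (u + n * a) = 𝓕⁻ χ₂ (u + n * a - z.1) * 𝓕 ψ₂ (u + n * a - x₀) := by
            rw [hG₀, mulS_apply, compSubConstCLM_apply, compSubConstCLM_apply]
          rw [tfShift_eq_ec, sub_zero, e2, add_mul, ec_add]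
          ring
    simp_rw [e]
    rw [integral_finsetSum, Finset.mul_sum]
    · refine Finset.sum_congr rfl fun k _ => ?_
      rw [integral_const_mul, hC]
      ring
    · intro k _
      have := (mulS (tfShift 0 (z.2 + θ) (P k)) (compSubConstCLM ℂ (-(n * a)) G₀)).integrable
        (μ := volume)
      refine Integrable.const_mul (this.congr (ae_of_all _ fun u => ?_)) _
      simp only [mulS_apply, compSubConstCLM_apply, sub_neg_eq_add]
  have hper : ∀ k : ℤ, Function.Periodic (fun n => c n * d (n + k)) L := by
    intro k n
    simp only
    rw [hc n, show n + (L : ℤ) + k = n + k + L by ring, hd]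
  have hsm : ∀ k, Summable fun n : ℤ => (c n * d (n + k)) * C k (n * a) := by
    intro k
    obtain ⟨B, hB⟩ := exists_norm_le_of_periodic hL (hper k)
    exact summable_deltaTrain ha hB (C k)
  have hCj : ∀ k j : ℤ, 𝓕 (C k) (j * (L * a)⁻¹) = 𝓕⁻ (P k) (z.2 + θ + j * (L * a)⁻¹) *
      (ec (-(j * (L * a)⁻¹ * x₀)) *
        𝓕 (mulS χ₂ (compSubConstCLM ℂ (j * (L * a)⁻¹) ψ₂)) (z.1 - x₀)) := by
    intro k j
    have e : 𝓕⁻ (tfShift 0 (z.2 + θ) (P k)) (j * (L * a)⁻¹) =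
        𝓕⁻ (P k) (z.2 + θ + j * (L * a)⁻¹) := by
      rw [fourierInv_apply_eq_fourier_neg, fourierInv_apply_eq_fourier_neg,
        ← neg_neg (z.2 + θ), fourier_tfShift_zero]
      ring_nf
    rw [hCF, e, hG₀, fourier_mulS_compSubConst_apply]
  rw [combPairing, ← hsum.tsum_eq]
  simp_rw [hterm]
  rw [Summable.tsum_finsetSum fun k _ => (hsm k).mul_left _, Finset.mul_sum]
  refine Finset.sum_congr rfl fun k _ => ?_
  rw [tsum_mul_left, tsum_periodic_mul_eq hL ha (hper k), tsum_eq_sum (s := J₂), mul_left_comm,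
    Finset.mul_sum]
  · congr 1
    refine Finset.sum_congr rfl fun j _ => ?_
    rw [hCj]
    ring
  · intro j hj
    have : mulS χ₂ (compSubConstCLM ℂ (j * (L * a)⁻¹) ψ₂) = 0 := by
      ext x
      rw [mulS_apply, compSubConstCLM_apply, h₂.mul_eq_zero j hj]
      rfl
    rw [hCj, this, FourierTransform.fourier_zero]
    simp

end Pairing

/-! ### Inversion of the short-time Fourier transform -/

theorem integral_fourier_mul_eq_of_integrable {f g : ℝ → ℂ} (hf : Integrable f)
    (hg : Integrable g) : ∫ w, 𝓕 f w * g w = ∫ x, f x * 𝓕 g x := by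
  have h := VectorFourier.integral_fourierIntegral_smul_eq_flip (μ := volume) (ν := volume)
    (L := innerₗ ℝ) Real.continuous_fourierChar continuous_inner hf hg
  simpa [flip_innerₗ] using! h

theorem integral_gaussianWindow_sq (x : ℝ) :
    ∫ t, gaussianWindow (x - t) * gaussianWindow (x - t) = 1 := by
  have h1 := integral_sub_left_eq_self (μ := volume)
    (fun t => gaussianWindow t * gaussianWindow t) x
  rw [h1]
  have e : ∀ t, gaussianWindow t * gaussianWindow t =
      ((Real.sqrt 2 * Real.exp (-(2 * Real.pi) * t ^ 2) : ℝ) : ℂ) := by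
    intro t
    rw [gaussianWindow_apply, ← Complex.ofReal_mul]
    congr 1
    have h2 : (2 : ℝ) ^ (1 / 4 : ℝ) * (2 : ℝ) ^ (1 / 4 : ℝ) = Real.sqrt 2 := by
      rw [← Real.rpow_add two_pos, Real.sqrt_eq_rpow]
      norm_num
    have h3 : Real.exp (-Real.pi * t ^ 2) * Real.exp (-Real.pi * t ^ 2) =
        Real.exp (-(2 * Real.pi) * t ^ 2) := by
      rw [← Real.exp_add]; ring_nf
    rw [← h2, ← h3]
    ring
  simp_rw [e]
  rw [integral_complex_ofReal, integral_const_mul, integral_gaussian, ← Real.sqrt_mul two_pos.le]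
  have : 2 * (Real.pi / (2 * Real.pi)) = 1 := by
    have := Real.pi_ne_zero
    field_simp
  rw [this]
  simp

/-- For fixed `t` the multiplication formula and Fourier inversion evaluate the `ν`-integral as `∫ Θ
W 𝔤(· - t)²`; integrating over `t` removes the window since `∫ 𝔤² = 1`. -/
theorem stft_inversion {Θ W : ℝ → ℂ} (hΘ : Continuous Θ) (hΘi : Integrable Θ) (hW : Continuous W)
    {B : ℝ} (hB : ∀ x, ‖W x‖ ≤ B)
    (hA : ∀ t, Integrable fun ν => ∫ x, Θ x * (gaussianWindow (x - t) * ec (x * ν)))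
    (hi : Integrable fun ζ : ℝ × ℝ => (∫ x, Θ x * (gaussianWindow (x - ζ.1) * ec (x * ζ.2))) *
      ∫ x, W x * (gaussianWindow (x - ζ.1) * ec (-(x * ζ.2)))) :
    ∫ ζ : ℝ × ℝ, (∫ x, Θ x * (gaussianWindow (x - ζ.1) * ec (x * ζ.2))) *
      ∫ x, W x * (gaussianWindow (x - ζ.1) * ec (-(x * ζ.2))) = ∫ x, Θ x * W x := by
  have hg := gaussianWindow.continuous
  have hgb : ∀ x, ‖gaussianWindow x‖ ≤ schNorm (0, 0) gaussianWindow := norm_le_schNorm _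
  have hinner : ∀ t, ∫ ν, (∫ x, Θ x * (gaussianWindow (x - t) * ec (x * ν))) *
      ∫ x, W x * (gaussianWindow (x - t) * ec (-(x * ν))) =
      ∫ x, Θ x * W x * (gaussianWindow (x - t) * gaussianWindow (x - t)) := by
    intro t
    set u : ℝ → ℂ := fun x => Θ x * gaussianWindow (x - t)
    set v : ℝ → ℂ := fun x => W x * gaussianWindow (x - t)
    have hgt : Integrable fun x => gaussianWindow (x - t) :=
      (gaussianWindow.integrable (μ := volume)).comp_sub_right t
    have huc : Continuous u := by fun_prop
    have hui : Integrable u := hΘi.mul_bdd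
      (Continuous.aestronglyMeasurable (by fun_prop)) (ae_of_all _ fun x => hgb _)
    have hvi : Integrable v := hgt.bdd_mul hW.aestronglyMeasurable (ae_of_all _ hB)
    have e1 : ∀ ν, ∫ x, Θ x * (gaussianWindow (x - t) * ec (x * ν)) = 𝓕⁻ u ν := by
      intro ν
      rw [fourierInv_eq_ec]
      refine integral_congr_ae (ae_of_all _ fun x => ?_)
      simp only [u]
      ring
    have e2 : ∀ ν, ∫ x, W x * (gaussianWindow (x - t) * ec (-(x * ν))) = 𝓕 v ν := by
      intro ν
      rw [fourier_eq_ec]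
      refine integral_congr_ae (ae_of_all _ fun x => ?_)
      simp only [v]
      ring
    have hFi : Integrable (𝓕⁻ u) := by simpa only [e1] using! hA t
    have hFi' : Integrable (𝓕 u) := by
      refine hFi.comp_neg.congr (ae_of_all _ fun ν => ?_)
      simp only [Real.fourierInv_eq_fourier_neg, neg_neg]
    simp_rw [e1, e2]
    have h1 := integral_fourier_mul_eq_of_integrable hvi hFi
    rw [huc.fourier_fourierInv_eq hui hFi'] at h1
    calc _ = ∫ w, 𝓕 v w * 𝓕⁻ u w := integral_congr_ae (ae_of_all _ fun w => mul_comm _ _)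
      _ = _ := h1
      _ = _ := integral_congr_ae (ae_of_all _ fun x => by simp only [u, v]; ring)
  have hB0 : 0 ≤ B := (norm_nonneg _).trans (hB 0)
  have hgi : Integrable fun x => gaussianWindow x * gaussianWindow x :=
    ((mulS gaussianWindow gaussianWindow).integrable (μ := volume)).congr
      (ae_of_all _ fun x => mulS_apply _ _ _)
  rw [Measure.volume_eq_prod, integral_prod _ hi]
  simp only
  simp_rw [hinner]
  rw [integral_integral_swap]
  · refine integral_congr_ae (ae_of_all _ fun x => ?_)
    simp only
    rw [integral_const_mul, integral_gaussianWindow_sq, mul_one]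
  · have h1 : Integrable fun x => Θ x * W x :=
      hΘi.mul_bdd hW.aestronglyMeasurable (ae_of_all _ hB)
    have h2 := h1.convolution_integrand (ContinuousLinearMap.mul ℂ ℂ) hgi
    refine h2.congr (ae_of_all _ fun p => ?_)
    have e : gaussianWindow (p.1 - p.2) = gaussianWindow (p.2 - p.1) := by
      rw [gaussianWindow_apply, gaussianWindow_apply, sub_sq_comm]
    simp [Function.uncurry_def, e]

/-! ### The response to a weighted delta train -/

section Response

variable {a b Γ Δ : ℝ} {c d : ℤ → ℂ} {χ₁ χ₂ ψ₁ ψ₂ : 𝓢(ℝ, ℂ)} {S : ℝ × ℝ → ℂ}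
  {T : 𝓢(ℝ, ℂ) →L[ℂ] 𝓢(ℝ, ℂ)} {g : 𝓢'(ℝ, ℂ)}

/-- Summing the kernels at the points `n a` assembles a modulated lattice sum. Interchanging sum and
integral is allowed because `kernelOp` decays rapidly both in `z` and along the lattice. -/
theorem deltaTrain_transpose_apply (ha : 0 < a) (hb : 0 < b) (hb1 : b ≤ 1) (hc : ∀ n, ‖c n‖ ≤ Γ)
    (hχ₁ : IsSubexp b χ₁) (hχ₂ : IsSubexp b χ₂) (hS : IsPolyBounded S)
    (hT : ∀ φ y, T φ y = ∫ z, S z * kernelOp χ₁ χ₂ z φ y)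
    (hg : ∀ φ, g φ = ∑' n : ℤ, c n * φ (n * a)) (φ : 𝓢(ℝ, ℂ)) :
    g (T φ) = ∫ z, S z * combPairing a c χ₁ χ₂ φ z := by
  obtain ⟨hSm, N, C, hC, hSb⟩ := hS
  obtain ⟨m', D, hD, h⟩ := exists_schNorm_kernelOp_le χ₁ χ₂ (N + 3) (2, 0)
  have hΓ : 0 ≤ Γ := (norm_nonneg _).trans (hc 0)
  set E := C * (D * schNorm m' φ)
  have hE : 0 ≤ E := mul_nonneg hC (mul_nonneg hD (schNorm_nonneg _ _))
  have hbd : ∀ (n : ℤ) z, ‖c n * (S z * kernelOp χ₁ χ₂ z φ (n * a))‖ ≤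
      Γ * (4 * E * (1 + (n * a) ^ 2)⁻¹) * ((1 + ‖z‖) ^ 3)⁻¹ := by
    intro n z
    have h1 := integrable_mul_of_rapid_decay hSb (A := 1) (D := D * schNorm m' φ) z zero_le_one
      (schNorm_nonneg (2, 0) (kernelOp χ₁ χ₂ z φ)) (by rw [one_mul]; exact h z φ)
    rw [one_mul] at h1
    rw [norm_mul, norm_mul]
    calc _ ≤ Γ * (‖S z‖ * (4 * schNorm (2, 0) (kernelOp χ₁ χ₂ z φ) * (1 + (n * a) ^ 2)⁻¹)) := by
          gcongr
          · exact hc n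
          · exact norm_le_schNorm_mul_inv _ _
      _ = Γ * (4 * (1 + (n * a) ^ 2)⁻¹ * (‖S z‖ * schNorm (2, 0) (kernelOp χ₁ χ₂ z φ))) := by ring
      _ ≤ Γ * (4 * (1 + (n * a) ^ 2)⁻¹ * (E * ((1 + ‖z‖) ^ 3)⁻¹)) := by gcongr Γ * (_ * ?_)
      _ = _ := by ring
  have hm : ∀ n : ℤ, Measurable fun z => c n * (S z * kernelOp χ₁ χ₂ z φ (n * a)) := by
    intro n
    have h1 : Measurable fun z => kernelOp χ₁ χ₂ z φ (n * a) :=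
      Measurable.comp (g := fun p : (ℝ × ℝ) × ℝ => kernelOp χ₁ χ₂ p.1 φ p.2)
        (f := fun z : ℝ × ℝ => (z, n * a)) (measurable_kernelOp χ₁ χ₂ φ) (by fun_prop)
    exact (hSm.mul h1).const_mul _
  have hint : ∀ n : ℤ, Integrable fun z => c n * (S z * kernelOp χ₁ χ₂ z φ (n * a)) := fun n =>
    (integrable_inv_one_add_pow_three.const_mul _).mono' (hm n).aestronglyMeasurable
      (ae_of_all _ (hbd n))
  set J := ∫ z : ℝ × ℝ, ((1 + ‖z‖) ^ 3)⁻¹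
  have hsum : Summable fun n : ℤ => ∫ z, ‖c n * (S z * kernelOp χ₁ χ₂ z φ (n * a))‖ := by
    refine Summable.of_nonneg_of_le (fun n => integral_nonneg fun z => norm_nonneg _) (fun n => ?_)
      ((summable_inv_one_add_sq ha).mul_left (Γ * (4 * E) * J))
    refine (integral_mono (hint n).norm (integrable_inv_one_add_pow_three.const_mul _)
      (hbd n)).trans (le_of_eq ?_)
    rw [integral_const_mul]
    ring
  have hs := (hasSum_integral_of_summable_integral_norm hint hsum).tsum_eq
  rw [hg]
  simp_rw [hT, ← integral_const_mul]
  rw [hs]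
  refine integral_congr_ae (ae_of_all _ fun z => ?_)
  have hφ := φ.continuous
  have h2 := hasSum_integral_combFun ha hb hb1 hχ₁ hc hχ₂.fourierInv hφ (norm_le_schNorm φ) z.2 z.1
  simp only
  rw [combPairing, ← h2.tsum_eq, ← tsum_mul_left]
  refine tsum_congr fun n => ?_
  rw [kernelOp_apply, mul_left_comm]
  congr 2
  refine integral_congr_ae (ae_of_all _ fun x => ?_)
  simp only
  ring

theorem combPairing_tfShift (ζ z : ℝ × ℝ) :
    combPairing a c χ₁ χ₂ (tfShift ζ.1 (-ζ.2) gaussianWindow) z =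
      ∫ x, combFun a c χ₁ z.2 x * 𝓕⁻ χ₂ (x - z.1) *
        (gaussianWindow (x - ζ.1) * ec (-(x * ζ.2))) := by
  refine integral_congr_ae (ae_of_all _ fun x => ?_)
  simp only
  rw [tfShift_eq_ec, show -ζ.2 * x = -(x * ζ.2) by ring]
  ring

/-- This is the kernel taking the symbol to the short-time Fourier transform of the response; its
decay yields the upper sampling bound. -/
theorem exists_norm_combPairing_tfShift_le (ha : 0 < a) (hb : 0 < b) (hb1 : b ≤ 1)
    (hc : ∀ n, ‖c n‖ ≤ Γ) (hχ₁ : IsSubexp b χ₁) (hχ₂ : IsSubexp b χ₂) :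
    ∃ κ C : ℝ, 0 < κ ∧ 0 < C ∧ ∀ ζ z : ℝ × ℝ,
      ‖combPairing a c χ₁ χ₂ (tfShift ζ.1 (-ζ.2) gaussianWindow) z‖ ≤
        C * (sexp b κ (z.1 - ζ.1) * sexp b κ (z.2 - ζ.2)) := by
  obtain ⟨κ, C, hκ, hC, h⟩ := exists_norm_integral_combFun_le ha hb hb1 hχ₁
    (isSubexp_gaussianWindow hb hb1) hχ₂.fourierInv hc
  refine ⟨κ, C, hκ, hC, fun ζ z => ?_⟩
  have h1 := h z.2 ζ.1 z.1 ζ.2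
  rw [combPairing_tfShift]
  simp_rw [mul_assoc]
  rw [sexp_sub_comm b κ z.1, sexp_sub_comm b κ z.2, mul_comm (sexp b κ (ζ.1 - z.1))]
  exact h1

theorem enorm_integral_mul_le_lintegral {f k : ℝ × ℝ → ℂ} {K : ℝ × ℝ → ℝ}
    (hk : ∀ z, ‖k z‖ ≤ K z) : ‖∫ z, f z * k z‖ₑ ≤ ∫⁻ z, ‖f z‖ₑ * ENNReal.ofReal (K z) := by
  refine (enorm_integral_le_lintegral_enorm _).trans (lintegral_mono fun z => ?_)
  rw [enorm_mul]
  gcongr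
  rw [← ofReal_norm]
  exact ENNReal.ofReal_le_ofReal (hk z)

theorem continuous_combFun_right (ha : 0 < a) (hb : 0 < b) (hb1 : b ≤ 1) {A : 𝓢(ℝ, ℂ)}
    (hA : IsSubexp b A) (hc : ∀ n, ‖c n‖ ≤ Γ) (θ : ℝ) : Continuous (combFun a c A θ) :=
  (continuous_combFun ha hb hb1 hA hc).comp (Continuous.prodMk_right θ)

theorem measurable_integral_combFun (ha : 0 < a) (hb : 0 < b) (hb1 : b ≤ 1)
    (hc : ∀ n, ‖c n‖ ≤ Γ) {A h : 𝓢(ℝ, ℂ)} (hA : IsSubexp b A) :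
    Measurable fun p : (ℝ × ℝ) × (ℝ × ℝ) => ∫ x, combFun a c A p.2.2 x * h (x - p.2.1) *
      (gaussianWindow (x - p.1.1) * ec (-(x * p.1.2))) := by
  refine StronglyMeasurable.measurable (StronglyMeasurable.integral_prod_right
    (f := fun (p : (ℝ × ℝ) × (ℝ × ℝ)) (x : ℝ) => combFun a c A p.2.2 x * h (x - p.2.1) *
      (gaussianWindow (x - p.1.1) * ec (-(x * p.1.2)))) ?_)
  have h0 := continuous_combFun ha hb hb1 hA hc
  have h1 := h.continuous
  have h2 := gaussianWindow.continuous
  have h3 : Continuous fun q : ((ℝ × ℝ) × (ℝ × ℝ)) × ℝ => combFun a c A q.1.2.2 q.2 :=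
    h0.comp (f := fun q : ((ℝ × ℝ) × (ℝ × ℝ)) × ℝ => (q.1.2.2, q.2)) (by fun_prop)
  apply Continuous.stronglyMeasurable
  simp only [Function.uncurry_def]
  fun_prop

theorem measurable_combPairing_tfShift (ha : 0 < a) (hb : 0 < b) (hb1 : b ≤ 1)
    (hc : ∀ n, ‖c n‖ ≤ Γ) (hχ₁ : IsSubexp b χ₁) (χ₂ : 𝓢(ℝ, ℂ)) :
    Measurable (Function.uncurry fun ζ z : ℝ × ℝ =>
      combPairing a c χ₁ χ₂ (tfShift ζ.1 (-ζ.2) gaussianWindow) z) := by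
  simp only [Function.uncurry_def, combPairing_tfShift]
  exact measurable_integral_combFun (h := 𝓕⁻ χ₂) ha hb hb1 hc hχ₁

theorem integrable_one_add_pow_mul_sexp (hb : 0 < b) {κ : ℝ} (hκ : 0 < κ) (N : ℕ) (s : ℝ) :
    Integrable fun x => (1 + |x|) ^ N * sexp b κ (x - s) := by
  obtain ⟨C, hC, h⟩ := exists_rpow_mul_le_exp hb (half_pos hκ) N
  refine (((integrable_sexp hb (half_pos hκ)).comp_sub_right s).const_mul
    ((1 + |s|) ^ N * C)).mono' ?_ (ae_of_all _ fun x => ?_)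
  · have := continuous_sexp (b := b) (c := κ) hb
    exact Continuous.aestronglyMeasurable (by fun_prop)
  · rw [Real.norm_of_nonneg (mul_nonneg (by positivity) (sexp_nonneg _ _ _))]
    have h1 : 1 + |x| ≤ (1 + |s|) * (1 + |x - s|) := by
      have := abs_sub_abs_le_abs_sub x s
      nlinarith [abs_nonneg s, abs_nonneg (x - s)]
    have e := sexp_add_rate b (κ / 2) (κ / 2) (x - s)
    rw [add_halves] at e
    have n1 := sexp_nonneg b (κ / 2) (x - s)
    calc _ ≤ ((1 + |s|) * (1 + |x - s|)) ^ N * (sexp b (κ / 2) (x - s) * sexp b (κ / 2) (x - s)) := by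
          rw [e]; gcongr
      _ = (1 + |s|) ^ N * ((1 + |x - s|) ^ N * sexp b (κ / 2) (x - s)) * sexp b (κ / 2) (x - s) := by
          rw [mul_pow]; ring
      _ ≤ (1 + |s|) ^ N * C * sexp b (κ / 2) (x - s) := by
          gcongr
          exact h _

theorem IsPolyBounded.integrable_mul_sexp (hS : IsPolyBounded S) (hb : 0 < b) {κ : ℝ} (hκ : 0 < κ)
    (s t : ℝ) : Integrable fun z : ℝ × ℝ => ‖S z‖ * (sexp b κ (z.1 - s) * sexp b κ (z.2 - t)) := by
  obtain ⟨hSm, N, C, hC, hSb⟩ := hS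
  have h1 := (integrable_one_add_pow_mul_sexp hb hκ N s).mul_prod
    (integrable_one_add_pow_mul_sexp hb hκ N t)
  refine (h1.const_mul C).mono' ?_ (ae_of_all _ fun z => ?_)
  · have := continuous_sexp (b := b) (c := κ) hb
    have h2 : Measurable fun z : ℝ × ℝ => sexp b κ (z.1 - s) * sexp b κ (z.2 - t) :=
      Continuous.measurable (by fun_prop)
    exact (hSm.norm.mul h2).aestronglyMeasurable
  · have n1 := sexp_nonneg b κ (z.1 - s)
    have n2 := sexp_nonneg b κ (z.2 - t)
    rw [Real.norm_of_nonneg (mul_nonneg (norm_nonneg _) (mul_nonneg n1 n2))]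
    have hz : 1 + ‖z‖ ≤ (1 + |z.1|) * (1 + |z.2|) := by
      have : ‖z‖ ≤ ‖z.1‖ + ‖z.2‖ := by
        rw [Prod.norm_def]
        exact max_le_add_of_nonneg (norm_nonneg _) (norm_nonneg _)
      simp only [Real.norm_eq_abs] at this
      nlinarith [abs_nonneg z.1, abs_nonneg z.2]
    calc _ ≤ (C * (1 + ‖z‖) ^ N) * (sexp b κ (z.1 - s) * sexp b κ (z.2 - t)) := by
          gcongr; exact hSb z
      _ ≤ (C * ((1 + |z.1|) * (1 + |z.2|)) ^ N) * (sexp b κ (z.1 - s) * sexp b κ (z.2 - t)) := by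
          gcongr
      _ = _ := by rw [mul_pow]; ring

/-- Pairings with modulated lattice sums are controlled by the short-time Fourier transform. -/
theorem exists_enorm_integral_combPairing_le (ha : 0 < a) (hb : 0 < b) (hb1 : b ≤ 1)
    (hc : ∀ n, ‖c n‖ ≤ Γ) (hd : ∀ n, ‖d n‖ ≤ Δ) (hχ₁ : IsSubexp b χ₁) (hχ₂ : IsSubexp b χ₂)
    (hψ₁ : IsSubexp b ψ₁) (hψ₂ : IsSubexp b ψ₂) :
    ∃ κ C : ℝ, 0 < κ ∧ 0 < C ∧ ∀ (S V : ℝ × ℝ → ℂ), IsPolyBounded S →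
      (∀ ζ, V ζ = ∫ z, S z * combPairing a c χ₁ χ₂ (tfShift ζ.1 (-ζ.2) gaussianWindow) z) →
      ∀ θ x₀ : ℝ,
      ‖∫ z, S z * combPairing a c χ₁ χ₂ (fun x => combFun a d ψ₁ θ x * 𝓕 ψ₂ (x - x₀)) z‖ₑ ≤
        ∫⁻ ζ, ‖V ζ‖ₑ * ENNReal.ofReal (C * (sexp b κ (ζ.1 - x₀) * sexp b κ (ζ.2 + θ))) := by
  obtain ⟨κ₁, C₁, hκ₁, hC₁, h₁⟩ := exists_norm_combPairing_tfShift_le ha hb hb1 hc hχ₁ hχ₂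
  obtain ⟨κ₂, C₂, hκ₂, hC₂, h₂⟩ := exists_norm_integral_combFun_le ha hb hb1 hψ₁
    (isSubexp_gaussianWindow hb hb1) hψ₂.fourier hd
  set κ := min κ₁ κ₂
  have hκ : 0 < κ := lt_min hκ₁ hκ₂
  refine ⟨κ, C₂, hκ, hC₂, fun S V hS hV θ x₀ => ?_⟩
  set k : ℝ × ℝ → ℝ × ℝ → ℂ := fun ζ z =>
    combPairing a c χ₁ χ₂ (tfShift ζ.1 (-ζ.2) gaussianWindow) z with hk
  -- Up to the sign of the frequency, the short-time Fourier transform of the test function. It is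
  -- concentrated at time `x₀` and frequency `-θ`.
  set A : ℝ × ℝ → ℂ := fun ζ =>
    ∫ x, combFun a d ψ₁ θ x * 𝓕 ψ₂ (x - x₀) * (gaussianWindow (x - ζ.1) * ec (x * ζ.2)) with hA
  have hkb : ∀ ζ z, ‖k ζ z‖ ≤ C₁ * (sexp b κ (z.1 - ζ.1) * sexp b κ (z.2 - ζ.2)) := by
    intro ζ z
    refine (h₁ ζ z).trans (mul_le_mul_of_nonneg_left (mul_le_mul (sexp_anti (min_le_left _ _) _)
      (sexp_anti (min_le_left _ _) _) (sexp_nonneg _ _ _) (sexp_nonneg _ _ _)) hC₁.le)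
  have hAb : ∀ ζ, ‖A ζ‖ ≤ C₂ * (sexp b κ (ζ.1 - x₀) * sexp b κ (ζ.2 + θ)) := by
    intro ζ
    have h3 := h₂ θ ζ.1 x₀ (-ζ.2)
    rw [show -ζ.2 - θ = -(ζ.2 + θ) by ring, sexp_neg, mul_comm (sexp b κ₂ (ζ.2 + θ))] at h3
    have e : A ζ = ∫ x, combFun a d ψ₁ θ x *
        (𝓕 ψ₂ (x - x₀) * (gaussianWindow (x - ζ.1) * ec (-(x * -ζ.2)))) := by
      refine integral_congr_ae (ae_of_all _ fun x => ?_)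
      simp only
      rw [mul_neg, neg_neg, mul_assoc]
    rw [e]
    refine h3.trans (mul_le_mul_of_nonneg_left (mul_le_mul (sexp_anti (min_le_right _ _) _)
      (sexp_anti (min_le_right _ _) _) (sexp_nonneg _ _ _) (sexp_nonneg _ _ _)) hC₂.le)
  have hkm : Measurable (Function.uncurry k) :=
    measurable_combPairing_tfShift ha hb hb1 hc hχ₁ χ₂
  have hAm : Measurable A := by
    have h3 := (measurable_integral_combFun (h := 𝓕 ψ₂) ha hb hb1 hd hψ₁).comp
      (f := fun ζ : ℝ × ℝ => ((ζ.1, -ζ.2), (x₀, θ))) (by fun_prop)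
    have e : A = (fun p : (ℝ × ℝ) × (ℝ × ℝ) => ∫ x, combFun a d ψ₁ p.2.2 x * 𝓕 ψ₂ (x - p.2.1) *
        (gaussianWindow (x - p.1.1) * ec (-(x * p.1.2)))) ∘
        fun ζ : ℝ × ℝ => ((ζ.1, -ζ.2), (x₀, θ)) := by
      ext ζ
      simp only [hA, Function.comp_apply, mul_neg, neg_neg]
    rw [e]
    exact h3
  have hsi : ∀ {r : ℝ}, 0 < r → ∀ s t : ℝ,
      Integrable fun ζ : ℝ × ℝ => sexp b r (ζ.1 - s) * sexp b r (ζ.2 + t) := fun hr s t =>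
    ((integrable_sexp hb hr).comp_sub_right s).mul_prod ((integrable_sexp hb hr).comp_add_right t)
  have hAi : Integrable A :=
    ((hsi hκ x₀ θ).const_mul C₂).mono' hAm.aestronglyMeasurable (ae_of_all _ hAb)
  have hkb' : ∀ ζ z, ‖k ζ z‖ ≤ C₁ := fun ζ z => (hkb ζ z).trans
    (mul_le_of_le_one_right hC₁.le (mul_le_one₀ (sexp_le_one hκ.le _) (sexp_nonneg _ _ _)
      (sexp_le_one hκ.le _)))
  have hAfib : ∀ t, Integrable fun ν => A (t, ν) := by
    intro t
    have h3 : Integrable fun ν => C₂ * (sexp b κ (t - x₀) * sexp b κ (ν + θ)) :=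
      (((integrable_sexp hb hκ).comp_add_right θ).const_mul _).const_mul C₂
    have h4 : Measurable fun ν => A (t, ν) :=
      Measurable.comp (g := A) (f := fun ν => (t, ν)) hAm (by fun_prop)
    exact h3.mono' h4.aestronglyMeasurable (ae_of_all _ fun ν => hAb (t, ν))
  obtain ⟨D₁, hD₁, hD₁b⟩ := exists_norm_combFun_le ha hb hb1 hψ₁ hd
  obtain ⟨D₂, hD₂, hD₂b⟩ := exists_norm_combFun_le ha hb hb1 hχ₁ hc
  -- Inversion writes the pairing with the test function as a superposition of pairings with shifted
  -- Gaussians.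
  have hAk : ∀ z, ∫ ζ, A ζ * k ζ z =
      combPairing a c χ₁ χ₂ (fun x => combFun a d ψ₁ θ x * 𝓕 ψ₂ (x - x₀)) z := by
    intro z
    have c1 := continuous_combFun_right ha hb hb1 hψ₁ hd θ
    have c2 := continuous_combFun_right ha hb hb1 hχ₁ hc z.2
    have c3 := (𝓕 ψ₂).continuous
    have c4 := (𝓕⁻ χ₂).continuous
    have hkz : Measurable fun ζ => k ζ z :=
      Measurable.comp (g := Function.uncurry k) (f := fun ζ => (ζ, z)) hkm (by fun_prop)
    have c5 : Integrable fun x => 𝓕 ψ₂ (x - x₀) :=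
      ((𝓕 ψ₂).integrable (μ := volume)).comp_sub_right x₀
    have c6 : Integrable fun x => combFun a d ψ₁ θ x * 𝓕 ψ₂ (x - x₀) :=
      c5.bdd_mul (f := combFun a d ψ₁ θ) (c := D₁) c1.aestronglyMeasurable
        (ae_of_all _ fun x => hD₁b θ x)
    have hAki : Integrable fun ζ => A ζ * k ζ z :=
      hAi.mul_bdd hkz.aestronglyMeasurable (ae_of_all _ fun ζ => hkb' ζ z)
    have e : ∀ ζ, k ζ z = ∫ x, combFun a c χ₁ z.2 x * 𝓕⁻ χ₂ (x - z.1) *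
        (gaussianWindow (x - ζ.1) * ec (-(x * ζ.2))) := fun ζ => combPairing_tfShift ζ z
    simp_rw [e] at hAki ⊢
    have h3 := stft_inversion (Θ := fun x => combFun a d ψ₁ θ x * 𝓕 ψ₂ (x - x₀))
      (W := fun x => combFun a c χ₁ z.2 x * 𝓕⁻ χ₂ (x - z.1))
      (B := D₂ * schNorm (0, 0) (𝓕⁻ χ₂)) (by fun_prop)
      c6 (by fun_prop)
      (fun x => by
        rw [norm_mul]
        exact mul_le_mul (hD₂b _ _) (norm_le_schNorm _ _) (norm_nonneg _) hD₂.le)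
      hAfib hAki
    refine h3.trans (integral_congr_ae (ae_of_all _ fun x => ?_))
    simp only
    ring
  -- `S` may grow polynomially, so decay in `z` around a fixed point is needed. It is obtained from
  -- decay in `z - ζ` and in `ζ` around `(x₀, -θ)` by giving up half of the rate.
  have hint : Integrable (fun p : (ℝ × ℝ) × (ℝ × ℝ) => S p.1 * (A p.2 * k p.2 p.1)) := by
    have h3 := (hS.integrable_mul_sexp hb (half_pos hκ) x₀ (-θ)).mul_prod (hsi (half_pos hκ) x₀ θ)
    refine (h3.const_mul (C₁ * C₂)).mono' ?_ (ae_of_all _ fun p => ?_)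
    · exact ((hS.measurable.comp measurable_fst).mul ((hAm.comp measurable_snd).mul
        (hkm.comp measurable_swap))).aestronglyMeasurable
    · obtain ⟨z, ζ⟩ := p
      simp only [norm_mul]
      have key : ∀ x y s : ℝ, sexp b κ (y - s) * sexp b κ (x - y) ≤
          sexp b (κ / 2) (x - s) * sexp b (κ / 2) (y - s) := by
        intro x y s
        have h4 := sexp_mul_sexp_shift_le hb hb1 hκ.le (s - x) (y - s)
        rwa [show y - s + (s - x) = y - x by ring, sexp_sub_comm b κ y x,
          sexp_sub_comm b (κ / 2) s x] at h4
      have k1 := key z.1 ζ.1 x₀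
      have k2 := key z.2 ζ.2 (-θ)
      simp only [sub_neg_eq_add] at k2
      have n := sexp_nonneg b κ
      have n' := sexp_nonneg b (κ / 2)
      calc _ ≤ ‖S z‖ * ((C₂ * (sexp b κ (ζ.1 - x₀) * sexp b κ (ζ.2 + θ))) *
            (C₁ * (sexp b κ (z.1 - ζ.1) * sexp b κ (z.2 - ζ.2)))) :=
            mul_le_mul_of_nonneg_left (mul_le_mul (hAb ζ) (hkb ζ z) (norm_nonneg _)
              (mul_nonneg hC₂.le (mul_nonneg (n _) (n _)))) (norm_nonneg _)
        _ = ‖S z‖ * (C₁ * C₂) * ((sexp b κ (ζ.1 - x₀) * sexp b κ (z.1 - ζ.1)) *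
            (sexp b κ (ζ.2 + θ) * sexp b κ (z.2 - ζ.2))) := by ring
        _ ≤ ‖S z‖ * (C₁ * C₂) * ((sexp b (κ / 2) (z.1 - x₀) * sexp b (κ / 2) (ζ.1 - x₀)) *
            (sexp b (κ / 2) (z.2 + θ) * sexp b (κ / 2) (ζ.2 + θ))) :=
            mul_le_mul_of_nonneg_left (mul_le_mul k1 k2 (mul_nonneg (n _) (n _))
              (mul_nonneg (n' _) (n' _))) (by positivity)
        _ = _ := by rw [sub_neg_eq_add]; ring
  have key : ∫ z, S z * combPairing a c χ₁ χ₂ (fun x => combFun a d ψ₁ θ x * 𝓕 ψ₂ (x - x₀)) z =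
      ∫ ζ, V ζ * A ζ := by
    simp_rw [← hAk, ← integral_const_mul]
    rw [integral_integral_swap (by exact hint)]
    refine integral_congr_ae (ae_of_all _ fun ζ => ?_)
    simp only
    rw [hV, ← integral_mul_const]
    refine integral_congr_ae (ae_of_all _ fun z => ?_)
    simp only [hk]
    ring
  rw [key]
  exact enorm_integral_mul_le_lintegral hAb

end Response

/-! ### Reconstruction of the symbol -/

/-- Translating the test function by `z₀` multiplies its transform by a character, which does not
enlarge the support. -/
theorem regularize_eq_zero_of_disjoint (σ : 𝓢'(ℝ × ℝ, ℂ)) {Ψ : 𝓢(ℝ × ℝ, ℂ)}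
    (h : Disjoint (tsupport Ψ) (Distribution.dsupport (symplecticFourier σ))) (z₀ : ℝ × ℝ) :
    regularize σ (symplecticFourierTest Ψ) z₀ = 0 := by
  set Φ := compSubConstCLM ℂ z₀ (symplecticFourierTest Ψ) with hΦ
  have e : ∀ y : ℝ × ℝ, symplecticFourierTest Φ y = ec (y.2 * z₀.1 - z₀.2 * y.1) * Ψ y := by
    rintro ⟨x, ξ⟩
    rw [symplecticFourierTest_eq_ec, ← integral_add_right_eq_self _ z₀]
    conv_rhs => rw [← symplecticFourierTest_symplecticFourierTest Ψ, symplecticFourierTest_eq_ec]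
    rw [← integral_const_mul]
    refine integral_congr_ae (ae_of_all _ fun z => ?_)
    simp only [hΦ, compSubConstCLM_apply, add_sub_cancel_right, Prod.fst_add, Prod.snd_add]
    rw [← mul_assoc, ← ec_add]
    ring_nf
  have h1 : symplecticFourier σ (symplecticFourierTest Φ) = 0 := by
    refine apply_eq_zero_of_disjoint_dsupport _ _ (h.mono_left (closure_mono fun y hy => ?_))
    rw [Function.mem_support, e] at hy
    exact right_ne_zero_of_mul hy
  rwa [symplecticFourier_apply, symplecticFourierTest_symplecticFourierTest] at h1

theorem IsPolyBounded.integrable_mul {S : ℝ × ℝ → ℂ} (hS : IsPolyBounded S) (ψ : 𝓢(ℝ × ℝ, ℂ)) :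
    Integrable fun z => S z * ψ z := by
  obtain ⟨hSm, N, C, hC, hSb⟩ := hS
  refine ((integrable_one_add_pow_mul_norm volume N ψ).const_mul C).mono'
    (hSm.mul ψ.continuous.measurable).aestronglyMeasurable (ae_of_all _ fun z => ?_)
  rw [norm_mul, ← mul_assoc]
  gcongr
  exact hSb z

theorem fourierInv_tfShift_zero (P : 𝓢(ℝ, ℂ)) (s w : ℝ) :
    𝓕⁻ (tfShift 0 s P) w = 𝓕⁻ P (w + s) := by
  rw [fourierInv_apply_eq_fourier_neg, fourierInv_apply_eq_fourier_neg, ← neg_neg s,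
    fourier_tfShift_zero]
  ring_nf

theorem tfShift_zero_zero (P : 𝓢(ℝ, ℂ)) : tfShift 0 0 P = P := by
  ext x
  rw [tfShift_eq_ec]
  simp

section Reconstruction

variable {a b : ℝ} {c d : ℤ → ℂ} {χ₁ χ₂ ψ₁ ψ₂ : 𝓢(ℝ, ℂ)} {J₁ J₂ : Finset ℤ}
  {σ : 𝓢'(ℝ × ℝ, ℂ)} {S : ℝ × ℝ → ℂ} {L : ℕ} {Λ : Finset (ℤ × ℤ)} {M : Set (ℝ × ℝ)}

/-- The part of the symbol belonging to a pair of bumps. -/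
def symbolPart (σ : 𝓢'(ℝ × ℝ, ℂ)) (P Q : 𝓢(ℝ, ℂ)) (z : ℝ × ℝ) : ℂ :=
  regularize σ (symplecticFourierTest (tensor P Q)) z

theorem integral_mul_fourier_eq_symbolPart (hσ : ∀ ψ, σ ψ = ∫ z, S z * ψ z) (P Q : 𝓢(ℝ, ℂ))
    (s : ℝ) (z₀ : ℝ × ℝ) :
    ∫ z, S z * (𝓕⁻ P (z.2 - z₀.2 + s) * 𝓕 Q (z.1 - z₀.1)) =
      symbolPart σ (tfShift 0 s P) Q z₀ := by
  rw [symbolPart, regularize, hσ]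
  refine integral_congr_ae (ae_of_all _ fun z => ?_)
  simp only [compSubConstCLM_apply, symplecticFourierTest_tensor, fourierInv_tfShift_zero,
    Prod.fst_sub, Prod.snd_sub]
  ring

theorem integrable_mul_fourier (hS : IsPolyBounded S) (P Q : 𝓢(ℝ, ℂ)) (s : ℝ) (z₀ : ℝ × ℝ) :
    Integrable fun z => S z * (𝓕⁻ P (z.2 - z₀.2 + s) * 𝓕 Q (z.1 - z₀.1)) := by
  refine (hS.integrable_mul (compSubConstCLM ℂ z₀ (symplecticFourierTest
    (tensor (tfShift 0 s P) Q)))).congr (ae_of_all _ fun z => ?_)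
  simp only [compSubConstCLM_apply, symplecticFourierTest_tensor, fourierInv_tfShift_zero,
    Prod.fst_sub, Prod.snd_sub]
  ring

/-- The modulation of the test function is chosen so that for `j = m` the frequency shifts cancel
and the piece is evaluated exactly at `z₀`. For `j ≠ m` a modulation of the bump remains, which does
not affect its support. -/
theorem integral_mul_combPairing_eq (ha : 0 < a) (hb : 0 < b) (hb1 : b ≤ 1) (hL : 0 < L)
    (hc : Function.Periodic c L) (hd : Function.Periodic d L)
    (h₁ : IsLatticePartition b a ψ₁ χ₁ J₁) (h₂ : IsLatticePartition b (L * a)⁻¹ ψ₂ χ₂ J₂)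
    (hS : IsPolyBounded S) (hσ : ∀ ψ, σ ψ = ∫ z, S z * ψ z) (m : ℤ) (z₀ : ℝ × ℝ) :
    ∫ z, S z * combPairing a c χ₁ χ₂ (fun x =>
        combFun a d ψ₁ (-(z₀.2 + m * (L * a)⁻¹)) x * 𝓕 ψ₂ (x - z₀.1)) z =
      ((L * a)⁻¹ : ℝ) * ∑ k ∈ J₁, ∑ j ∈ J₂,
        (∑ r ∈ Finset.range L, c r * d (r + k) * ec (j * r / L)) *
        (ec (-(-(z₀.2 + m * (L * a)⁻¹) * (k * a))) * ec (-(j * (L * a)⁻¹ * z₀.1)) *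
          symbolPart σ (tfShift 0 ((j - m) * (L * a)⁻¹) (mulS χ₁ (compSubConstCLM ℂ (k * a) ψ₁)))
            (mulS χ₂ (compSubConstCLM ℂ (j * (L * a)⁻¹) ψ₂)) z₀) := by
  set q : ℤ → ℤ → ℂ := fun k j => ((L * a)⁻¹ : ℝ) *
    ((∑ r ∈ Finset.range L, c r * d (r + k) * ec (j * r / L)) *
      (ec (-(-(z₀.2 + m * (L * a)⁻¹) * (k * a))) * ec (-(j * (L * a)⁻¹ * z₀.1)))) with hq
  have e : ∀ z, S z * combPairing a c χ₁ χ₂ (fun x =>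
        combFun a d ψ₁ (-(z₀.2 + m * (L * a)⁻¹)) x * 𝓕 ψ₂ (x - z₀.1)) z =
      ∑ k ∈ J₁, ∑ j ∈ J₂, q k j * (S z * (𝓕⁻ (mulS χ₁ (compSubConstCLM ℂ (k * a) ψ₁))
        (z.2 - z₀.2 + (j - m) * (L * a)⁻¹) *
        𝓕 (mulS χ₂ (compSubConstCLM ℂ (j * (L * a)⁻¹) ψ₂)) (z.1 - z₀.1))) := by
    intro z
    rw [combPairing_combFun ha hb hb1 hL hc hd h₁ h₂, Finset.mul_sum, Finset.mul_sum]
    refine Finset.sum_congr rfl fun k _ => ?_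
    rw [Finset.mul_sum, Finset.mul_sum]
    refine Finset.sum_congr rfl fun j _ => ?_
    rw [show z.2 + -(z₀.2 + m * (L * a)⁻¹) + j * (L * a)⁻¹ =
      z.2 - z₀.2 + (j - m) * (L * a)⁻¹ by ring, hq]
    ring
  have hi : ∀ k j : ℤ, Integrable fun z => q k j * (S z *
      (𝓕⁻ (mulS χ₁ (compSubConstCLM ℂ (k * a) ψ₁)) (z.2 - z₀.2 + (j - m) * (L * a)⁻¹) *
        𝓕 (mulS χ₂ (compSubConstCLM ℂ (j * (L * a)⁻¹) ψ₂)) (z.1 - z₀.1))) := fun k j =>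
    (integrable_mul_fourier hS _ _ _ z₀).const_mul _
  simp_rw [e]
  rw [integral_finsetSum _ fun k _ => integrable_finsetSum _ fun j _ => hi k j, Finset.mul_sum]
  refine Finset.sum_congr rfl fun k _ => ?_
  rw [integral_finsetSum _ fun j _ => hi k j, Finset.mul_sum]
  refine Finset.sum_congr rfl fun j _ => ?_
  rw [integral_const_mul, integral_mul_fourier_eq_symbolPart hσ, hq]
  ring

/-- A piece whose closed box of one grid step around its centre misses `M` contributes nothing,
whatever the modulation `s`. -/
theorem symbolPart_eq_zero (h₁ : IsLatticePartition b a ψ₁ χ₁ J₁) {a₂ : ℝ}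
    (h₂ : IsLatticePartition b a₂ ψ₂ χ₂ J₂)
    (hσM : Distribution.dsupport (symplecticFourier σ) ⊆ M) {k j : ℤ}
    (hM : ∀ z ∈ M, a < |z.1 - k * a| ∨ a₂ < |z.2 - j * a₂|) (s : ℝ) (z₀ : ℝ × ℝ) :
    symbolPart σ (tfShift 0 s (mulS χ₁ (compSubConstCLM ℂ (k * a) ψ₁)))
      (mulS χ₂ (compSubConstCLM ℂ (j * a₂) ψ₂)) z₀ = 0 := by
  refine regularize_eq_zero_of_disjoint σ (Disjoint.mono_right hσM ?_) z₀
  have hcl : IsClosed {z : ℝ × ℝ | |z.1 - k * a| ≤ a ∧ |z.2 - j * a₂| ≤ a₂} :=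
    (isClosed_le (f := fun z : ℝ × ℝ => |z.1 - k * a|) (g := fun _ => a) (by fun_prop)
      (by fun_prop)).inter (isClosed_le (f := fun z : ℝ × ℝ => |z.2 - j * a₂|) (g := fun _ => a₂)
      (by fun_prop) (by fun_prop))
  have hsub : tsupport (tensor (tfShift 0 s (mulS χ₁ (compSubConstCLM ℂ (k * a) ψ₁)))
      (mulS χ₂ (compSubConstCLM ℂ (j * a₂) ψ₂))) ⊆
      {z : ℝ × ℝ | |z.1 - k * a| ≤ a ∧ |z.2 - j * a₂| ≤ a₂} := by
    refine closure_minimal (fun z hz => ?_) hcl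
    simp only [Function.mem_support, tensor_apply, tfShift_eq_ec, mulS_apply,
      compSubConstCLM_apply, sub_zero] at hz
    constructor <;> by_contra h <;> refine hz ?_
    · rw [h₁.bump_eq_zero _ (not_le.mp h).le]; simp
    · rw [h₂.bump_eq_zero _ (not_le.mp h).le]; simp
  refine Set.disjoint_left.mpr fun z hz hzM => ?_
  have h3 := hsub hz
  rcases hM z hzM with h | h
  · exact absurd h3.1 (not_le.mpr h)
  · exact absurd h3.2 (not_le.mpr h)

theorem sum_symbolPart (h₁ : IsLatticePartition b a ψ₁ χ₁ J₁) {a₂ : ℝ}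
    (h₂ : IsLatticePartition b a₂ ψ₂ χ₂ J₂) (σ : 𝓢'(ℝ × ℝ, ℂ)) (z₀ : ℝ × ℝ) :
    ∑ k ∈ J₁, ∑ j ∈ J₂, symbolPart σ (mulS χ₁ (compSubConstCLM ℂ (k * a) ψ₁))
      (mulS χ₂ (compSubConstCLM ℂ (j * a₂) ψ₂)) z₀ = symbolPart σ χ₁ χ₂ z₀ := by
  have e : tensor χ₁ χ₂ = ∑ k ∈ J₁, ∑ j ∈ J₂,
      tensor (mulS χ₁ (compSubConstCLM ℂ (k * a) ψ₁))
        (mulS χ₂ (compSubConstCLM ℂ (j * a₂) ψ₂)) := by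
    ext z
    simp only [sum_apply, tensor_apply, mulS_apply, compSubConstCLM_apply]
    rw [← Finset.sum_mul_sum, h₁.sum_eq, h₂.sum_eq]
  simp only [symbolPart, regularize, e, map_sum]

/-- Each `l ∈ Λ` has its own test function. Indices in `Λ` other than `l` are removed by duality and
indices outside `Λ` by support, so the integral isolates the piece at `l`; the unimodular prefactor
and `L a` undo the constants of the pairing formula. The pieces over `Λ` then add up to the whole.
-/
theorem symbolPart_eq_sum (ha : 0 < a) (hb : 0 < b) (hb1 : b ≤ 1) (hL : 0 < L)
    (hc : Function.Periodic c L) {d : ℤ × ℤ → ℤ → ℂ} (hd : ∀ l, Function.Periodic (d l) L)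
    (hdual : ∀ l₀ ∈ Λ, ∀ l ∈ Λ, ∑ r ∈ Finset.range L, c r * d l₀ (r + l.1) * ec (l.2 * r / L) =
      if l = l₀ then 1 else 0)
    (h₁ : IsLatticePartition b a ψ₁ χ₁ J₁) (h₂ : IsLatticePartition b (L * a)⁻¹ ψ₂ χ₂ J₂)
    (hS : IsPolyBounded S) (hσ : ∀ ψ, σ ψ = ∫ z, S z * ψ z)
    (hσM : Distribution.dsupport (symplecticFourier σ) ⊆ M)
    (hM : ∀ l ∉ Λ, ∀ z ∈ M, a < |z.1 - l.1 * a| ∨ (L * a)⁻¹ < |z.2 - l.2 * (L * a)⁻¹|)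
    (z₀ : ℝ × ℝ) :
    symbolPart σ χ₁ χ₂ z₀ = ∑ l ∈ Λ, ((L * a : ℝ) * (ec (-(z₀.2 + l.2 * (L * a)⁻¹) * (l.1 * a)) *
      ec (l.2 * (L * a)⁻¹ * z₀.1))) * ∫ z, S z * combPairing a c χ₁ χ₂ (fun x =>
        combFun a (d l) ψ₁ (-(z₀.2 + l.2 * (L * a)⁻¹)) x * 𝓕 ψ₂ (x - z₀.1)) z := by
  have hLa : ((L * a : ℝ) : ℂ) ≠ 0 := by
    have : (0 : ℝ) < L := by exact_mod_cast hL
    rw [Complex.ofReal_ne_zero]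
    positivity
  set R : ℤ × ℤ → ℂ := fun l => symbolPart σ (mulS χ₁ (compSubConstCLM ℂ (l.1 * a) ψ₁))
      (mulS χ₂ (compSubConstCLM ℂ (l.2 * (L * a)⁻¹) ψ₂)) z₀ with hR
  have hR0 : ∀ l ∉ Λ, R l = 0 := by
    intro l hl
    have h := symbolPart_eq_zero h₁ h₂ hσM (hM l hl) 0 z₀
    rwa [tfShift_zero_zero] at h
  have hterm : ∀ l ∈ Λ, ((L * a : ℝ) * (ec (-(z₀.2 + l.2 * (L * a)⁻¹) * (l.1 * a)) *
      ec (l.2 * (L * a)⁻¹ * z₀.1))) * ∫ z, S z * combPairing a c χ₁ χ₂ (fun x =>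
        combFun a (d l) ψ₁ (-(z₀.2 + l.2 * (L * a)⁻¹)) x * 𝓕 ψ₂ (x - z₀.1)) z =
      ∑ l' ∈ J₁ ×ˢ J₂, if l' = l then R l' else 0 := by
    intro l hl
    rw [integral_mul_combPairing_eq ha hb hb1 hL hc (hd l) h₁ h₂ hS hσ, ← Finset.sum_product',
      Complex.ofReal_inv, mul_mul_mul_comm, mul_inv_cancel₀ hLa, one_mul, Finset.mul_sum]
    refine Finset.sum_congr rfl fun l' _ => ?_
    by_cases hl' : l' ∈ Λ
    · rw [hdual l hl l' hl']
      split_ifs with h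
      · subst h
        rw [sub_self, zero_mul, tfShift_zero_zero, one_mul]
        have e1 := ec_neg_mul_self (-(z₀.2 + l'.2 * (L * a)⁻¹) * (l'.1 * a))
        have e2 := ec_neg_mul_self (l'.2 * (L * a)⁻¹ * z₀.1)
        have h0 : R l' = symbolPart σ (mulS χ₁ (compSubConstCLM ℂ (l'.1 * a) ψ₁))
          (mulS χ₂ (compSubConstCLM ℂ (l'.2 * (L * a)⁻¹) ψ₂)) z₀ := rfl
        rw [← h0]
        linear_combination (R l' * (ec (-(l'.2 * (L * a)⁻¹ * z₀.1)) *
          ec (l'.2 * (L * a)⁻¹ * z₀.1))) * e1 + R l' * e2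
      · ring
    · rw [symbolPart_eq_zero h₁ h₂ hσM (hM l' hl')]
      split_ifs with h
      · rw [hR0 l' hl']; ring
      · ring
  rw [Finset.sum_congr rfl hterm, Finset.sum_comm, ← sum_symbolPart h₁ h₂, ← Finset.sum_product']
  refine Finset.sum_congr rfl fun l _ => ?_
  rw [Finset.sum_ite_eq]
  split_ifs with h
  · rfl
  · exact hR0 l h

end Reconstruction

/-! ### Identification by a weighted delta train -/

theorem exists_pos_forall_le {ι : Type*} (s : Finset ι) {f : ι → ℝ} (hf : ∀ i, 0 < f i) :
    ∃ κ : ℝ, 0 < κ ∧ ∀ i ∈ s, κ ≤ f i := by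
  classical
  induction s using Finset.induction_on with
  | empty => exact ⟨1, one_pos, by simp⟩
  | insert i s hi ih =>
    obtain ⟨κ, hκ, h⟩ := ih
    refine ⟨min (f i) κ, lt_min (hf i) hκ, fun j hj => ?_⟩
    rcases Finset.mem_insert.mp hj with rfl | hj
    · exact min_le_left _ _
    · exact (min_le_right _ _).trans (h j hj)

section Identification

variable {a b : ℝ} {c : ℤ → ℂ} {d : ℤ × ℤ → ℤ → ℂ} {χ₁ χ₂ ψ₁ ψ₂ : 𝓢(ℝ, ℂ)} {J₁ J₂ : Finset ℤ}
  {L : ℕ} {Λ : Finset (ℤ × ℤ)} {M : Set (ℝ × ℝ)}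

/-- The reconstruction formula expresses the symbol at `z₀` by finitely many pairings, each
controlled by the transform of the response near `(z₀.1, z₀.2 + l.2 (L a)⁻¹)`. These frequency
offsets form a finite set and cost only the constants `e l`. -/
theorem exists_enorm_symbolPart_le (ha : 0 < a) (hb : 0 < b) (hb1 : b ≤ 1) (hL : 0 < L)
    (hc : Function.Periodic c L) (hd : ∀ l, Function.Periodic (d l) L)
    (hdual : ∀ l₀ ∈ Λ, ∀ l ∈ Λ, ∑ r ∈ Finset.range L, c r * d l₀ (r + l.1) * ec (l.2 * r / L) =
      if l = l₀ then 1 else 0)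
    (h₁ : IsLatticePartition b a ψ₁ χ₁ J₁) (h₂ : IsLatticePartition b (L * a)⁻¹ ψ₂ χ₂ J₂)
    (hM : ∀ l ∉ Λ, ∀ z ∈ M, a < |z.1 - l.1 * a| ∨ (L * a)⁻¹ < |z.2 - l.2 * (L * a)⁻¹|) :
    ∃ κ C : ℝ, 0 < κ ∧ 0 < C ∧ ∀ (σ : 𝓢'(ℝ × ℝ, ℂ)) (S V : ℝ × ℝ → ℂ), IsPolyBounded S →
      (∀ ψ, σ ψ = ∫ z, S z * ψ z) → Distribution.dsupport (symplecticFourier σ) ⊆ M →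
      (∀ ζ, V ζ = ∫ z, S z * combPairing a c χ₁ χ₂ (tfShift ζ.1 (-ζ.2) gaussianWindow) z) →
      ∀ z₀, ‖symbolPart σ χ₁ χ₂ z₀‖ₑ ≤
        ∫⁻ ζ, ‖V ζ‖ₑ * ENNReal.ofReal (C * (sexp b κ (ζ.1 - z₀.1) * sexp b κ (ζ.2 - z₀.2))) := by
  obtain ⟨Γ, hΓ⟩ := exists_norm_le_of_periodic hL hc
  choose Δ hΔ using fun l => exists_norm_le_of_periodic hL (hd l)
  choose κ C hκ hC h using fun l => exists_enorm_integral_combPairing_le ha hb hb1 hΓ (hΔ l)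
    h₁.isSubexp_cutoff h₂.isSubexp_cutoff h₁.isSubexp_bump h₂.isSubexp_bump
  obtain ⟨κ₀, hκ₀, hκle⟩ := exists_pos_forall_le Λ hκ
  have hLa : 0 < L * a := mul_pos (by exact_mod_cast hL) ha
  set e : ℤ × ℤ → ℝ := fun l => Real.exp (κ₀ * |-(l.2 * (L * a)⁻¹)| ^ b)
  set D := ∑ l ∈ Λ, C l * e l
  have hD : ∀ l ∈ Λ, C l * e l ≤ D := fun l hl =>
    Finset.single_le_sum (f := fun l => C l * e l)
      (fun l _ => mul_nonneg (hC l).le (Real.exp_pos _).le) hl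
  have hD0 : 0 ≤ D := Finset.sum_nonneg fun l _ => mul_nonneg (hC l).le (Real.exp_pos _).le
  refine ⟨κ₀, (L * a) * (Λ.card * D) + 1, hκ₀, by positivity, fun σ S V hS hσ hσM hV z₀ => ?_⟩
  have n0 := sexp_nonneg b κ₀
  set I := ∫⁻ ζ, ‖V ζ‖ₑ *
    ENNReal.ofReal (D * (sexp b κ₀ (ζ.1 - z₀.1) * sexp b κ₀ (ζ.2 - z₀.2))) with hI
  have hterm : ∀ l ∈ Λ, ‖((L * a : ℝ) * (ec (-(z₀.2 + l.2 * (L * a)⁻¹) * (l.1 * a)) *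
      ec (l.2 * (L * a)⁻¹ * z₀.1))) * ∫ z, S z * combPairing a c χ₁ χ₂ (fun x =>
        combFun a (d l) ψ₁ (-(z₀.2 + l.2 * (L * a)⁻¹)) x * 𝓕 ψ₂ (x - z₀.1)) z‖ₑ ≤
      ENNReal.ofReal (L * a) * I := by
    intro l hl
    rw [enorm_mul]
    refine mul_le_mul' (le_of_eq ?_) ((h l S V hS hV _ _).trans (lintegral_mono fun ζ => ?_))
    · rw [← ofReal_norm, norm_mul, norm_mul, norm_ec, norm_ec, Complex.norm_real,
        Real.norm_of_nonneg hLa.le, mul_one, mul_one]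
    · refine mul_le_mul' le_rfl (ENNReal.ofReal_le_ofReal ?_)
      have s1 : sexp b (κ l) (ζ.1 - z₀.1) ≤ sexp b κ₀ (ζ.1 - z₀.1) := sexp_anti (hκle l hl) _
      have s2 : sexp b (κ l) (ζ.2 + -(z₀.2 + l.2 * (L * a)⁻¹)) ≤
          e l * sexp b κ₀ (ζ.2 - z₀.2) := by
        refine (sexp_anti (hκle l hl) _).trans ?_
        rw [show ζ.2 + -(z₀.2 + l.2 * (L * a)⁻¹) = ζ.2 - z₀.2 + -(l.2 * (L * a)⁻¹) by ring]
        exact sexp_add_le hb hb1 hκ₀.le _ _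
      calc _ ≤ C l * (sexp b κ₀ (ζ.1 - z₀.1) * (e l * sexp b κ₀ (ζ.2 - z₀.2))) :=
            mul_le_mul_of_nonneg_left (mul_le_mul s1 s2 (sexp_nonneg _ _ _) (n0 _)) (hC l).le
        _ = (C l * e l) * (sexp b κ₀ (ζ.1 - z₀.1) * sexp b κ₀ (ζ.2 - z₀.2)) := by ring
        _ ≤ _ := mul_le_mul_of_nonneg_right (hD l hl) (mul_nonneg (n0 _) (n0 _))
  rw [symbolPart_eq_sum ha hb hb1 hL hc hd hdual h₁ h₂ hS hσ hσM hM z₀]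
  refine (enorm_sum_le _ _).trans ((Finset.sum_le_sum hterm).trans ?_)
  rw [Finset.sum_const, nsmul_eq_mul, ← mul_assoc, hI,
    ← lintegral_const_mul' _ _ (ENNReal.mul_ne_top (by simp) ENNReal.ofReal_ne_top)]
  refine lintegral_mono fun ζ => ?_
  rw [mul_left_comm, ← ENNReal.ofReal_natCast, ← ENNReal.ofReal_mul (by positivity),
    ← ENNReal.ofReal_mul (by positivity)]
  refine mul_le_mul' le_rfl (ENNReal.ofReal_le_ofReal ?_)
  have n1 : 0 ≤ sexp b κ₀ (ζ.1 - z₀.1) * sexp b κ₀ (ζ.2 - z₀.2) := mul_nonneg (n0 _) (n0 _)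
  nlinarith

/-- The image of a tempered distribution that is a limit of Schwartz functions, under an operator
with a transpose. -/
theorem isImage_precomp {H : 𝓢(ℝ, ℂ) →L[ℂ] 𝓢'(ℝ, ℂ)} {T : 𝓢(ℝ, ℂ) →L[ℂ] 𝓢(ℝ, ℂ)}
    {g : 𝓢'(ℝ, ℂ)} (hT : ∀ f φ, H f φ = ∫ y, f y * T φ y) (hg : ∃ f, BoundedWeakStarTendsto f g) :
    IsImage H g (PointwiseConvergenceCLM.precomp ℂ T g) := by
  refine ⟨hg, fun f hf => ?_⟩
  have h1 := hf.1
  rw [PointwiseConvergenceCLM.tendsto_iff_forall_tendsto] at h1 ⊢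
  intro φ
  refine (h1 (T φ)).congr fun k => ?_
  refine (SchwartzMap.toTemperedDistributionCLM_apply_apply (μ := volume) (f k) (T φ)).trans ?_
  rw [hT]
  refine integral_congr_ae (ae_of_all _ fun y => ?_)
  simp only [smul_eq_mul]
  ring

/-- Rounding a point of `M` to the grid gives an index within distance `1/2` in both coordinates,
which must lie in the finite set `Λ`; hence `M` is bounded. -/
theorem exists_bound_of_grid {K L : ℝ} (hK : 0 < K) (hL : 0 < L)
    (hM : ∀ l ∉ Λ, ∀ z ∈ M, 1 < |z.1 * K - l.1| ∨ 1 < |z.2 * L - l.2|) :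
    ∃ R : ℝ, ∀ z ∈ M, |z.1| < R ∧ |z.2| < R := by
  set B : ℝ := ∑ l ∈ Λ, (|(l.1 : ℝ)| + |(l.2 : ℝ)|)
  refine ⟨(B + 1) / K + (B + 1) / L + 1, fun z hz => ?_⟩
  have hl : (round (z.1 * K), round (z.2 * L)) ∈ Λ := by
    by_contra h
    have h1 := abs_sub_round (z.1 * K)
    have h2 := abs_sub_round (z.2 * L)
    rcases hM _ h z hz with h3 | h3
    · linarith
    · linarith
  have hB : |(round (z.1 * K) : ℝ)| + |(round (z.2 * L) : ℝ)| ≤ B :=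
    Finset.single_le_sum (f := fun l : ℤ × ℤ => |(l.1 : ℝ)| + |(l.2 : ℝ)|)
      (fun l _ => by positivity) hl
  have hB0 : 0 ≤ B := (by positivity : (0 : ℝ) ≤ _).trans hB
  have key : ∀ x r : ℝ, 0 < r → |(round (x * r) : ℝ)| ≤ B → |x| ≤ (B + 1) / r := by
    intro x r hr h
    rw [le_div_iff₀ hr, ← abs_of_pos hr, ← abs_mul]
    have h1 := abs_sub_round (x * r)
    have h2 := abs_sub_abs_le_abs_sub (x * r) (round (x * r))
    linarith
  have k1 := key z.1 K hK (by linarith [abs_nonneg (round (z.2 * L) : ℝ)])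
  have k2 := key z.2 L hL (by linarith [abs_nonneg (round (z.1 * K) : ℝ)])
  have n1 : 0 ≤ (B + 1) / K := by positivity
  have n2 : 0 ≤ (B + 1) / L := by positivity
  constructor <;> linarith

/-- All functions representing the symbol agree almost everywhere, so the infimum in the norm is
over a constant family. -/
theorem opwNorm_eq_mixedNorm {p q : ℝ≥0∞} {w : ℝ × ℝ → ℝ} {H : 𝓢(ℝ, ℂ) →L[ℂ] 𝓢'(ℝ, ℂ)}
    {s S : ℝ × ℝ → ℂ} (hs : IsGivenBy (symbol H) s)
    (hS : ∀ s', IsGivenBy (symbol H) s' → s' =ᵐ[volume] S) :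
    opwNorm p q w H = mixedNorm p q w S := by
  refine le_antisymm ((iInf₂_le s hs).trans (mixedNorm_congr_ae (hS s hs)).le) ?_
  exact le_iInf₂ fun s' hs' => (mixedNorm_congr_ae (hS s' hs')).ge

theorem isSymbol_symbol {H : 𝓢(ℝ, ℂ) →L[ℂ] 𝓢'(ℝ, ℂ)} (h : ∃ σ, IsSymbol H σ) :
    IsSymbol H (symbol H) := by
  rw [symbol, dif_pos h]
  exact h.choose_spec

/-- Operators with spreading support in a set of outer Jordan content less than one are
identifiable by a periodically weighted delta train. -/
theorem exists_isIdentifiableBy {v w : ℝ × ℝ → ℝ} (hv : IsSubexponential v) (hw : IsModerate v w)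
    (hM : outerContent M < 1) :
    ∃ K L : ℕ, 0 < K ∧ 0 < L ∧ ∃ (c : ℤ → ℂ) (g : 𝓢'(ℝ, ℂ)), Function.Periodic c L ∧
      IsDeltaSeries c (fun n => n * (K : ℝ)⁻¹) g ∧
      ∀ p q : ℝ≥0∞, 1 ≤ p → 1 ≤ q → IsIdentifiableBy p q w M g := by
  obtain ⟨K, L, Λ, k₀, R, hK, hL, hΛ, hcard, hinj, hgrid⟩ := exists_grid hM
  obtain ⟨c, d, hc, hd, hdual⟩ := exists_dual_sequences hL Λ k₀ R hΛ hcard hinj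
  obtain ⟨γ, Cv, β, hγ, hCv, hβ, hβ1, hvb⟩ := hv
  obtain ⟨b, hβb, hb, hb1, ψ, hψ, hsum, Cψ, cψ, hcψ, hCψ, hψF⟩ := exists_partition_fourier_decay hβ1
  have hψb : IsSubexp b ψ := IsSubexp.of_support hb hψ hcψ hCψ hψF
  have hK' : (0 : ℝ) < K := by exact_mod_cast hK
  have hL' : (0 : ℝ) < L := by exact_mod_cast hL
  obtain ⟨ρ, hρ⟩ := exists_bound_of_grid hK' (div_pos hL' hK') hgrid
  obtain ⟨ψ₁, χ₁, J₁, h₁, hχ₁⟩ := exists_isLatticePartition hb hb1.le hψ hsum hψb hK' ρ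
  obtain ⟨ψ₂, χ₂, J₂, h₂, hχ₂⟩ :=
    exists_isLatticePartition hb hb1.le hψ hsum hψb (div_pos hL' hK') ρ
  rw [div_eq_mul_inv] at h₂
  have ha : 0 < (K : ℝ)⁻¹ := inv_pos.mpr hK'
  set a : ℝ := (K : ℝ)⁻¹ with ha_def
  -- The separation of `M` from the other grid points, rescaled from index units to the steps `a`
  -- and `(L a)⁻¹`.
  have hMa : ∀ l ∉ Λ, ∀ z ∈ M, a < |z.1 - l.1 * a| ∨ (L * a)⁻¹ < |z.2 - l.2 * (L * a)⁻¹| := by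
    have key : ∀ x r y : ℝ, 0 < r → 1 < |x * r - y| → r⁻¹ < |x - y * r⁻¹| := by
      intro x r y hr h
      rw [inv_lt_iff_one_lt_mul₀ hr]
      calc 1 < |x * r - y| := h
        _ = |(x - y * r⁻¹) * r| := by congr 1; field_simp
        _ = _ := by rw [abs_mul, abs_of_pos hr]
    intro l hl z hz
    exact (hgrid l hl z hz).imp (key _ _ _ hK') fun h => by
      rw [div_eq_mul_inv] at h
      exact key _ _ _ (by positivity) h
  obtain ⟨Γ, hΓ⟩ := exists_norm_le_of_periodic hL hc
  obtain ⟨g, hg, hgδ⟩ := exists_deltaTrain ha hΓ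
  obtain ⟨κ₁, C₁, hκ₁, hC₁, hup⟩ := exists_norm_combPairing_tfShift_le ha hb hb1.le hΓ
    h₁.isSubexp_cutoff h₂.isSubexp_cutoff
  obtain ⟨κ₂, C₂, hκ₂, hC₂, hlow⟩ := exists_enorm_symbolPart_le ha hb hb1.le hL hc hd hdual h₁ h₂ hMa
  obtain ⟨B, hB, hBle⟩ := exists_mixedNorm_le hw hγ hCv hβ hvb hβb hκ₁ hC₁
  obtain ⟨A, hA, hAle⟩ := exists_mixedNorm_le hw hγ hCv hβ hvb hβb hκ₂ hC₂
  refine ⟨K, L, hK, hL, c, g, hc, hgδ, fun p q hp hq =>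
    ⟨modulationNorm_deltaTrain_lt_top ha hΓ hg, A⁻¹, B, inv_pos.mpr hA, hB, fun H hH => ?_⟩⟩
  obtain ⟨hsym, hsupp, hnorm⟩ := hH
  have hσ := isSymbol_symbol hsym
  obtain ⟨s, hs⟩ : ∃ s, IsGivenBy (symbol H) s := by
    simp only [opwNorm, distMixedNorm, iInf_lt_iff] at hnorm
    obtain ⟨s, hs, -⟩ := hnorm
    exact ⟨s, hs⟩
  -- An open box containing `M` on which `χ₁ ⊗ χ₂ = 1`, so the symbol is reproduced by convolution
  -- with the transform of this cutoff.
  have hU : IsOpen {z : ℝ × ℝ | |z.1| < ρ ∧ |z.2| < ρ} :=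
    (isOpen_lt (f := fun z : ℝ × ℝ => |z.1|) (g := fun _ => ρ) (by fun_prop) (by fun_prop)).inter
      (isOpen_lt (f := fun z : ℝ × ℝ => |z.2|) (g := fun _ => ρ) (by fun_prop) (by fun_prop))
  obtain ⟨hSm, hSb, hSσ, hSae⟩ := exists_symbol_function (χ := tensor χ₁ χ₂) hs hU
    (fun z hz => hρ z (hsupp hz)) (fun z hz => by
      rw [tensor_apply, hχ₁ _ hz.1, hχ₂ _ hz.2, mul_one])
  have hconv := apply_eq_apply_convS (symbol H) (tensor χ₁ χ₂) hU
    (fun z hz => hρ z (hsupp hz)) (fun z hz => by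
      rw [tensor_apply, hχ₁ _ hz.1, hχ₂ _ hz.2, mul_one])
  have hlow' := hlow (symbol H) (regularize (symbol H) (symplecticFourierTest (tensor χ₁ χ₂)))
  have hpart : symbolPart (symbol H) χ₁ χ₂ =
    regularize (symbol H) (symplecticFourierTest (tensor χ₁ χ₂)) := rfl
  rw [hpart] at hlow'
  -- The same function serves three purposes: it represents the symbol, it is the integrand of the
  -- transpose, and it is the full `symbolPart` that the lower estimate bounds pointwise.
  generalize regularize (symbol H) (symplecticFourierTest (tensor χ₁ χ₂)) = S at *
  have hSp : IsPolyBounded S := ⟨hSm, hSb⟩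
  obtain ⟨T, hT, hTint⟩ := exists_transpose hSp χ₁ χ₂
  -- Replacing the test function by its smoothed version before integrating against `S` is what
  -- makes the transpose act on Schwartz functions.
  have hHT : ∀ f φ, H f φ = ∫ y, f y * T φ y := by
    intro f φ
    rw [hσ, hconv, hSσ, hTint]
  set F : 𝓢'(ℝ, ℂ) := PointwiseConvergenceCLM.precomp ℂ T g with hF
  have hstft : ∀ ζ, stft F ζ =
      ∫ z, S z * combPairing a c χ₁ χ₂ (tfShift ζ.1 (-ζ.2) gaussianWindow) z := fun ζ =>
    deltaTrain_transpose_apply ha hb hb1.le hΓ h₁.isSubexp_cutoff h₂.isSubexp_cutoff hSp hT hg _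
  have hstftm : Measurable (stft F) := by
    have hk := measurable_combPairing_tfShift ha hb hb1.le hΓ h₁.isSubexp_cutoff χ₂
    have h3 : StronglyMeasurable (Function.uncurry fun ζ z : ℝ × ℝ =>
        S z * combPairing a c χ₁ χ₂ (tfShift ζ.1 (-ζ.2) gaussianWindow) z) :=
      ((hSm.comp measurable_snd).mul hk).stronglyMeasurable
    have e : stft F = fun ζ => ∫ z, S z *
        combPairing a c χ₁ χ₂ (tfShift ζ.1 (-ζ.2) gaussianWindow) z := funext hstft
    rw [e]
    exact (StronglyMeasurable.integral_prod_right h3).measurable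
  have hopw : opwNorm p q w H = mixedNorm p q w S := opwNorm_eq_mixedNorm hs hSae
  refine ⟨F, isImage_precomp hHT (exists_boundedWeakStarTendsto ha hΓ hg), ?_, ?_⟩
  · rw [hopw, modulationNorm]
    have h3 := hAle p q hp hq (stft F) S hstftm (hlow' (stft F) hSp hSσ hsupp hstft)
    rw [ENNReal.coe_inv hA.ne', mul_comm, ← div_eq_mul_inv]
    exact ENNReal.div_le_of_le_mul' h3
  · rw [hopw, modulationNorm]
    refine hBle p q hp hq S (stft F) hSm fun ζ => ?_
    rw [hstft]
    exact enorm_integral_mul_le_lintegral (hup ζ)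

end Identification

end OperatorSampling

end

/-! ### The sampling theorem -/

theorem mainTheorem1 (p q : ℝ≥0∞) (hp : 1 ≤ p) (hq : 1 ≤ q)
    (w₁ w₂ : ℝ → ℝ) (v : ℝ × ℝ → ℝ)
    (hv : OperatorSampling.IsSubmultiplicative v) (hv' : OperatorSampling.IsSubexponential v)
    (hw : OperatorSampling.IsModerate v (fun z => w₁ z.1 * w₂ z.2))
    (M : Set (ℝ × ℝ)) (hM : OperatorSampling.outerContent M < 1) :
    OperatorSampling.PermitsOperatorSampling p q (fun z => w₁ z.1 * w₂ z.2) M ∧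
    ∃ (L : ℝ) (c : ℤ → ℂ) (P : ℤ) (g : 𝓢'(ℝ, ℂ)), 0 < L ∧ 0 < P ∧ Function.Periodic c P ∧
      OperatorSampling.IsDeltaSeries c (fun n => n / L) g ∧
      OperatorSampling.IsIdentifiableBy p q (fun z => w₁ z.1 * w₂ z.2) M g := by
  obtain ⟨K, L, hK, hL, c, g, hc, hg, h⟩ := OperatorSampling.exists_isIdentifiableBy hv' hw hM
  have hx : (fun n : ℤ => (n : ℝ) / (K : ℝ)) = fun n : ℤ => n * (K : ℝ)⁻¹ :=
    funext fun n => div_eq_mul_inv _ _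
  -- The sampling rate is the grid parameter `K`, so the nodes are `n / K`, while the grid parameter
  -- `L` is the period of the weights.
  refine ⟨⟨c, _, g, hg, h p q hp hq⟩, K, c, L, g, by exact_mod_cast hK, by exact_mod_cast hL, hc, ?_,
    h p q hp hq⟩
  rw [hx]
  exact hg
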